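/- Let $A$ be a separable C*-algebra (not necessarily unital), let $G$ be a second countable, compact (Hausdorff) group, and let $\alpha\colon G\curvearrowright A$ be a point-norm continuous action by $*$-automorphisms. Let $A_\infty=\ell^\infty(\mathbb N,A)/c_0(\mathbb N,A)$, into which $A$ embeds as constant sequences, and let $F_\infty(A)=(A_\infty\cap A')/\{x\in A_\infty : xa=ax=0 \text{ for all } a\in A\}$, which is a unital C*-algebra. The automorphisms $\alpha_g$, applied componentwise, induce automorphisms $\tilde\alpha_{\infty,g}$ of $F_\infty(A)$; let $F_{\infty,\alpha}(A)$ be the subalgebra of those $y$ for which $g\mapsto\tilde\alpha_{\infty,g}(y)$ is norm continuous. Let $\sigma_g(f)=f(g^{-1}\,\cdot\,)$ for $f\in C(G)$. Assume that $\alpha$ has the Rokhlin property, that is, there is a unital equivariant $*$-homomorphism $(C(G),\sigma)\to(F_{\infty,\alpha}(A),\tilde\alpha_\infty)$. Let $A^\alpha$ be the fixed point algebra, let $\alpha_{\mathrm{co}}\colon A\to C(G)\otimes A=C(G,A)$ be given by $\alpha_{\mathrm{co}}(a)(g)=\alpha_g(a)$, and let $1\otimes\mathrm{id}_A\colon A\to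 C(G,A)$ send $a$ to the constant function $a$. Then for $i=0,1$ the inclusion $A^\alpha\subseteq A$ induces an injective homomorphism $K_i(A^\alpha)\to K_i(A)$, and $$\mathrm{im}\big(K_i(A^\alpha)\hookrightarrow K_i(A)\big)=\{x\in K_i(A) : K_i(\alpha_{\mathrm{co}})(x)=K_i(1\otimes\mathrm{id}_A)(x)\in K_i(C(G)\otimes A)\}.$$ For every $n\ge 2$ the same holds for K-theory with coefficients in $\mathbb Z_n=\mathbb Z/n\mathbb Z$, where $K_i(B;\mathbb Z_n)=K_i(B\otimes\mathcal O_{n+1})$ and $\mathcal O_{n+1}$ is the Cuntz algebra: for $i=0,1$ the homomorphism $K_i(A^\alpha;\mathbb Z_n)\to K_i(A;\mathbb Z_n)$ is injective with image $$\{x\in K_i(A;\mathbb Z_n) : K_i(\alpha_{\mathrm{co}};\mathbb Z_n)(x)=K_i(1\otimes\mathrm{id}_A;\mathbb Z_n)(x)\in K_i(C(G)\otimes A;\mathbb Z_n)\}.$$ -/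

import Mathlib

open scoped ENNReal Topology Matrix
open Filter

noncomputable section

namespace KTheory

theorem continuous_starHom {A B : Type*} [NonUnitalCStarAlgebra A] [NonUnitalCStarAlgebra B]
    (φ : A →⋆ₙₐ[ℂ] B) : Continuous φ :=
  AddMonoidHomClass.continuous_of_bound φ 1 fun x => by
    simpa using NonUnitalStarAlgHom.norm_apply_le φ x

section VMonoid

variable {B : Type*} [Ring B] [StarRing B]

/-- Murray--von Neumann equivalence of square matrices over `B`, possibly of different sizes,
implemented by a rectangular matrix. -/
def MvN {ι κ : Type*} [Fintype ι] [Fintype κ] (p : Matrix ι ι B) (q : Matrix κ κ B) : Prop :=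
  ∃ v : Matrix κ ι B, vᴴ * v = p ∧ v * vᴴ = q

theorem MvN.symm {ι κ : Type*} [Fintype ι] [Fintype κ] {p : Matrix ι ι B} {q : Matrix κ κ B}
    (h : MvN p q) : MvN q p := by
  obtain ⟨v, h1, h2⟩ := h
  exact ⟨vᴴ, by simpa using h2, by simpa using h1⟩

theorem MvN.trans {ι κ μ : Type*} [Fintype ι] [Fintype κ] [Fintype μ]
    {p : Matrix ι ι B} {q : Matrix κ κ B} {r : Matrix μ μ B}
    (hp : p * p = p) (hr : r * r = r) (h : MvN p q) (h' : MvN q r) : MvN p r := by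
  obtain ⟨v, h1, h2⟩ := h
  obtain ⟨w, h3, h4⟩ := h'
  refine ⟨w * v, ?_, ?_⟩
  · calc (w * v)ᴴ * (w * v) = vᴴ * (wᴴ * w) * v := by
          simp only [Matrix.conjTranspose_mul, Matrix.mul_assoc]
      _ = (vᴴ * v) * (vᴴ * v) := by rw [h3, ← h2]; simp only [Matrix.mul_assoc]
      _ = p := by rw [h1, hp]
  · calc (w * v) * (w * v)ᴴ = w * (v * vᴴ) * wᴴ := by
          simp only [Matrix.conjTranspose_mul, Matrix.mul_assoc]
      _ = (w * wᴴ) * (w * wᴴ) := by rw [h2, ← h3]; simp only [Matrix.mul_assoc]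
      _ = r := by rw [h4, hr]

theorem MvN.of_projection {ι : Type*} [Fintype ι] {p : Matrix ι ι B} (hp : IsStarProjection p) :
    MvN p p := by
  have h1 : pᴴ = p := hp.isSelfAdjoint
  have h2 : p * p = p := hp.isIdempotentElem
  exact ⟨p, by rw [h1, h2], by rw [h1, h2]⟩

theorem MvN.of_submatrix {ι κ : Type*} [Fintype ι] [Fintype κ] [DecidableEq ι]
    {p : Matrix ι ι B} (hp : IsStarProjection p) (e : κ ≃ ι) : MvN p (p.submatrix e e) := by
  have h1 : pᴴ = p := hp.isSelfAdjoint
  have h2 : p * p = p := hp.isIdempotentElem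
  refine ⟨p.submatrix e id, ?_, ?_⟩
  · rw [Matrix.conjTranspose_submatrix, h1, Matrix.submatrix_mul_equiv, h2, Matrix.submatrix_id_id]
  · rw [Matrix.conjTranspose_submatrix, h1, Matrix.submatrix_mul _ _ _ _ _ Function.bijective_id |>.symm, h2]

theorem MvN.fromBlocks {ι κ ι' κ' : Type*} [Fintype ι] [Fintype κ] [Fintype ι'] [Fintype κ']
    {p : Matrix ι ι B} {q : Matrix κ κ B} {p' : Matrix ι' ι' B} {q' : Matrix κ' κ' B}
    (h : MvN p q) (h' : MvN p' q') :
    MvN (Matrix.fromBlocks p 0 0 p') (Matrix.fromBlocks q 0 0 q') := by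
  obtain ⟨v, h1, h2⟩ := h
  obtain ⟨w, h3, h4⟩ := h'
  refine ⟨Matrix.fromBlocks v 0 0 w, ?_, ?_⟩ <;>
    simp [Matrix.fromBlocks_conjTranspose, Matrix.fromBlocks_multiply, h1, h2, h3, h4]

theorem isStarProjection_fromBlocks {ι κ : Type*} [Fintype ι] [Fintype κ]
    {p : Matrix ι ι B} {q : Matrix κ κ B} (hp : IsStarProjection p) (hq : IsStarProjection q) :
    IsStarProjection (Matrix.fromBlocks p 0 0 q) := by
  have h1 : pᴴ = p := hp.isSelfAdjoint
  have h2 : p * p = p := hp.isIdempotentElem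
  have h3 : qᴴ = q := hq.isSelfAdjoint
  have h4 : q * q = q := hq.isIdempotentElem
  constructor
  · show _ * _ = _
    simp [Matrix.fromBlocks_multiply, h2, h4]
  · show (_)ᴴ = _
    simp [Matrix.fromBlocks_conjTranspose, h1, h3]

theorem isStarProjection_submatrix {ι κ : Type*} [Fintype ι] [Fintype κ]
    {p : Matrix ι ι B} (hp : IsStarProjection p) (e : κ ≃ ι) :
    IsStarProjection (p.submatrix e e) := by
  have h1 : pᴴ = p := hp.isSelfAdjoint
  have h2 : p * p = p := hp.isIdempotentElem
  constructor
  · show _ * _ = _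
    rw [Matrix.submatrix_mul_equiv, h2]
  · show (_)ᴴ = _
    rw [Matrix.conjTranspose_submatrix, h1]

variable (B) in
/-- Projections in `⋃ₙ Mₙ(B)`. -/
abbrev MatProj : Type _ := Σ n : ℕ, {p : Matrix (Fin n) (Fin n) B // IsStarProjection p}

/-- The direct sum `p ⊕ q` of two matrix projections. -/
def MatProj.dsum (p q : MatProj B) : MatProj B :=
  ⟨p.1 + q.1, (Matrix.fromBlocks p.2.1 0 0 q.2.1).submatrix finSumFinEquiv.symm finSumFinEquiv.symm,
    isStarProjection_submatrix (isStarProjection_fromBlocks p.2.2 q.2.2) _⟩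

variable (B) in
instance matProjSetoid : Setoid (MatProj B) where
  r p q := MvN p.2.1 q.2.1
  iseqv :=
    { refl := fun p => MvN.of_projection p.2.2
      symm := fun h => h.symm
      trans := fun {p _ r} h h' => MvN.trans p.2.2.isIdempotentElem r.2.2.isIdempotentElem h h' }

variable (B) in
/-- The monoid `V(B)` of Murray--von Neumann classes of projections in matrices over `B`. -/
def VMonoid : Type _ := Quotient (matProjSetoid B)

/-- The class `[p] ∈ V(B)` of a matrix projection. -/
def VMonoid.mk (p : MatProj B) : VMonoid B := Quotient.mk _ p

theorem MatProj.dsum_equiv (p q : MatProj B) :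
    MvN (Matrix.fromBlocks p.2.1 0 0 q.2.1) (MatProj.dsum p q).2.1 :=
  MvN.of_submatrix (isStarProjection_fromBlocks p.2.2 q.2.2) _

instance : Add (VMonoid B) where
  add := Quotient.map₂ MatProj.dsum fun p p' hp q q' hq => by
    have h1 := (MatProj.dsum_equiv p q).symm
    have h2 := MatProj.dsum_equiv p' q'
    have h3 := MvN.fromBlocks hp hq
    exact MvN.trans (MatProj.dsum p q).2.2.isIdempotentElem
      (MatProj.dsum p' q').2.2.isIdempotentElem h1
      (MvN.trans (isStarProjection_fromBlocks p.2.2 q.2.2).isIdempotentElem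
        (MatProj.dsum p' q').2.2.isIdempotentElem h3 h2)

instance : Zero (VMonoid B) where
  zero := Quotient.mk _ ⟨0, 0, .zero _⟩

theorem MatProj.dsum_comm (p q : MatProj B) : MvN (p.dsum q).2.1 (q.dsum p).2.1 := by
  refine MvN.trans (p.dsum q).2.2.isIdempotentElem (q.dsum p).2.2.isIdempotentElem
    (p.dsum_equiv q).symm ?_
  refine MvN.trans (isStarProjection_fromBlocks p.2.2 q.2.2).isIdempotentElem
    (q.dsum p).2.2.isIdempotentElem ?_ (q.dsum_equiv p)
  have := MvN.of_submatrix (isStarProjection_fromBlocks p.2.2 q.2.2) (Equiv.sumComm _ _)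
  convert this using 1
  ext (i | i) (j | j) <;> simp

theorem MatProj.dsum_assoc (p q r : MatProj B) :
    MvN ((p.dsum q).dsum r).2.1 (p.dsum (q.dsum r)).2.1 := by
  have hL := MvN.trans (isStarProjection_fromBlocks (isStarProjection_fromBlocks p.2.2 q.2.2)
      r.2.2).isIdempotentElem ((p.dsum q).dsum r).2.2.isIdempotentElem
    (MvN.fromBlocks (p.dsum_equiv q) (MvN.of_projection r.2.2)) ((p.dsum q).dsum_equiv r)
  have hR := MvN.trans (isStarProjection_fromBlocks p.2.2 (isStarProjection_fromBlocks q.2.2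
      r.2.2)).isIdempotentElem (p.dsum (q.dsum r)).2.2.isIdempotentElem
    (MvN.fromBlocks (MvN.of_projection p.2.2) (q.dsum_equiv r)) (p.dsum_equiv (q.dsum r))
  refine MvN.trans ((p.dsum q).dsum r).2.2.isIdempotentElem
    (p.dsum (q.dsum r)).2.2.isIdempotentElem hL.symm ?_
  refine MvN.trans (isStarProjection_fromBlocks (isStarProjection_fromBlocks p.2.2 q.2.2)
    r.2.2).isIdempotentElem (p.dsum (q.dsum r)).2.2.isIdempotentElem ?_ hR
  have := MvN.of_submatrix (isStarProjection_fromBlocks (isStarProjection_fromBlocks p.2.2 q.2.2)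
    r.2.2) (Equiv.sumAssoc _ _ _).symm
  convert this using 1
  ext (i | i | i) (j | j | j) <;> simp

theorem MatProj.zero_dsum (p : MatProj B) :
    MvN (MatProj.dsum ⟨0, 0, .zero _⟩ p).2.1 p.2.1 := by
  refine MvN.trans (MatProj.dsum ⟨0, 0, .zero _⟩ p).2.2.isIdempotentElem
    p.2.2.isIdempotentElem (MatProj.dsum_equiv _ p).symm ?_
  have := MvN.of_submatrix (isStarProjection_fromBlocks
    (.zero (Matrix (Fin 0) (Fin 0) B)) p.2.2) (Equiv.emptySum (Fin 0) _).symm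
  convert this using 1
  ext i j
  simp

instance : AddCommMonoid (VMonoid B) where
  add_assoc := by
    rintro ⟨p⟩ ⟨q⟩ ⟨r⟩
    exact Quotient.sound (MatProj.dsum_assoc p q r)
  add_comm := by
    rintro ⟨p⟩ ⟨q⟩
    exact Quotient.sound (MatProj.dsum_comm p q)
  zero_add := by
    rintro ⟨p⟩
    exact Quotient.sound (MatProj.zero_dsum p)
  add_zero := by
    rintro ⟨p⟩
    refine Quotient.sound (?_ : MvN _ _)
    exact MvN.trans (MatProj.dsum _ _).2.2.isIdempotentElem p.2.2.isIdempotentElem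
      (MatProj.dsum_comm p ⟨0, 0, .zero _⟩) (MatProj.zero_dsum p)
  nsmul := nsmulRec

theorem MvN.map {C : Type*} [Ring C] [StarRing C] [Algebra ℂ B] [Algebra ℂ C]
    (φ : B →⋆ₐ[ℂ] C) {ι κ : Type*} [Fintype ι] [Fintype κ] {p : Matrix ι ι B} {q : Matrix κ κ B}
    (h : MvN p q) : MvN (p.map φ) (q.map φ) := by
  obtain ⟨v, h1, h2⟩ := h
  refine ⟨v.map φ, ?_, ?_⟩
  · rw [← Matrix.conjTranspose_map (f := φ) (fun x => map_star φ x), ← Matrix.map_mul, h1]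
  · rw [← Matrix.conjTranspose_map (f := φ) (fun x => map_star φ x), ← Matrix.map_mul, h2]

/-- Entrywise application of a unital `*`-homomorphism to a matrix projection. -/
def MatProj.map {C : Type*} [Ring C] [StarRing C] [Algebra ℂ B] [Algebra ℂ C]
    (φ : B →⋆ₐ[ℂ] C) (p : MatProj B) : MatProj C :=
  ⟨p.1, p.2.1.map φ, by
    have h1 : p.2.1ᴴ = p.2.1 := p.2.2.isSelfAdjoint
    have h2 : p.2.1 * p.2.1 = p.2.1 := p.2.2.isIdempotentElem
    constructor
    · show _ * _ = _
      rw [← Matrix.map_mul, h2]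
    · show (_)ᴴ = _
      rw [← Matrix.conjTranspose_map (f := φ) (fun x => map_star φ x), h1]⟩

/-- Functoriality of `V`. -/
def VMonoid.map {C : Type*} [Ring C] [StarRing C] [Algebra ℂ B] [Algebra ℂ C]
    (φ : B →⋆ₐ[ℂ] C) : VMonoid B →+ VMonoid C where
  toFun := Quotient.map (MatProj.map φ) fun _ _ h => MvN.map φ h
  map_zero' := by
    refine Quotient.sound (?_ : MvN _ _)
    exact ⟨(0 : Matrix (Fin 0) (Fin 0) C), Matrix.ext fun i => i.elim0, Matrix.ext fun i => i.elim0⟩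
  map_add' := by
    rintro ⟨p⟩ ⟨q⟩
    refine congrArg (Quotient.mk _) ?_
    refine Sigma.ext rfl (heq_of_eq (Subtype.ext ?_))
    have h : ((Matrix.fromBlocks p.2.1 0 0 q.2.1).submatrix finSumFinEquiv.symm
        finSumFinEquiv.symm).map φ = (Matrix.fromBlocks (p.2.1.map φ) 0 0 (q.2.1.map φ)).submatrix
        finSumFinEquiv.symm finSumFinEquiv.symm := by
      rw [← Matrix.submatrix_map, Matrix.fromBlocks_map, Matrix.map_zero _ (map_zero φ),
        Matrix.map_zero _ (map_zero φ)]
    exact h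

variable (B) in
/-- The Grothendieck group of `V(B)`; this is `K₀(B)` when `B` is a unital C*-algebra. -/
abbrev K00 : Type _ := Algebra.GrothendieckAddGroup (VMonoid B)

/-- Functoriality of `K00`. -/
def K00.map {C : Type*} [Ring C] [StarRing C] [Algebra ℂ B] [Algebra ℂ C]
    (φ : B →⋆ₐ[ℂ] C) : K00 B →+ K00 C :=
  Algebra.GrothendieckAddGroup.lift (Algebra.GrothendieckAddGroup.of.comp (VMonoid.map φ))

theorem K00.map_of {C : Type*} [Ring C] [StarRing C] [Algebra ℂ B] [Algebra ℂ C]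
    (φ : B →⋆ₐ[ℂ] C) (x : VMonoid B) :
    K00.map φ (Algebra.GrothendieckAddGroup.of x)
      = Algebra.GrothendieckAddGroup.of (VMonoid.map φ x) :=
  DFunLike.congr_fun (Algebra.GrothendieckAddGroup.lift.symm_apply_apply
    (Algebra.GrothendieckAddGroup.of.comp (VMonoid.map φ))) x

end VMonoid

section K0

variable (A : Type*) [NonUnitalCStarAlgebra A]

/-- The canonical character `ε : Ã → ℂ` of the (minimal, forced) unitization. -/
def unitizationChar : Unitization ℂ A →⋆ₐ[ℂ] ℂ :=
  { Unitization.fstHom ℂ A with map_star' := fun _ => rfl }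

/-- `K₀(A) = ker (K₀(Ã) → K₀(ℂ))`. -/
def K0 : Type _ := (K00.map (unitizationChar A)).ker

instance : AddCommGroup (K0 A) := inferInstanceAs (AddCommGroup (K00.map (unitizationChar A)).ker)

variable {A} {B : Type*} [NonUnitalCStarAlgebra B]

theorem K00_char_map (φ : A →⋆ₙₐ[ℂ] B) (x : K00 (Unitization ℂ A)) :
    K00.map (unitizationChar B) (K00.map (Unitization.starMap φ) x)
      = K00.map (unitizationChar A) x := by
  suffices h : (K00.map (unitizationChar B)).comp (K00.map (Unitization.starMap φ))
      = K00.map (unitizationChar A) from DFunLike.congr_fun h x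
  apply Algebra.GrothendieckAddGroup.lift.symm.injective
  ext x
  obtain ⟨p⟩ := x
  have key : VMonoid.map (unitizationChar B) (VMonoid.map (Unitization.starMap φ)
      (VMonoid.mk p)) = VMonoid.map (unitizationChar A) (VMonoid.mk p) := by
    refine congrArg (Quotient.mk _) (Sigma.ext rfl (heq_of_eq (Subtype.ext ?_)))
    ext i j
    show (Unitization.starMap φ (p.2.1 i j)).fst = (p.2.1 i j).fst
    induction p.2.1 i j with
    | inl_add_inr r a => simp [Unitization.algebraMap_eq_inl]
  show K00.map (unitizationChar B) (K00.map (Unitization.starMap φ)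
    (Algebra.GrothendieckAddGroup.of (VMonoid.mk p)))
      = K00.map (unitizationChar A) (Algebra.GrothendieckAddGroup.of (VMonoid.mk p))
  rw [K00.map_of, K00.map_of, K00.map_of, key]

/-- The homomorphism `K₀(φ) : K₀(A) → K₀(B)`. -/
def K0.map (φ : A →⋆ₙₐ[ℂ] B) : K0 A →+ K0 B :=
  ((K00.map (Unitization.starMap φ)).comp (K00.map (unitizationChar A)).ker.subtype).codRestrict
    (K00.map (unitizationChar B)).ker fun x => by
      have hx : K00.map (unitizationChar A) x = 0 := x.2
      show K00.map (unitizationChar B) (K00.map (Unitization.starMap φ) x) = 0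
      rw [K00_char_map, hx]

end K0

section K1

variable {B : Type*} [Ring B]

/-- The embedding `Mₙ(B) → Mₘ(B)`, `u ↦ u ⊕ 1`, for `n ≤ m`. -/
def padOne {n m : ℕ} (h : n ≤ m) (u : Matrix (Fin n) (Fin n) B) : Matrix (Fin m) (Fin m) B :=
  (Matrix.fromBlocks u 0 0 (1 : Matrix (Fin (m - n)) (Fin (m - n)) B)).submatrix
    (finSumFinEquiv.trans (finCongr (Nat.add_sub_of_le h))).symm
    (finSumFinEquiv.trans (finCongr (Nat.add_sub_of_le h))).symm

theorem padOne_apply {n m : ℕ} (h : n ≤ m) (u : Matrix (Fin n) (Fin n) B) (i j : Fin m) :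
    padOne h u i j = if hij : i.1 < n ∧ j.1 < n then u ⟨i, hij.1⟩ ⟨j, hij.2⟩
      else if i = j then 1 else 0 := by
  obtain ⟨i, rfl⟩ := (finSumFinEquiv.trans (finCongr (Nat.add_sub_of_le h))).surjective i
  obtain ⟨j, rfl⟩ := (finSumFinEquiv.trans (finCongr (Nat.add_sub_of_le h))).surjective j
  unfold padOne
  rw [Matrix.submatrix_apply, Equiv.symm_apply_apply, Equiv.symm_apply_apply]
  rcases i with i | i <;> rcases j with j | j <;>
    simp [Matrix.one_apply, Fin.ext_iff] <;> omega

variable [StarRing B]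

/-- The embedding `u ↦ u ⊕ 1` as a homomorphism of unitary groups. -/
def unitaryPad {n m : ℕ} (h : n ≤ m) :
    unitary (Matrix (Fin n) (Fin n) B) →* unitary (Matrix (Fin m) (Fin m) B) :=
  (Unitary.map
    { toFun := padOne h
      map_one' := by rw [padOne, Matrix.fromBlocks_one, Matrix.submatrix_one_equiv]
      map_mul' := fun u v => by
        rw [padOne, padOne, padOne, Matrix.submatrix_mul_equiv, Matrix.fromBlocks_multiply]
        simp only [Matrix.mul_zero, Matrix.zero_mul, add_zero, zero_add, Matrix.mul_one]
      map_star' := fun u => by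
        simp [padOne, Matrix.star_eq_conjTranspose, Matrix.conjTranspose_submatrix,
          Matrix.fromBlocks_conjTranspose] } :
    unitary (Matrix (Fin n) (Fin n) B) →⋆* unitary (Matrix (Fin m) (Fin m) B)).toMonoidHom

variable [TopologicalSpace B]

theorem continuous_unitaryPad {n m : ℕ} (h : n ≤ m) :
    Continuous (unitaryPad (B := B) h) := by
  refine continuous_induced_rng.2 (continuous_matrix fun i j => ?_)
  show Continuous fun u : unitary (Matrix (Fin n) (Fin n) B) => padOne h u.1 i j
  simp only [padOne_apply]
  split_ifs with h1
  · exact continuous_subtype_val.matrix_elem _ _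
  all_goals exact continuous_const

variable [IsTopologicalRing B] [ContinuousStar B]

theorem pathComponentOne_le_comap {G H : Type*} [Group G] [TopologicalSpace G]
    [IsTopologicalGroup G] [Group H] [TopologicalSpace H] [IsTopologicalGroup H]
    (f : G →* H) (hf : Continuous f) :
    Subgroup.pathComponentOne G ≤ (Subgroup.pathComponentOne H).comap f := by
  intro x hx
  have : Joined (1 : G) x := hx
  have h2 : Joined (f 1) (f x) := this.map hf
  rw [map_one] at h2
  exact h2

variable (B) in
/-- The group `Uₙ(B) / Uₙ(B)₀` of homotopy classes of unitaries in `Mₙ(B)`. -/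
abbrev UPi0 (n : ℕ) : Type _ :=
  unitary (Matrix (Fin n) (Fin n) B) ⧸
    Subgroup.pathComponentOne (unitary (Matrix (Fin n) (Fin n) B))

variable (B) in
/-- The connecting maps `Uₙ(B) / Uₙ(B)₀ → Uₘ(B) / Uₘ(B)₀`, `[u] ↦ [u ⊕ 1]`. -/
def UPi0.pad (n m : ℕ) (h : n ≤ m) : UPi0 B n →* UPi0 B m :=
  QuotientGroup.map _ _ (unitaryPad h) (pathComponentOne_le_comap _ (continuous_unitaryPad h))

instance : DirectedSystem (UPi0 B) (UPi0.pad B · · ·) where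
  map_self := by
    rintro n ⟨u⟩
    refine congrArg (QuotientGroup.mk) (Subtype.ext ?_)
    show padOne le_rfl u.1 = u.1
    ext i j
    simp [padOne_apply]
  map_map := by
    rintro n m k hij hjk ⟨u⟩
    refine congrArg (QuotientGroup.mk) (Subtype.ext ?_)
    show padOne hjk (padOne hij u.1) = padOne (hij.trans hjk) u.1
    ext i j
    simp only [padOne_apply, Fin.ext_iff]
    split_ifs <;> first | rfl | omega

variable (B) in
/-- The direct limit of the groups `Uₙ(B) / Uₙ(B)₀` along `u ↦ u ⊕ 1`. -/
abbrev UStable : Type _ := DirectLimit (UPi0 B) (UPi0.pad B)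

variable {C : Type*} [Ring C] [StarRing C] [TopologicalSpace C] [IsTopologicalRing C]
  [ContinuousStar C] [Algebra ℂ B] [Algebra ℂ C]

/-- The homomorphism `Uₙ(B) / Uₙ(B)₀ → Uₙ(C) / Uₙ(C)₀` induced by a continuous unital
`*`-homomorphism, applied entrywise. -/
def UPi0.map (φ : B →⋆ₐ[ℂ] C) (hφ : Continuous φ) (n : ℕ) : UPi0 B n →* UPi0 C n :=
  QuotientGroup.map _ _
    (Unitary.map
      { toFun := fun u => u.map φ
        map_one' := Matrix.map_one _ (map_zero φ) (map_one φ)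
        map_mul' := fun _ _ => Matrix.map_mul
        map_star' := fun _ => Matrix.conjTranspose_map (f := φ) (fun x => map_star φ x) } :
      unitary (Matrix (Fin n) (Fin n) B) →⋆* unitary (Matrix (Fin n) (Fin n) C)).toMonoidHom
    (pathComponentOne_le_comap _
      (Continuous.subtype_mk (continuous_subtype_val.matrix_map hφ) _))

/-- Functoriality of `UStable`. -/
def UStable.map (φ : B →⋆ₐ[ℂ] C) (hφ : Continuous φ) : UStable B →* UStable C :=
  MonoidHom.mk'
    (DirectLimit.map (UPi0.pad B) (UPi0.pad C) (fun n => UPi0.map φ hφ n) (by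
      rintro n m h ⟨u⟩
      refine congrArg (QuotientGroup.mk) (Subtype.ext ?_)
      show padOne h (u.1.map φ) = (padOne h u.1).map φ
      ext i j
      simp only [padOne_apply, Matrix.map_apply]
      split_ifs <;> simp))
    (by
      intro x y
      obtain ⟨n, u, v, rfl, rfl⟩ := DirectLimit.exists_eq_mk₂ _ x y
      rw [DirectLimit.mul_def]
      simp only [DirectLimit.map_def, DirectLimit.mul_def, map_mul])

/-- `K₁(A)`: the direct limit of the groups of homotopy classes of unitaries in `Mₙ(Ã)`.
The group operation is written multiplicatively. -/
def K1 (A : Type*) [NonUnitalCStarAlgebra A] : Type _ := UStable (Unitization ℂ A)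

instance (A : Type*) [NonUnitalCStarAlgebra A] : Group (K1 A) :=
  inferInstanceAs (Group (UStable (Unitization ℂ A)))

/-- The homomorphism `K₁(φ) : K₁(A) → K₁(B)`. -/
def K1.map {A B : Type*} [NonUnitalCStarAlgebra A] [NonUnitalCStarAlgebra B]
    (φ : A →⋆ₙₐ[ℂ] B) : K1 A →* K1 B :=
  UStable.map (Unitization.starMap φ) (continuous_starHom (Unitization.starMap φ).toNonUnitalStarAlgHom)

end K1

end KTheory

namespace Rokhlin

/-- A closed two-sided `*`-ideal. -/
structure ClosedStarIdeal (E : Type*) [NonUnitalNormedRing E] [StarRing E] [NormedSpace ℂ E]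
    extends Submodule ℂ E where
  mul_left_mem' : ∀ x {y : E}, y ∈ carrier → x * y ∈ carrier
  mul_right_mem' : ∀ {x : E} y, x ∈ carrier → x * y ∈ carrier
  star_mem' : ∀ {x : E}, x ∈ carrier → star x ∈ carrier
  isClosed' : IsClosed carrier

namespace ClosedStarIdeal

variable {E : Type*} [NonUnitalNormedRing E] [StarRing E] [NormedSpace ℂ E]

/-- The quotient of `E` by a closed two-sided `*`-ideal, with the quotient norm. -/
def Quo (I : ClosedStarIdeal E) : Type _ := E ⧸ I.toSubmodule

variable (I : ClosedStarIdeal E)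

instance : IsClosed (I.toSubmodule : Set E) := I.isClosed'

instance : NormedAddCommGroup I.Quo :=
  inferInstanceAs (NormedAddCommGroup (E ⧸ I.toSubmodule))

instance : NormedSpace ℂ I.Quo := inferInstanceAs (NormedSpace ℂ (E ⧸ I.toSubmodule))

/-- The quotient map as a linear map. -/
def mkₗ : E →ₗ[ℂ] I.Quo := I.toSubmodule.mkQ

theorem mkₗ_surjective : Function.Surjective I.mkₗ := I.toSubmodule.mkQ_surjective

theorem mkₗ_eq_iff {x y : E} : I.mkₗ x = I.mkₗ y ↔ x - y ∈ I.toSubmodule :=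
  Submodule.Quotient.eq _

instance : Mul I.Quo where
  mul := Quotient.map₂ (· * ·) fun x x' hx y y' hy => by
    have hx' : x - x' ∈ I.toSubmodule := (Submodule.quotientRel_def _).1 hx
    have hy' : y - y' ∈ I.toSubmodule := (Submodule.quotientRel_def _).1 hy
    refine (Submodule.quotientRel_def _).2 ?_
    have : x * y - x' * y' = (x - x') * y + x' * (y - y') := by noncomm_ring
    rw [this]
    exact add_mem (I.mul_right_mem' _ hx') (I.mul_left_mem' _ hy')

instance : Star I.Quo where
  star := Quotient.map star fun x x' hx => by
    have hx' : x - x' ∈ I.toSubmodule := (Submodule.quotientRel_def _).1 hx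
    refine (Submodule.quotientRel_def _).2 ?_
    rw [← star_sub]
    exact I.star_mem' hx'

theorem mkₗ_mul (x y : E) : I.mkₗ (x * y) = I.mkₗ x * I.mkₗ y := rfl

theorem mkₗ_star (x : E) : I.mkₗ (star x) = star (I.mkₗ x) := rfl

instance : NonUnitalRing I.Quo where
  __ : NormedAddCommGroup I.Quo := inferInstance
  left_distrib x y z := by
    obtain ⟨x, rfl⟩ := I.mkₗ_surjective x
    obtain ⟨y, rfl⟩ := I.mkₗ_surjective y
    obtain ⟨z, rfl⟩ := I.mkₗ_surjective z
    rw [← map_add, ← mkₗ_mul, mul_add, map_add, mkₗ_mul, mkₗ_mul]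
  right_distrib x y z := by
    obtain ⟨x, rfl⟩ := I.mkₗ_surjective x
    obtain ⟨y, rfl⟩ := I.mkₗ_surjective y
    obtain ⟨z, rfl⟩ := I.mkₗ_surjective z
    rw [← map_add, ← mkₗ_mul, add_mul, map_add, mkₗ_mul, mkₗ_mul]
  zero_mul x := by
    obtain ⟨x, rfl⟩ := I.mkₗ_surjective x
    rw [← map_zero I.mkₗ, ← mkₗ_mul, zero_mul]
  mul_zero x := by
    obtain ⟨x, rfl⟩ := I.mkₗ_surjective x
    rw [← map_zero I.mkₗ, ← mkₗ_mul, mul_zero]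
  mul_assoc x y z := by
    obtain ⟨x, rfl⟩ := I.mkₗ_surjective x
    obtain ⟨y, rfl⟩ := I.mkₗ_surjective y
    obtain ⟨z, rfl⟩ := I.mkₗ_surjective z
    rw [← mkₗ_mul, ← mkₗ_mul, ← mkₗ_mul, ← mkₗ_mul, mul_assoc]

instance : NonUnitalNormedRing I.Quo where
  __ : NormedAddCommGroup I.Quo := inferInstance
  __ : NonUnitalRing I.Quo := inferInstance
  norm_mul_le x y := by
    refine le_of_forall_pos_le_add fun ε hε => ?_
    have hcont : Tendsto (fun δ : ℝ => (‖x‖ + δ) * (‖y‖ + δ)) (𝓝[>] 0) (𝓝 (‖x‖ * ‖y‖)) := by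
      have : Continuous fun δ : ℝ => (‖x‖ + δ) * (‖y‖ + δ) := by fun_prop
      simpa using (this.tendsto 0).mono_left nhdsWithin_le_nhds
    obtain ⟨δ, hδ, hδ0⟩ := ((hcont.eventually (gt_mem_nhds (lt_add_of_pos_right _ hε))).and
      self_mem_nhdsWithin).exists
    obtain ⟨a, rfl, ha⟩ := Submodule.Quotient.norm_mk_lt (S := I.toSubmodule) x hδ0
    obtain ⟨b, rfl, hb⟩ := Submodule.Quotient.norm_mk_lt (S := I.toSubmodule) y hδ0
    refine le_trans ?_ hδ.le
    refine (Submodule.Quotient.norm_mk_le I.toSubmodule (a * b)).trans ((norm_mul_le a b).trans ?_)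
    exact mul_le_mul ha.le hb.le (norm_nonneg _) ((norm_nonneg _).trans ha.le)

instance : StarRing I.Quo where
  star_involutive x := by
    obtain ⟨x, rfl⟩ := I.mkₗ_surjective x
    rw [← mkₗ_star, ← mkₗ_star, star_star]
  star_mul x y := by
    obtain ⟨x, rfl⟩ := I.mkₗ_surjective x
    obtain ⟨y, rfl⟩ := I.mkₗ_surjective y
    rw [← mkₗ_mul, ← mkₗ_star, star_mul, mkₗ_mul, mkₗ_star, mkₗ_star]
  star_add x y := by
    obtain ⟨x, rfl⟩ := I.mkₗ_surjective x
    obtain ⟨y, rfl⟩ := I.mkₗ_surjective y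
    rw [← map_add, ← mkₗ_star, star_add, map_add, mkₗ_star, mkₗ_star]

instance [StarModule ℂ E] : StarModule ℂ I.Quo where
  star_smul c x := by
    obtain ⟨x, rfl⟩ := I.mkₗ_surjective x
    rw [← map_smul, ← mkₗ_star, star_smul, map_smul, mkₗ_star]

instance [IsScalarTower ℂ E E] : IsScalarTower ℂ I.Quo I.Quo where
  smul_assoc c x y := by
    obtain ⟨x, rfl⟩ := I.mkₗ_surjective x
    obtain ⟨y, rfl⟩ := I.mkₗ_surjective y
    rw [smul_eq_mul, smul_eq_mul, ← map_smul, ← mkₗ_mul, smul_mul_assoc, map_smul, mkₗ_mul]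

instance [SMulCommClass ℂ E E] : SMulCommClass ℂ I.Quo I.Quo where
  smul_comm c x y := by
    obtain ⟨x, rfl⟩ := I.mkₗ_surjective x
    obtain ⟨y, rfl⟩ := I.mkₗ_surjective y
    rw [smul_eq_mul, smul_eq_mul, ← mkₗ_mul, ← map_smul, ← map_smul, ← mkₗ_mul, mul_smul_comm]

/-- The quotient `*`-homomorphism. -/
def proj : E →⋆ₙₐ[ℂ] I.Quo where
  toFun := I.mkₗ
  map_smul' := map_smul I.mkₗ
  map_zero' := map_zero I.mkₗ
  map_add' := map_add I.mkₗ
  map_mul' := I.mkₗ_mul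
  map_star' := I.mkₗ_star

/-- The `*`-homomorphism between quotients induced by a `*`-homomorphism mapping one ideal into
the other. -/
def mapQuo {E' : Type*} [NonUnitalNormedRing E'] [StarRing E'] [NormedSpace ℂ E']
    (I : ClosedStarIdeal E) (J : ClosedStarIdeal E') (φ : E →⋆ₙₐ[ℂ] E')
    (h : ∀ x ∈ I.toSubmodule, φ x ∈ J.toSubmodule) : I.Quo →⋆ₙₐ[ℂ] J.Quo where
  __ := (Submodule.mapQ I.toSubmodule J.toSubmodule (φ : E →ₗ[ℂ] E') h : I.Quo →ₗ[ℂ] J.Quo)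
  map_zero' := map_zero (Submodule.mapQ I.toSubmodule J.toSubmodule (φ : E →ₗ[ℂ] E') h)
  map_mul' x y := by
    obtain ⟨x, rfl⟩ := I.mkₗ_surjective x
    obtain ⟨y, rfl⟩ := I.mkₗ_surjective y
    exact congrArg J.mkₗ (map_mul φ x y)
  map_star' x := by
    obtain ⟨x, rfl⟩ := I.mkₗ_surjective x
    exact congrArg J.mkₗ (map_star φ x)

theorem mapQuo_proj {E' : Type*} [NonUnitalNormedRing E'] [StarRing E'] [NormedSpace ℂ E']
    (I : ClosedStarIdeal E) (J : ClosedStarIdeal E') (φ : E →⋆ₙₐ[ℂ] E')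
    (h : ∀ x ∈ I.toSubmodule, φ x ∈ J.toSubmodule) (x : E) :
    mapQuo I J φ h (I.proj x) = J.proj (φ x) := rfl

end ClosedStarIdeal

section SequenceAlgebra

variable (A : Type*) [NonUnitalCStarAlgebra A]

/-- `ℓ^∞(ℕ, A)`. -/
abbrev BddSeq : Type _ := lp (fun _ : ℕ => A) ∞

/-- The ideal `c₀(ℕ, A)` of null sequences in `ℓ^∞(ℕ, A)`. -/
def nullSeq : ClosedStarIdeal (BddSeq A) where
  carrier := {x | Tendsto (fun n => ‖x n‖) atTop (𝓝 0)}
  add_mem' {x y} hx hy := by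
    refine squeeze_zero (fun n => norm_nonneg _) (fun n => norm_add_le (x n) (y n)) ?_
    simpa using Tendsto.add hx hy
  zero_mem' := by simp
  smul_mem' c x hx := by
    have : Tendsto (fun n => ‖c‖ * ‖x n‖) atTop (𝓝 0) := by
      simpa using Tendsto.const_mul ‖c‖ hx
    simpa [norm_smul] using this
  mul_left_mem' x y hy := by
    refine squeeze_zero (g := fun n => ‖x‖ * ‖y n‖) (fun n => norm_nonneg _) (fun n => ?_) ?_
    · refine (norm_mul_le (x n) (y n)).trans ?_
      gcongr
      exact lp.norm_apply_le_norm ENNReal.top_ne_zero x n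
    · simpa using Tendsto.const_mul ‖x‖ hy
  mul_right_mem' {x} y hx := by
    refine squeeze_zero (g := fun n => ‖x n‖ * ‖y‖) (fun n => norm_nonneg _) (fun n => ?_) ?_
    · refine (norm_mul_le (x n) (y n)).trans ?_
      gcongr
      exact lp.norm_apply_le_norm ENNReal.top_ne_zero y n
    · simpa using Tendsto.mul_const ‖y‖ hx
  star_mem' {x} hx := by
    simpa using hx
  isClosed' := by
    refine isClosed_of_closure_subset fun x hx => ?_
    rw [Metric.mem_closure_iff] at hx
    show Tendsto _ _ _
    rw [Metric.tendsto_atTop]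
    intro ε hε
    obtain ⟨y, hy, hxy⟩ := hx (ε / 2) (half_pos hε)
    obtain ⟨N, hN⟩ := (Metric.tendsto_atTop.1 hy) (ε / 2) (half_pos hε)
    refine ⟨N, fun n hn => ?_⟩
    have h1 := hN n hn
    simp only [dist_zero_right, norm_norm] at h1 ⊢
    have h2 : ‖x n - y n‖ ≤ ‖x - y‖ := lp.norm_apply_le_norm ENNReal.top_ne_zero (x - y) n
    rw [dist_eq_norm] at hxy
    calc ‖x n‖ = ‖(x n - y n) + y n‖ := by rw [sub_add_cancel]
      _ ≤ ‖x n - y n‖ + ‖y n‖ := norm_add_le _ _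
      _ < ε := by linarith

/-- The sequence algebra `A_∞ = ℓ^∞(ℕ, A) / c₀(ℕ, A)`. -/
abbrev SeqAlg : Type _ := (nullSeq A).Quo

variable {A}

/-- Componentwise application of a `*`-homomorphism to bounded sequences. -/
def bddSeqMap {B : Type*} [NonUnitalCStarAlgebra B] (φ : A →⋆ₙₐ[ℂ] B) :
    BddSeq A →⋆ₙₐ[ℂ] BddSeq B where
  toFun x := ⟨fun n => φ (x n), memℓp_infty ⟨‖x‖, by
    rintro _ ⟨n, rfl⟩
    exact (NonUnitalStarAlgHom.norm_apply_le φ (x n)).trans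
      (lp.norm_apply_le_norm ENNReal.top_ne_zero x n)⟩⟩
  map_smul' c x := by ext n; exact map_smul φ c (x n)
  map_zero' := by ext n; exact map_zero φ
  map_add' x y := by ext n; exact map_add φ (x n) (y n)
  map_mul' x y := by ext n; exact map_mul φ (x n) (y n)
  map_star' x := by ext n; exact map_star φ (x n)

/-- The `*`-homomorphism `φ_∞ : A_∞ → B_∞` induced by componentwise application of `φ`. -/
def seqAlgMap {B : Type*} [NonUnitalCStarAlgebra B] (φ : A →⋆ₙₐ[ℂ] B) :
    SeqAlg A →⋆ₙₐ[ℂ] SeqAlg B :=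
  ClosedStarIdeal.mapQuo (nullSeq A) (nullSeq B) (bddSeqMap φ) fun _ hx =>
    squeeze_zero (fun _ => norm_nonneg _) (fun _ => NonUnitalStarAlgHom.norm_apply_le φ _) hx

variable (A) in
/-- The constant sequences `A → ℓ^∞(ℕ, A)`. -/
def constSeq : A →⋆ₙₐ[ℂ] BddSeq A where
  toFun a := ⟨fun _ => a, memℓp_infty ⟨‖a‖, by rintro _ ⟨n, rfl⟩; exact le_rfl⟩⟩
  map_smul' _ _ := rfl
  map_zero' := rfl
  map_add' _ _ := rfl
  map_mul' _ _ := rfl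
  map_star' _ := rfl

variable (A) in
/-- The canonical embedding `A → A_∞`. -/
def toSeqAlg : A →⋆ₙₐ[ℂ] SeqAlg A := (nullSeq A).proj.comp (constSeq A)

theorem seqAlgMap_toSeqAlg {B : Type*} [NonUnitalCStarAlgebra B] (φ : A →⋆ₙₐ[ℂ] B) (a : A) :
    seqAlgMap φ (toSeqAlg A a) = toSeqAlg B (φ a) := rfl

variable (A) in
/-- The relative commutant `A_∞ ∩ A'`. -/
def relCommutant : NonUnitalStarSubalgebra ℂ (SeqAlg A) where
  carrier := {x | ∀ a, x * toSeqAlg A a = toSeqAlg A a * x}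
  add_mem' hx hy a := by rw [add_mul, mul_add, hx a, hy a]
  zero_mem' a := by rw [zero_mul, mul_zero]
  mul_mem' {x y} hx hy a := by rw [mul_assoc, hy a, ← mul_assoc, hx a, mul_assoc]
  smul_mem' c x hx a := by rw [smul_mul_assoc, mul_smul_comm, hx a]
  star_mem' {x} hx a := by
    have := congrArg star (hx (star a))
    rw [star_mul, star_mul, map_star, star_star] at this
    exact this.symm

variable (A) in
/-- The annihilator `ann(A, A_∞)`, as an ideal in `A_∞ ∩ A'`. -/
def annIdeal : ClosedStarIdeal (relCommutant A) where
  carrier := {x | ∀ a, x.1 * toSeqAlg A a = 0 ∧ toSeqAlg A a * x.1 = 0}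
  add_mem' {x y} hx hy a := by
    constructor
    · show (x.1 + y.1) * _ = 0
      rw [add_mul, (hx a).1, (hy a).1, add_zero]
    · show _ * (x.1 + y.1) = 0
      rw [mul_add, (hx a).2, (hy a).2, add_zero]
  zero_mem' a := ⟨zero_mul _, mul_zero _⟩
  smul_mem' c x hx a := by
    constructor
    · show (c • x.1) * _ = 0
      rw [smul_mul_assoc, (hx a).1, smul_zero]
    · show _ * (c • x.1) = 0
      rw [mul_smul_comm, (hx a).2, smul_zero]
  mul_left_mem' x y hy a := by
    constructor
    · show (x.1 * y.1) * _ = 0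
      rw [mul_assoc, (hy a).1, mul_zero]
    · show _ * (x.1 * y.1) = 0
      rw [← mul_assoc, ← x.2 a, mul_assoc, (hy a).2, mul_zero]
  mul_right_mem' {x} y hx a := by
    constructor
    · show (x.1 * y.1) * _ = 0
      rw [mul_assoc, y.2 a, ← mul_assoc, (hx a).1, zero_mul]
    · show _ * (x.1 * y.1) = 0
      rw [← mul_assoc, (hx a).2, zero_mul]
  star_mem' {x} hx a := by
    constructor
    · show star x.1 * _ = 0
      have := congrArg star (hx (star a)).2
      rwa [star_mul, map_star, star_star, star_zero] at this
    · show _ * star x.1 = 0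
      have := congrArg star (hx (star a)).1
      rwa [star_mul, map_star, star_star, star_zero] at this
  isClosed' := by
    have : {x : relCommutant A | ∀ a, x.1 * toSeqAlg A a = 0 ∧ toSeqAlg A a * x.1 = 0}
        = ⋂ a, ({x | x.1 * toSeqAlg A a = 0} ∩ {x | toSeqAlg A a * x.1 = 0}) := by
      ext x; simp
    show IsClosed {x : relCommutant A | _}
    rw [this]
    refine isClosed_iInter fun a => IsClosed.inter ?_ ?_
    · exact isClosed_eq (continuous_subtype_val.mul continuous_const) continuous_const
    · exact isClosed_eq ((continuous_const (y := toSeqAlg A a)).mul continuous_subtype_val)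
        continuous_const

variable (A) in
/-- The central sequence algebra `F_∞(A) = (A_∞ ∩ A') / ann(A, A_∞)`. -/
abbrev CentralSeqAlg : Type _ := (annIdeal A).Quo

/-- The restriction of `θ_∞` to `A_∞ ∩ A'`, for an automorphism `θ` of `A`. -/
def relCommutantMap (θ : A ≃⋆ₐ[ℂ] A) : relCommutant A →⋆ₙₐ[ℂ] relCommutant A :=
  NonUnitalStarAlgHom.codRestrict
    ((seqAlgMap (θ : A →⋆ₙₐ[ℂ] A)).comp (NonUnitalStarSubalgebraClass.subtype (relCommutant A)))
    (relCommutant A) fun x a => by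
      have h := congrArg (seqAlgMap (θ : A →⋆ₙₐ[ℂ] A)) (x.2 (θ.symm a))
      rw [map_mul, map_mul, seqAlgMap_toSeqAlg] at h
      simpa using h

/-- The induced `*`-endomorphism of `F_∞(A)`, for an automorphism `θ` of `A`. -/
def centralSeqMap (θ : A ≃⋆ₐ[ℂ] A) : CentralSeqAlg A →⋆ₙₐ[ℂ] CentralSeqAlg A :=
  ClosedStarIdeal.mapQuo (annIdeal A) (annIdeal A) (relCommutantMap θ) fun x hx a => by
    have h1 := congrArg (seqAlgMap (θ : A →⋆ₙₐ[ℂ] A)) (hx (θ.symm a)).1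
    have h2 := congrArg (seqAlgMap (θ : A →⋆ₙₐ[ℂ] A)) (hx (θ.symm a)).2
    rw [map_mul, map_zero, seqAlgMap_toSeqAlg] at h1 h2
    rw [show (θ : A →⋆ₙₐ[ℂ] A) (θ.symm a) = a from θ.apply_symm_apply a] at h1 h2
    exact ⟨h1, h2⟩

end SequenceAlgebra

section Actions

variable {A G : Type*} [NonUnitalCStarAlgebra A] [Group G]

/-- The fixed point algebra `A^α`. -/
def fixedPoints (α : G →* (A ≃⋆ₐ[ℂ] A)) : NonUnitalStarSubalgebra ℂ A where
  carrier := {a | ∀ g, α g a = a}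
  add_mem' hx hy g := by rw [map_add, hx g, hy g]
  zero_mem' g := map_zero _
  mul_mem' hx hy g := by rw [map_mul, hx g, hy g]
  smul_mem' c x hx g := by rw [map_smul, hx g]
  star_mem' hx g := by rw [map_star, hx g]

instance (α : G →* (A ≃⋆ₐ[ℂ] A)) : IsClosed (fixedPoints α : Set A) := by
  have : (fixedPoints α : Set A) = ⋂ g, {a | α g a = a} := by
    ext x
    rw [Set.mem_iInter]
    exact Iff.rfl
  rw [this]
  exact isClosed_iInter fun g =>
    isClosed_eq (KTheory.continuous_starHom ((α g : A ≃⋆ₐ[ℂ] A) : A →⋆ₙₐ[ℂ] A)) continuous_id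

/-- The inclusion `A^α → A`. -/
def fixedIncl (α : G →* (A ≃⋆ₐ[ℂ] A)) : fixedPoints α →⋆ₙₐ[ℂ] A :=
  NonUnitalStarSubalgebraClass.subtype (fixedPoints α)

variable [TopologicalSpace G]

/-- The coaction `α_co : A → C(G, A) = C(G) ⊗ A`, `α_co(a)(g) = α_g(a)`, of a point-norm
continuous action. -/
def coaction (α : G →* (A ≃⋆ₐ[ℂ] A)) (hα : ∀ a, Continuous fun g => α g a) :
    A →⋆ₙₐ[ℂ] C(G, A) where
  toFun a := ⟨fun g => α g a, hα a⟩
  map_smul' c a := by ext g; exact map_smul (α g) c a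
  map_zero' := by ext g; exact map_zero (α g)
  map_add' a b := by ext g; exact map_add (α g) a b
  map_mul' a b := by ext g; exact map_mul (α g) a b
  map_star' a := by ext g; exact map_star (α g) a

variable (A G) in
/-- The second-factor embedding `1 ⊗ id_A : A → C(G, A) = C(G) ⊗ A`. -/
def constEmb : A →⋆ₙₐ[ℂ] C(G, A) where
  toFun a := ContinuousMap.const G a
  map_smul' _ _ := rfl
  map_zero' := rfl
  map_add' _ _ := rfl
  map_mul' _ _ := rfl
  map_star' _ := rfl

/-- The canonical shift `σ_g(f) = f(g⁻¹ · _)` on `C(G)`. -/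
def shift [IsTopologicalGroup G] (g : G) (f : C(G, ℂ)) : C(G, ℂ) :=
  f.comp ⟨fun h => g⁻¹ * h, continuous_const_mul g⁻¹⟩

/-- The underlying set of the continuous part `F_{∞,α}(A)` of the central sequence algebra. -/
def centralSeqContinuousPart (α : G →* (A ≃⋆ₐ[ℂ] A)) : Set (CentralSeqAlg A) :=
  {y | Continuous fun g => centralSeqMap (α g) y}

/-- The Rokhlin property: there is a unital equivariant `*`-homomorphism
`(C(G), σ) → (F_{∞,α}(A), α̃_∞)`. -/
def HasRokhlinProperty [IsTopologicalGroup G] (α : G →* (A ≃⋆ₐ[ℂ] A)) : Prop :=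
  ∃ φ : C(G, ℂ) →⋆ₙₐ[ℂ] CentralSeqAlg A,
    (∀ f, φ f ∈ centralSeqContinuousPart α) ∧
    (∀ y, φ 1 * y = y ∧ y * φ 1 = y) ∧
    ∀ g f, φ (shift g f) = centralSeqMap (α g) (φ f)

end Actions

section Tensor

universe w u v

/-- A pair of `*`-homomorphisms from `A` and `B` with commuting ranges into a common C*-algebra. -/
structure CommPair (A : Type u) (B : Type v) [NonUnitalCStarAlgebra A]
    [NonUnitalCStarAlgebra B] : Type (max u v (w + 1)) where
  D : Type w
  [inst : NonUnitalCStarAlgebra D]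
  left : A →⋆ₙₐ[ℂ] D
  right : B →⋆ₙₐ[ℂ] D
  comm : ∀ a b, left a * right b = right b * left a

attribute [instance] CommPair.inst

variable {A : Type u} {B : Type v} [NonUnitalCStarAlgebra A] [NonUnitalCStarAlgebra B]

/-- The elementary tensor `a ⊗ b`, as the family of its values in all commuting pairs. -/
def elemTensor (a : A) (b : B) : lp (fun i : CommPair.{w} A B => i.D) ∞ :=
  ⟨fun i => i.left a * i.right b, memℓp_infty ⟨‖a‖ * ‖b‖, by
    rintro _ ⟨i, rfl⟩
    refine (norm_mul_le _ _).trans ?_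
    gcongr
    · exact NonUnitalStarAlgHom.norm_apply_le i.left a
    · exact NonUnitalStarAlgHom.norm_apply_le i.right b⟩⟩

variable (A B) in
/-- The closed `*`-subalgebra generated by the elementary tensors. -/
def maxTensorSubalgebra : NonUnitalStarSubalgebra ℂ (lp (fun i : CommPair.{w} A B => i.D) ∞) :=
  (NonUnitalStarAlgebra.adjoin ℂ
    (Set.range fun x : A × B => elemTensor.{w} x.1 x.2)).topologicalClosure

instance : IsClosed
    (maxTensorSubalgebra.{w} A B : Set (lp (fun i : CommPair.{w} A B => i.D) ∞)) :=
  NonUnitalStarSubalgebra.isClosed_topologicalClosure _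

variable (A B) in
/-- The maximal tensor product `A ⊗_max B`: the completion of the span of the elementary tensors in
the norm given by the supremum over all commuting pairs of `*`-homomorphisms. The pairs
take values in C*-algebras in the universe `w`, which is to be at least as large as those of
`A` and `B`. -/
def MaxTensor : Type (max u v (w + 1)) := maxTensorSubalgebra.{w} A B

instance : NonUnitalCStarAlgebra (MaxTensor.{w} A B) :=
  inferInstanceAs (NonUnitalCStarAlgebra (maxTensorSubalgebra.{w} A B))

variable {A' : Type*} [NonUnitalCStarAlgebra A']

/-- Restriction of a commuting pair along a `*`-homomorphism. -/
def CommPair.restrict (φ : A →⋆ₙₐ[ℂ] A') (i : CommPair.{w} A' B) : CommPair.{w} A B where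
  D := i.D
  left := i.left.comp φ
  right := i.right
  comm a b := i.comm (φ a) b

/-- The map of products underlying `φ ⊗ id`. -/
def maxTensorMapAux (φ : A →⋆ₙₐ[ℂ] A') :
    lp (fun i : CommPair.{w} A B => i.D) ∞ →⋆ₙₐ[ℂ] lp (fun i : CommPair.{w} A' B => i.D) ∞ where
  toFun x := ⟨fun i => x (i.restrict φ), memℓp_infty ⟨‖x‖, by
    rintro _ ⟨i, rfl⟩
    exact lp.norm_apply_le_norm ENNReal.top_ne_zero x (i.restrict φ)⟩⟩
  map_smul' _ _ := rfl
  map_zero' := rfl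
  map_add' _ _ := rfl
  map_mul' _ _ := rfl
  map_star' _ := rfl

theorem maxTensorMapAux_mem (φ : A →⋆ₙₐ[ℂ] A') {x} (hx : x ∈ maxTensorSubalgebra.{w} A B) :
    maxTensorMapAux φ x ∈ maxTensorSubalgebra.{w} A' B := by
  have hc : IsClosed (maxTensorSubalgebra.{w} A' B :
      Set (lp (fun i : CommPair.{w} A' B => i.D) ∞)) := inferInstance
  have h1 : maxTensorSubalgebra.{w} A B
      ≤ (maxTensorSubalgebra.{w} A' B).comap (maxTensorMapAux φ) := by
    refine NonUnitalStarSubalgebra.topologicalClosure_minimal _ ?_ ?_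
    · refine NonUnitalStarAlgebra.adjoin_le ?_
      rintro _ ⟨⟨a, b⟩, rfl⟩
      refine NonUnitalStarSubalgebra.le_topologicalClosure _ ?_
      exact NonUnitalStarAlgebra.subset_adjoin ℂ _ ⟨(φ a, b), rfl⟩
    · exact hc.preimage (KTheory.continuous_starHom (maxTensorMapAux φ))
  exact h1 hx

/-- The `*`-homomorphism `φ ⊗ id_B : A ⊗_max B → A' ⊗_max B`. -/
def MaxTensor.map (φ : A →⋆ₙₐ[ℂ] A') : MaxTensor.{w} A B →⋆ₙₐ[ℂ] MaxTensor.{w} A' B :=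
  NonUnitalStarAlgHom.codRestrict
    ((maxTensorMapAux φ).comp
      (NonUnitalStarSubalgebraClass.subtype (maxTensorSubalgebra.{w} A B)))
    (maxTensorSubalgebra.{w} A' B) fun x => maxTensorMapAux_mem φ x.2

end Tensor

section Cuntz

/-- The Hilbert space `ℓ²(ℕ)`. -/
abbrev ell2 : Type := lp (fun _ : ℕ => ℂ) 2

theorem orthonormal_cuntz (m : ℕ) (i : Fin m) :
    Orthonormal ℂ (fun k : ℕ => (lp.single 2 (m * k + i) (1 : ℂ) : ell2)) := by
  rw [orthonormal_iff_ite]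
  intro k l
  have hm : 0 < m := i.pos
  rw [lp.inner_single_left, lp.single_apply]
  by_cases h : k = l
  · subst h; simp
  · simp [h, hm.ne']

/-- The isometries `s_0, …, s_{m-1}` on `ℓ²(ℕ)` given by `s_i e_k = e_{mk+i}`. They satisfy
`s_i^* s_i = 1` and `∑_i s_i s_i^* = 1`. -/
def cuntzIsometry (m : ℕ) (i : Fin m) : ell2 →L[ℂ] ell2 :=
  (orthonormal_cuntz m i).orthogonalFamily.linearIsometry.toContinuousLinearMap

/-- The closed unital `*`-subalgebra generated by `s_0, …, s_{m-1}`. -/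
def cuntzSubalgebra (m : ℕ) : StarSubalgebra ℂ (ell2 →L[ℂ] ell2) :=
  (StarAlgebra.adjoin ℂ (Set.range (cuntzIsometry m))).topologicalClosure

instance (m : ℕ) : IsClosed (cuntzSubalgebra m : Set (ell2 →L[ℂ] ell2)) :=
  StarSubalgebra.isClosed_topologicalClosure _

/-- The Cuntz algebra `O_m` (`m ≥ 2`): the C*-algebra generated by the isometries
`s_0, …, s_{m-1}`. -/
def CuntzAlgebra (m : ℕ) : Type := cuntzSubalgebra m

instance (m : ℕ) : CStarAlgebra (CuntzAlgebra m) :=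
  inferInstanceAs (CStarAlgebra (cuntzSubalgebra m))

end Cuntz

end Rokhlin

namespace KTheory

universe w u

/-- The C*-algebra `A ⊗ O_{n+1}`, whose K-theory is the K-theory of `A` with coefficients
in `ℤ/n`. -/
abbrev CoeffAlg (n : ℕ) (A : Type u) [NonUnitalCStarAlgebra A] : Type (max u (w + 1)) :=
  Rokhlin.MaxTensor.{w} A (Rokhlin.CuntzAlgebra (n + 1))

/-- `K₀(A; ℤ/n) = K₀(A ⊗ O_{n+1})`. -/
abbrev K0Mod (n : ℕ) (A : Type u) [NonUnitalCStarAlgebra A] : Type (max u (w + 1)) :=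
  K0 (CoeffAlg.{w} n A)

/-- `K₁(A; ℤ/n) = K₁(A ⊗ O_{n+1})`. -/
abbrev K1Mod (n : ℕ) (A : Type u) [NonUnitalCStarAlgebra A] : Type (max u (w + 1)) :=
  K1 (CoeffAlg.{w} n A)

variable {A B : Type*} [NonUnitalCStarAlgebra A] [NonUnitalCStarAlgebra B]

/-- The homomorphism `K₀(φ; ℤ/n)`. -/
def K0Mod.map (n : ℕ) (φ : A →⋆ₙₐ[ℂ] B) : K0Mod.{w} n A →+ K0Mod.{w} n B :=
  K0.map (Rokhlin.MaxTensor.map φ)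

/-- The homomorphism `K₁(φ; ℤ/n)`. -/
def K1Mod.map (n : ℕ) (φ : A →⋆ₙₐ[ℂ] B) : K1Mod.{w} n A →* K1Mod.{w} n B :=
  K1.map (Rokhlin.MaxTensor.map φ)

end KTheory

end

/-! The Rokhlin homomorphism `φ : C(G) → F_∞(A)` gives a `*`-homomorphism `ψ : C(G, A) → A_∞` with
`ψ(f ⊗ a) = φ(f) a`. On constant functions `ψ` is the canonical embedding, because `φ` is unital. It
is equivariant for the diagonal action on `C(G, A)`, which fixes every `α_co(a)`. Hence `ψ ∘ α_co`
takes values in the elements of `A_∞` fixed by all `α_g`, and averaging over Haar measure identifies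
these with `(A^α)_∞`. So `ψ ∘ α_co` factors through some `θ : A → (A^α)_∞`, and `θ` restricts to the
canonical embedding on `A^α`. The diagram `A^α → A ⇉ C(G, A)` thus behaves like an equalizer split
by `θ` and `ψ` up to passing to sequence algebras (`HasRokhlinProperty.exists_splitting`).

K-theory tolerates such approximate splittings. Projections, Murray–von Neumann equivalences and
unitaries over `E_∞` lift to sequences of the same kind over `E`, and homotopic unitaries over `F`
have eventually homotopic lifts along `F → E_∞`. If two classes over `A^α` agree over `A`, lifting
the witness along `θ` makes them agree over `A^α`. If `α_co` and `1 ⊗ id` agree on a class `x`,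
lifting the witness along `ψ` shows that `x` equals the image of a late term of a lift of `θ(x)`.
This is `kTheory_equalizer`, applied after unitization.

For coefficients, `θ` and `ψ` are tensored with `O_{n+1}` (`exists_tensor_seqAlg`). This works for
the maximal tensor product with any C*-algebra: a commuting pair into `D` pulls back to a commuting
pair into `D_∞`, and finitely or countably many pairs can be merged into a product. The same
equalizer statement then applies. -/

noncomputable section

namespace Rokhlin

/-! ### The sequence algebra as a C*-algebra -/

section SeqAlgNorm

variable {E : Type*} [NonUnitalCStarAlgebra E]

/-- A bounded sequence as an element of `ℓ^∞(ℕ, E)`. -/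
def BddSeq.ofBound (x : ℕ → E) (c : ℝ) (h : ∀ n, ‖x n‖ ≤ c) : BddSeq E :=
  ⟨x, memℓp_infty ⟨c, by rintro _ ⟨n, rfl⟩; exact h n⟩⟩

@[simp]
theorem BddSeq.ofBound_apply (x : ℕ → E) (c : ℝ) (h : ∀ n, ‖x n‖ ≤ c) (n : ℕ) :
    BddSeq.ofBound x c h n = x n := rfl

theorem BddSeq.norm_ofBound_le (x : ℕ → E) (c : ℝ) (h : ∀ n, ‖x n‖ ≤ c) :
    ‖BddSeq.ofBound x c h‖ ≤ c :=
  lp.norm_le_of_forall_le ((norm_nonneg _).trans (h 0)) h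

theorem BddSeq.norm_apply_le (x : BddSeq E) (n : ℕ) : ‖x n‖ ≤ ‖x‖ :=
  lp.norm_apply_le_norm ENNReal.top_ne_zero x n

theorem mem_nullSeq_iff {x : BddSeq E} :
    x ∈ (nullSeq E).toSubmodule ↔ Tendsto (fun n => x n) atTop (𝓝 0) :=
  tendsto_zero_iff_norm_tendsto_zero.symm

theorem proj_surjective (x : SeqAlg E) : ∃ y : BddSeq E, (nullSeq E).proj y = x :=
  (nullSeq E).mkₗ_surjective x

theorem proj_eq_proj_iff {x y : BddSeq E} :
    (nullSeq E).proj x = (nullSeq E).proj y ↔ Tendsto (fun n => x n - y n) atTop (𝓝 0) :=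
  (nullSeq E).mkₗ_eq_iff.trans mem_nullSeq_iff

theorem norm_proj_le (x : BddSeq E) : ‖(nullSeq E).proj x‖ ≤ ‖x‖ :=
  Submodule.Quotient.norm_mk_le (nullSeq E).toSubmodule x

/-- Changing finitely many terms does not change the class. Together with
`eventually_norm_lt_of_norm_proj_lt` this says that the quotient norm is `limsup ‖x n‖`. -/
theorem norm_proj_le_of_eventually {x : BddSeq E} {c : ℝ} (hc : 0 ≤ c)
    (h : ∀ᶠ n in atTop, ‖x n‖ ≤ c) : ‖(nullSeq E).proj x‖ ≤ c := by
  obtain ⟨N, hN⟩ := eventually_atTop.1 h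
  let y : BddSeq E := BddSeq.ofBound (fun n => if N ≤ n then x n else 0) c fun n => by
    split_ifs with hn
    · exact hN n hn
    · simpa using hc
  have : (nullSeq E).proj x = (nullSeq E).proj y := by
    rw [proj_eq_proj_iff]
    refine tendsto_const_nhds.congr' ?_
    filter_upwards [eventually_ge_atTop N] with n hn
    simp [y, hn]
  rw [this]
  exact (norm_proj_le y).trans (BddSeq.norm_ofBound_le _ _ _)

theorem eventually_norm_lt_of_norm_proj_lt {x : BddSeq E} {c : ℝ}
    (h : ‖(nullSeq E).proj x‖ < c) : ∀ᶠ n in atTop, ‖x n‖ < c := by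
  obtain ⟨z, hz, hzc⟩ := Submodule.Quotient.norm_mk_lt (S := (nullSeq E).toSubmodule)
    ((nullSeq E).proj x) (sub_pos.2 h)
  have hz' : Tendsto (fun n => x n - z n) atTop (𝓝 0) := proj_eq_proj_iff.1 hz.symm
  have hzc' : ‖z‖ < c := lt_of_lt_of_eq hzc (add_sub_cancel ‖(nullSeq E).proj x‖ c)
  have := (tendsto_zero_iff_norm_tendsto_zero.1 hz').eventually (gt_mem_nhds (sub_pos.2 hzc'))
  filter_upwards [this] with n hn
  have h1 := norm_add_le (x n - z n) (z n)
  rw [sub_add_cancel] at h1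
  have h2 := z.norm_apply_le n
  linarith

instance : CompleteSpace (SeqAlg E) :=
  inferInstanceAs (CompleteSpace (BddSeq E ⧸ (nullSeq E).toSubmodule))

instance : CStarRing (SeqAlg E) where
  norm_mul_self_le x := by
    obtain ⟨x, rfl⟩ := proj_surjective x
    refine le_of_forall_pos_le_add fun ε hε => ?_
    rw [← map_star, ← map_mul]
    have h1 := eventually_norm_lt_of_norm_proj_lt
      (lt_add_of_pos_right ‖(nullSeq E).proj (star x * x)‖ hε)
    have h0 : 0 ≤ ‖(nullSeq E).proj (star x * x)‖ + ε := add_nonneg (norm_nonneg _) hε.le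
    have h2 := norm_proj_le_of_eventually (x := x) (Real.sqrt_nonneg _)
      (h1.mono fun n hn => Real.le_sqrt_of_sq_le (y := ‖(nullSeq E).proj (star x * x)‖ + ε) (by
        rw [sq, ← CStarRing.norm_star_mul_self]
        exact hn.le))
    calc _ ≤ _ := mul_le_mul h2 h2 (norm_nonneg _) (Real.sqrt_nonneg _)
      _ = _ := Real.mul_self_sqrt h0

instance : NonUnitalCStarAlgebra (SeqAlg E) where

theorem norm_toSeqAlg (a : E) : ‖toSeqAlg E a‖ = ‖a‖ := by
  refine le_antisymm (NonUnitalStarAlgHom.norm_apply_le _ _) (le_of_forall_gt fun c hc => ?_)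
  exact (eventually_norm_lt_of_norm_proj_lt (x := constSeq E a) hc).exists.choose_spec

theorem seqAlgMap_proj {F : Type*} [NonUnitalCStarAlgebra F] (φ : E →⋆ₙₐ[ℂ] F) (x : BddSeq E) :
    seqAlgMap φ ((nullSeq E).proj x) = (nullSeq F).proj (bddSeqMap φ x) := rfl

/-- An injective `*`-homomorphism of C*-algebras is isometric, so it reflects null sequences. -/
theorem seqAlgMap_injective {F : Type*} [NonUnitalCStarAlgebra F] (φ : E →⋆ₙₐ[ℂ] F)
    (hφ : Function.Injective φ) : Function.Injective (seqAlgMap φ) := by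
  intro x y h
  obtain ⟨x, rfl⟩ := proj_surjective x
  obtain ⟨y, rfl⟩ := proj_surjective y
  rw [seqAlgMap_proj, seqAlgMap_proj, proj_eq_proj_iff] at h
  rw [proj_eq_proj_iff, tendsto_zero_iff_norm_tendsto_zero]
  refine (tendsto_zero_iff_norm_tendsto_zero.1 h).congr fun n => ?_
  show ‖φ (x n) - φ (y n)‖ = _
  rw [← map_sub, NonUnitalStarAlgHom.norm_map φ hφ]

end SeqAlgNorm

/-! ### Extending bounded maps from dense subspaces -/

section Extension

variable {T E F : Type*} [AddCommGroup T] [Module ℂ T] [NonUnitalCStarAlgebra E]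
  [NonUnitalCStarAlgebra F]

/-- A bounded linear map that is multiplicative and `*`-preserving on a total family extends
uniquely to a `*`-homomorphism. -/
theorem exists_starHom_extension (e : T →ₗ[ℂ] E) (f : T →ₗ[ℂ] F) (S : Set T)
    (hS : Submodule.span ℂ S = ⊤) (hd : DenseRange e) (hb : ∃ C, ∀ t, ‖f t‖ ≤ C * ‖e t‖)
    (hmul : ∀ s ∈ S, ∀ t ∈ S, ∃ r, e r = e s * e t ∧ f r = f s * f t)
    (hstar : ∀ s ∈ S, ∃ r, e r = star (e s) ∧ f r = star (f s)) :
    ∃ Φ : E →⋆ₙₐ[ℂ] F, ∀ t, Φ (e t) = f t := by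
  let Φ := f.extendOfNorm e
  have hΦ : ∀ t, Φ (e t) = f t := fun t => LinearMap.extendOfNorm_eq hd hb t
  have hm : ∀ s t, Φ (e s * e t) = f s * f t := by
    intro s t
    have hs : s ∈ Submodule.span ℂ S := hS ▸ Submodule.mem_top
    have ht : t ∈ Submodule.span ℂ S := hS ▸ Submodule.mem_top
    induction hs, ht using Submodule.span_induction₂ with
    | mem_mem s t hs ht =>
      obtain ⟨r, h1, h2⟩ := hmul s hs t ht
      rw [← h1, hΦ, h2]
    | zero_left => simp
    | zero_right => simp
    | add_left s s' t _ _ _ h1 h2 => simp only [map_add, add_mul, h1, h2]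
    | add_right s s' t _ _ _ h1 h2 => simp only [map_add, mul_add, h1, h2]
    | smul_left c s t _ _ h => simp only [map_smul, smul_mul_assoc, h]
    | smul_right c s t _ _ h => simp only [map_smul, mul_smul_comm, h]
  have hs : ∀ s, Φ (star (e s)) = star (f s) := by
    intro s
    have hs : s ∈ Submodule.span ℂ S := hS ▸ Submodule.mem_top
    induction hs using Submodule.span_induction with
    | mem s hs =>
      obtain ⟨r, h1, h2⟩ := hstar s hs
      rw [← h1, hΦ, h2]
    | zero => simp
    | add s t _ _ h1 h2 => simp only [map_add, star_add, h1, h2]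
    | smul c s _ h => simp only [map_smul, star_smul, h]
  refine ⟨{ toFun := Φ, map_smul' := map_smul Φ, map_zero' := map_zero Φ, map_add' := map_add Φ,
            map_mul' := fun x y => ?_, map_star' := fun x => ?_ }, hΦ⟩
  · refine hd.induction_on₂ (p := fun x y => Φ (x * y) = Φ x * Φ y) ?_ ?_ x y
    · exact isClosed_eq (by fun_prop) (by fun_prop)
    · intro s t
      rw [hm, hΦ, hΦ]
  · refine hd.induction_on (p := fun x => Φ (star x) = star (Φ x)) x ?_ ?_
    · exact isClosed_eq (by fun_prop) (by fun_prop)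
    · intro s
      rw [hs, hΦ]

end Extension

end Rokhlin
end

noncomputable section

namespace Rokhlin

/-! ### Maximal tensor products and sequence algebras -/

section TensorSeq

open scoped TensorProduct

universe w u v

variable {A : Type u} {B : Type v} [NonUnitalCStarAlgebra A] [NonUnitalCStarAlgebra B]

/-- The elementary tensor `a ⊗ b` in `A ⊗_max B`. -/
def MaxTensor.tmul (a : A) (b : B) : MaxTensor.{w} A B :=
  ⟨elemTensor a b, NonUnitalStarSubalgebra.le_topologicalClosure _
    (NonUnitalStarAlgebra.subset_adjoin ℂ _ ⟨(a, b), rfl⟩)⟩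

/-- The `*`-homomorphism `A ⊗_max B → D` given by a commuting pair. -/
def MaxTensor.eval (i : CommPair.{w} A B) : MaxTensor.{w} A B →⋆ₙₐ[ℂ] i.D where
  toFun x := x.1 i
  map_smul' _ _ := rfl
  map_zero' := rfl
  map_add' _ _ := rfl
  map_mul' _ _ := rfl
  map_star' _ := rfl

theorem MaxTensor.eval_tmul (i : CommPair.{w} A B) (a : A) (b : B) :
    MaxTensor.eval i (MaxTensor.tmul a b) = i.left a * i.right b := rfl

theorem MaxTensor.ext_eval {x y : MaxTensor.{w} A B}
    (h : ∀ i, MaxTensor.eval i x = MaxTensor.eval i y) : x = y :=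
  Subtype.ext (lp.ext (funext h))

theorem MaxTensor.norm_le {x : MaxTensor.{w} A B} {c : ℝ} (hc : 0 ≤ c)
    (h : ∀ i, ‖MaxTensor.eval i x‖ ≤ c) : ‖x‖ ≤ c :=
  lp.norm_le_of_forall_le hc h

theorem MaxTensor.norm_tmul_le (a : A) (b : B) :
    ‖(MaxTensor.tmul a b : MaxTensor.{w} A B)‖ ≤ ‖a‖ * ‖b‖ := by
  refine MaxTensor.norm_le (by positivity) fun i => ?_
  rw [MaxTensor.eval_tmul]
  refine (norm_mul_le _ _).trans ?_
  gcongr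
  · exact NonUnitalStarAlgHom.norm_apply_le i.left a
  · exact NonUnitalStarAlgHom.norm_apply_le i.right b

theorem MaxTensor.tmul_mul_tmul (a a' : A) (b b' : B) :
    (MaxTensor.tmul a b * MaxTensor.tmul a' b' : MaxTensor.{w} A B)
      = MaxTensor.tmul (a * a') (b * b') := by
  refine MaxTensor.ext_eval fun i => ?_
  rw [map_mul, MaxTensor.eval_tmul, MaxTensor.eval_tmul, MaxTensor.eval_tmul, map_mul, map_mul,
    mul_assoc, mul_assoc, ← mul_assoc (i.right b), ← i.comm, mul_assoc]

theorem MaxTensor.star_tmul (a : A) (b : B) :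
    star (MaxTensor.tmul a b : MaxTensor.{w} A B) = MaxTensor.tmul (star a) (star b) := by
  refine MaxTensor.ext_eval fun i => ?_
  rw [map_star, MaxTensor.eval_tmul, MaxTensor.eval_tmul, star_mul, map_star, map_star,
    ← map_star i.left, ← map_star i.right, i.comm]

variable (A B) in
/-- The canonical map from the algebraic tensor product to `A ⊗_max B`. -/
def MaxTensor.ofTensor : A ⊗[ℂ] B →ₗ[ℂ] MaxTensor.{w} A B :=
  TensorProduct.lift (LinearMap.mk₂ ℂ MaxTensor.tmul
    (fun a a' b => MaxTensor.ext_eval fun i => by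
      rw [map_add, MaxTensor.eval_tmul, MaxTensor.eval_tmul, MaxTensor.eval_tmul, map_add, add_mul])
    (fun c a b => MaxTensor.ext_eval fun i => by
      rw [map_smul, MaxTensor.eval_tmul, MaxTensor.eval_tmul, map_smul, smul_mul_assoc])
    (fun a b b' => MaxTensor.ext_eval fun i => by
      rw [map_add, MaxTensor.eval_tmul, MaxTensor.eval_tmul, MaxTensor.eval_tmul, map_add, mul_add])
    (fun c a b => MaxTensor.ext_eval fun i => by
      rw [map_smul, MaxTensor.eval_tmul, MaxTensor.eval_tmul, map_smul, mul_smul_comm]))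

theorem MaxTensor.ofTensor_tmul (a : A) (b : B) :
    MaxTensor.ofTensor.{w} A B (a ⊗ₜ b) = MaxTensor.tmul a b := rfl

theorem MaxTensor.exists_ofTensor_mul (s t : A ⊗[ℂ] B) :
    ∃ r, MaxTensor.ofTensor.{w} A B r = MaxTensor.ofTensor A B s * MaxTensor.ofTensor A B t := by
  induction s with
  | zero => exact ⟨0, by simp⟩
  | add s s' h h' =>
    obtain ⟨r, hr⟩ := h
    obtain ⟨r', hr'⟩ := h'
    exact ⟨r + r', by rw [map_add, map_add, add_mul, hr, hr']⟩
  | tmul a b =>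
    induction t with
    | zero => exact ⟨0, by simp⟩
    | add s s' h h' =>
      obtain ⟨r, hr⟩ := h
      obtain ⟨r', hr'⟩ := h'
      exact ⟨r + r', by rw [map_add, map_add, mul_add, hr, hr']⟩
    | tmul a' b' => exact ⟨(a * a') ⊗ₜ (b * b'), by
        simp only [MaxTensor.ofTensor_tmul, MaxTensor.tmul_mul_tmul]⟩

theorem MaxTensor.exists_ofTensor_star (s : A ⊗[ℂ] B) :
    ∃ r, MaxTensor.ofTensor.{w} A B r = star (MaxTensor.ofTensor A B s) := by
  induction s with
  | zero => exact ⟨0, by simp⟩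
  | add s s' h h' =>
    obtain ⟨r, hr⟩ := h
    obtain ⟨r', hr'⟩ := h'
    exact ⟨r + r', by rw [map_add, map_add, star_add, hr, hr']⟩
  | tmul a b => exact ⟨star a ⊗ₜ star b, by
      simp only [MaxTensor.ofTensor_tmul, MaxTensor.star_tmul]⟩

variable (A B) in
-- Products and adjoints of images of algebraic tensors are again such images, so the generated
-- `*`-algebra contains nothing more before closure.
theorem MaxTensor.denseRange_ofTensor : DenseRange (MaxTensor.ofTensor.{w} A B) := by
  intro x
  refine closure_subtype.2 (closure_mono ?_ x.2)
  intro y hy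
  suffices h : ∃ t, (MaxTensor.ofTensor.{w} A B t).1 = y by
    obtain ⟨t, ht⟩ := h
    exact ⟨_, ⟨t, rfl⟩, ht⟩
  induction hy using NonUnitalStarAlgebra.adjoin_induction with
  | mem y hy =>
    obtain ⟨⟨a, b⟩, rfl⟩ := hy
    exact ⟨a ⊗ₜ b, rfl⟩
  | zero => exact ⟨0, by simp; rfl⟩
  | add y z _ _ hy hz =>
    obtain ⟨s, rfl⟩ := hy
    obtain ⟨t, rfl⟩ := hz
    exact ⟨s + t, by rw [map_add]; rfl⟩
  | mul y z _ _ hy hz =>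
    obtain ⟨s, rfl⟩ := hy
    obtain ⟨t, rfl⟩ := hz
    obtain ⟨r, hr⟩ := MaxTensor.exists_ofTensor_mul.{w} s t
    exact ⟨r, by rw [hr]; rfl⟩
  | smul c y _ hy =>
    obtain ⟨s, rfl⟩ := hy
    exact ⟨c • s, by rw [map_smul]; rfl⟩
  | star y _ hy =>
    obtain ⟨s, rfl⟩ := hy
    obtain ⟨r, hr⟩ := MaxTensor.exists_ofTensor_star.{w} s
    exact ⟨r, by rw [hr]; rfl⟩

/-- `*`-homomorphisms on `A ⊗_max B` agree if they agree on elementary tensors. -/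
theorem MaxTensor.hom_ext {D : Type*} [NonUnitalCStarAlgebra D]
    {φ ψ : MaxTensor.{w} A B →⋆ₙₐ[ℂ] D}
    (h : ∀ a b, φ (MaxTensor.tmul a b) = ψ (MaxTensor.tmul a b)) : φ = ψ := by
  refine DFunLike.coe_injective ((MaxTensor.denseRange_ofTensor A B).equalizer
    (KTheory.continuous_starHom φ) (KTheory.continuous_starHom ψ) (funext fun t => ?_))
  show φ (MaxTensor.ofTensor A B t) = ψ (MaxTensor.ofTensor A B t)
  induction t with
  | zero => simp
  | add s t hs ht => rw [map_add, map_add, map_add, hs, ht]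
  | tmul a b => exact h a b

variable {A' : Type*} [NonUnitalCStarAlgebra A']

theorem MaxTensor.map_comp {A'' : Type*} [NonUnitalCStarAlgebra A''] (ψ : A' →⋆ₙₐ[ℂ] A'')
    (φ : A →⋆ₙₐ[ℂ] A') :
    (MaxTensor.map (ψ.comp φ) : MaxTensor.{w} A B →⋆ₙₐ[ℂ] _)
      = (MaxTensor.map ψ).comp (MaxTensor.map φ) :=
  MaxTensor.hom_ext fun _ _ => rfl

/-- The product of a sequence of commuting pairs. -/
def CommPair.prod (i : ℕ → CommPair.{w} A B) : CommPair.{w} A B where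
  D := lp (fun n => (i n).D) ∞
  left :=
    { toFun := fun a => ⟨fun n => (i n).left a, memℓp_infty ⟨‖a‖, by
        rintro _ ⟨n, rfl⟩
        exact NonUnitalStarAlgHom.norm_apply_le (i n).left a⟩⟩
      map_smul' := fun c a => lp.ext (funext fun n => map_smul (i n).left c a)
      map_zero' := lp.ext (funext fun n => map_zero (i n).left)
      map_add' := fun a a' => lp.ext (funext fun n => map_add (i n).left a a')
      map_mul' := fun a a' => lp.ext (funext fun n => map_mul (i n).left a a')
      map_star' := fun a => lp.ext (funext fun n => map_star (i n).left a) }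
  right :=
    { toFun := fun b => ⟨fun n => (i n).right b, memℓp_infty ⟨‖b‖, by
        rintro _ ⟨n, rfl⟩
        exact NonUnitalStarAlgHom.norm_apply_le (i n).right b⟩⟩
      map_smul' := fun c a => lp.ext (funext fun n => map_smul (i n).right c a)
      map_zero' := lp.ext (funext fun n => map_zero (i n).right)
      map_add' := fun a a' => lp.ext (funext fun n => map_add (i n).right a a')
      map_mul' := fun a a' => lp.ext (funext fun n => map_mul (i n).right a a')
      map_star' := fun a => lp.ext (funext fun n => map_star (i n).right a) }
  comm a b := lp.ext (funext fun n => (i n).comm a b)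

/-- Evaluation of the product at one of its factors. -/
def CommPair.prodEval (i : ℕ → CommPair.{w} A B) (n : ℕ) : (CommPair.prod i).D →⋆ₙₐ[ℂ] (i n).D where
  toFun x := (show lp (fun n => (i n).D) ∞ from x) n
  map_smul' _ _ := rfl
  map_zero' := rfl
  map_add' _ _ := rfl
  map_mul' _ _ := rfl
  map_star' _ := rfl

theorem CommPair.prodEval_eval (i : ℕ → CommPair.{w} A B) (n : ℕ) (x : MaxTensor.{w} A B) :
    CommPair.prodEval i n (MaxTensor.eval (CommPair.prod i) x) = MaxTensor.eval (i n) x :=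
  DFunLike.congr_fun (MaxTensor.hom_ext
    (φ := (CommPair.prodEval i n).comp (MaxTensor.eval (CommPair.prod i)))
    (ψ := MaxTensor.eval (i n)) fun _ _ => rfl) x

instance : Nonempty (CommPair.{w} A B) :=
  ⟨{ D := lp (fun _ : PUnit.{w + 1} => ℂ) ∞
     left := 0
     right := 0
     comm := fun _ _ => rfl }⟩

/-- The norm is a supremum over pairs, hence attained up to `ε`. The existence of at least one pair
is needed to know that the competing bound `‖x‖ - ε` is nonnegative. -/
theorem MaxTensor.exists_norm_lt_eval (x : MaxTensor.{w} A B) {ε : ℝ} (hε : 0 < ε) :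
    ∃ i, ‖x‖ < ‖MaxTensor.eval i x‖ + ε := by
  by_contra! h
  have h1 : ‖x‖ ≤ ‖x‖ - ε := by
    refine MaxTensor.norm_le ?_ fun i => by linarith [h i]
    obtain ⟨i⟩ := (inferInstance : Nonempty (CommPair.{w} A B))
    linarith [h i, norm_nonneg (MaxTensor.eval i x)]
  linarith

/-- Elementary tensors of a bounded sequence with a fixed element. -/
def tensorSeq (x : BddSeq A) (b : B) : BddSeq (MaxTensor.{w} A B) :=
  BddSeq.ofBound (fun n => MaxTensor.tmul (x n) b) (‖x‖ * ‖b‖) fun n =>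
    (MaxTensor.norm_tmul_le _ _).trans (by gcongr; exact x.norm_apply_le n)

theorem tmul_sub (a a' : A) (b : B) :
    (MaxTensor.tmul (a - a') b : MaxTensor.{w} A B) = MaxTensor.tmul a b - MaxTensor.tmul a' b := by
  refine MaxTensor.ext_eval fun i => ?_
  rw [map_sub, MaxTensor.eval_tmul, MaxTensor.eval_tmul, MaxTensor.eval_tmul, map_sub, sub_mul]

/-- Makes `seqTmul` independent of the representative chosen in its definition. -/
theorem proj_tensorSeq_congr {x y : BddSeq A} (b : B)
    (h : (nullSeq A).proj x = (nullSeq A).proj y) :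
    (nullSeq (MaxTensor.{w} A B)).proj (tensorSeq x b)
      = (nullSeq (MaxTensor.{w} A B)).proj (tensorSeq y b) := by
  rw [proj_eq_proj_iff] at h ⊢
  refine squeeze_zero_norm (a := fun n => ‖x n - y n‖ * ‖b‖) (fun n => ?_) ?_
  · show ‖MaxTensor.tmul (x n) b - MaxTensor.tmul (y n) b‖ ≤ _
    rw [← tmul_sub]
    exact MaxTensor.norm_tmul_le _ _
  · simpa using (tendsto_zero_iff_norm_tendsto_zero.1 h).mul_const ‖b‖

/-- The elementary tensor of an element of the sequence algebra of `A` and an element of `B`. -/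
def seqTmul (x : SeqAlg A) (b : B) : SeqAlg (MaxTensor.{w} A B) :=
  (nullSeq _).proj (tensorSeq (proj_surjective x).choose b)

theorem seqTmul_proj (x : BddSeq A) (b : B) :
    seqTmul.{w} ((nullSeq A).proj x) b = (nullSeq _).proj (tensorSeq x b) :=
  proj_tensorSeq_congr b (proj_surjective ((nullSeq A).proj x)).choose_spec

theorem seqTmul_toSeqAlg (a : A) (b : B) :
    seqTmul.{w} (toSeqAlg A a) b = toSeqAlg _ (MaxTensor.tmul a b) :=
  seqTmul_proj _ _

/-- Through a pair, `seqTmul` becomes an ordinary product in `SeqAlg i.D`. Combined with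
`ext_seqAlgMap_eval`, this gives bilinearity of `seqTmul` without handling representatives. -/
theorem seqAlgMap_eval_seqTmul (i : CommPair.{w} A B) (x : SeqAlg A) (b : B) :
    seqAlgMap (MaxTensor.eval i) (seqTmul x b)
      = seqAlgMap i.left x * toSeqAlg i.D (i.right b) := by
  obtain ⟨x, rfl⟩ := proj_surjective x
  rw [seqTmul_proj]
  rfl

theorem seqAlgMap_map_seqTmul (φ : A →⋆ₙₐ[ℂ] A') (x : SeqAlg A) (b : B) :
    seqAlgMap (MaxTensor.map φ) (seqTmul.{w} x b) = seqTmul (seqAlgMap φ x) b := by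
  obtain ⟨x, rfl⟩ := proj_surjective x
  rw [seqTmul_proj, seqAlgMap_proj, seqAlgMap_proj, seqTmul_proj]
  rfl

/-- The family of all homomorphisms induced by commuting pairs is jointly norming on the sequence
algebra of `A ⊗_max B`. -/
theorem norm_le_of_forall_seqAlgMap_eval {x : SeqAlg (MaxTensor.{w} A B)} {c : ℝ} (hc : 0 ≤ c)
    (h : ∀ i, ‖seqAlgMap (MaxTensor.eval.{w} (A := A) (B := B) i) x‖ ≤ c) : ‖x‖ ≤ c := by
  obtain ⟨x, rfl⟩ := proj_surjective x
  -- Each term needs its own nearly norming pair. The product of these countably many pairs is a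
  -- single commuting pair, and it nearly norms all terms at once.
  choose i hi using fun n : ℕ =>
    MaxTensor.exists_norm_lt_eval (x n) (Nat.one_div_pos_of_nat (α := ℝ) (n := n))
  refine le_of_forall_pos_le_add fun ε hε => norm_proj_le_of_eventually (by positivity) ?_
  have h1 : ‖(nullSeq _).proj (bddSeqMap (MaxTensor.eval (CommPair.prod i)) x)‖ < c + ε / 2 :=
    (h (CommPair.prod i)).trans_lt (by linarith)
  have h2 := tendsto_one_div_add_atTop_nhds_zero_nat (𝕜 := ℝ)
  filter_upwards [eventually_norm_lt_of_norm_proj_lt h1,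
    h2.eventually (gt_mem_nhds (half_pos hε))] with n hn hn'
  have h3 : ‖MaxTensor.eval (i n) (x n)‖ ≤ ‖MaxTensor.eval (CommPair.prod i) (x n)‖ := by
    rw [← CommPair.prodEval_eval]
    exact NonUnitalStarAlgHom.norm_apply_le _ _
  have h4 : ‖MaxTensor.eval (CommPair.prod i) (x n)‖ < c + ε / 2 := hn
  linarith [hi n]

theorem ext_seqAlgMap_eval {x y : SeqAlg (MaxTensor.{w} A B)}
    (h : ∀ i, seqAlgMap (MaxTensor.eval.{w} (A := A) (B := B) i) x
      = seqAlgMap (MaxTensor.eval.{w} (A := A) (B := B) i) y) : x = y := by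
  rw [← sub_eq_zero, ← norm_le_zero_iff]
  refine norm_le_of_forall_seqAlgMap_eval le_rfl fun i => ?_
  rw [map_sub, h i, sub_self, norm_zero]

/-- A `*`-homomorphism `Φ : A → A'_∞` induces `Φ ⊗ id : A ⊗_max B → (A' ⊗_max B)_∞`. -/
theorem exists_tensor_seqAlg (Φ : A →⋆ₙₐ[ℂ] SeqAlg A') :
    ∃ Ψ : MaxTensor.{w} A B →⋆ₙₐ[ℂ] SeqAlg (MaxTensor.{w} A' B),
      ∀ a b, Ψ (MaxTensor.tmul a b) = seqTmul (Φ a) b := by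
  let f : A ⊗[ℂ] B →ₗ[ℂ] SeqAlg (MaxTensor.{w} A' B) :=
    TensorProduct.lift (LinearMap.mk₂ ℂ (fun a b => seqTmul (Φ a) b)
      (fun a a' b => ext_seqAlgMap_eval fun i => by
        simp only [map_add, seqAlgMap_eval_seqTmul, add_mul])
      (fun c a b => ext_seqAlgMap_eval fun i => by
        simp only [map_smul, seqAlgMap_eval_seqTmul, smul_mul_assoc])
      (fun a b b' => ext_seqAlgMap_eval fun i => by
        simp only [map_add, seqAlgMap_eval_seqTmul, mul_add])
      (fun c a b => ext_seqAlgMap_eval fun i => by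
        simp only [map_smul, seqAlgMap_eval_seqTmul, mul_smul_comm]))
  have hcomm : ∀ (i : CommPair.{w} A' B) a b,
      seqAlgMap i.left (Φ a) * toSeqAlg i.D (i.right b)
        = toSeqAlg i.D (i.right b) * seqAlgMap i.left (Φ a) := by
    intro i a b
    obtain ⟨x, hx⟩ := proj_surjective (Φ a)
    rw [← hx]
    exact congrArg (nullSeq _).proj (lp.ext (funext fun n => i.comm (x n) b))
  -- The key to boundedness: a pair for `A'` and `B` with values in `D` yields a pair for `A` and
  -- `B` with values in `D_∞`. The norm of `A ⊗_max B` therefore dominates every evaluation of `f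
  -- t`.
  let pair (i : CommPair.{w} A' B) : CommPair.{w} A B :=
    { D := SeqAlg i.D
      left := (seqAlgMap i.left).comp Φ
      right := (toSeqAlg i.D).comp i.right
      comm := hcomm i }
  have hf : ∀ i t, seqAlgMap (MaxTensor.eval i) (f t)
      = MaxTensor.eval (pair i) (MaxTensor.ofTensor A B t) := by
    intro i t
    induction t with
    | zero => simp
    | add s t hs ht => rw [map_add, map_add, map_add, map_add, hs, ht]
    | tmul a b => exact seqAlgMap_eval_seqTmul i (Φ a) b
  obtain ⟨Ψ, hΨ⟩ := exists_starHom_extension (MaxTensor.ofTensor.{w} A B) f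
    {t | ∃ a b, a ⊗ₜ b = t} (TensorProduct.span_tmul_eq_top ℂ A B) (MaxTensor.denseRange_ofTensor A B)
    ⟨1, fun t => norm_le_of_forall_seqAlgMap_eval (by positivity) fun i => by
      rw [hf, one_mul]
      exact NonUnitalStarAlgHom.norm_apply_le _ _⟩
    (by
      rintro _ ⟨a, b, rfl⟩ _ ⟨a', b', rfl⟩
      refine ⟨(a * a') ⊗ₜ (b * b'), (MaxTensor.tmul_mul_tmul a a' b b').symm, ?_⟩
      refine ext_seqAlgMap_eval fun i => ?_
      rw [map_mul, hf, hf, hf, ← map_mul]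
      exact congrArg _ (MaxTensor.tmul_mul_tmul a a' b b').symm)
    (by
      rintro _ ⟨a, b, rfl⟩
      refine ⟨star a ⊗ₜ star b, (MaxTensor.star_tmul a b).symm, ?_⟩
      refine ext_seqAlgMap_eval fun i => ?_
      rw [map_star, hf, hf, ← map_star]
      exact congrArg _ (MaxTensor.star_tmul a b).symm)
  exact ⟨Ψ, fun a b => hΨ (a ⊗ₜ b)⟩

end TensorSeq

end Rokhlin
end

noncomputable section

namespace Rokhlin

/-! ### Sequential approximate units -/

section ApproximateUnit

variable {A : Type*} [NonUnitalCStarAlgebra A]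

/-- A separable C*-algebra has a contractive sequential approximate unit. -/
theorem exists_seq_approximateUnit [TopologicalSpace.SeparableSpace A] :
    ∃ e : ℕ → A, (∀ n, ‖e n‖ ≤ 1) ∧ ∀ a, Tendsto (fun n => e n * a) atTop (𝓝 a) ∧
      Tendsto (fun n => a * e n) atTop (𝓝 a) := by
  let _ := CStarAlgebra.spectralOrder A
  let _ := CStarAlgebra.spectralOrderedRing A
  have hl := CStarAlgebra.increasingApproximateUnit A
  -- Diagonal choice: the `n`-th element is a unit up to `1 / (n + 1)` for the first `n + 1` terms
  -- of a dense sequence.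
  have key : ∀ n : ℕ, ∃ x : A, ‖x‖ ≤ 1 ∧ ∀ k ∈ Finset.range (n + 1),
      dist (x * TopologicalSpace.denseSeq A k) (TopologicalSpace.denseSeq A k) < 1 / ((n : ℝ) + 1) ∧
      dist (TopologicalSpace.denseSeq A k * x) (TopologicalSpace.denseSeq A k)
        < 1 / ((n : ℝ) + 1) := by
    intro n
    have hn : (0 : ℝ) < 1 / ((n : ℝ) + 1) := Nat.one_div_pos_of_nat
    refine (hl.eventually_norm.and ((Finset.eventually_all _).2 fun k _ => ?_)).exists
    exact ((hl.tendsto_mul_right (TopologicalSpace.denseSeq A k)).eventually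
        (Metric.ball_mem_nhds _ hn)).and
      ((hl.tendsto_mul_left (TopologicalSpace.denseSeq A k)).eventually
        (Metric.ball_mem_nhds _ hn))
  choose e he1 he2 using key
  refine ⟨e, he1, fun a => ?_⟩
  have aux : ∀ ε > 0, ∀ᶠ n in atTop, ‖e n * a - a‖ < ε ∧ ‖a * e n - a‖ < ε := by
    intro ε hε
    obtain ⟨k, hk⟩ := (TopologicalSpace.denseRange_denseSeq A).exists_dist_lt a
      (show (0 : ℝ) < ε / 3 by positivity)
    set d := TopologicalSpace.denseSeq A k
    filter_upwards [eventually_ge_atTop k, (tendsto_one_div_add_atTop_nhds_zero_nat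
      (𝕜 := ℝ)).eventually (gt_mem_nhds (show (0 : ℝ) < ε / 3 by positivity))] with n hn hn'
    obtain ⟨h1, h2⟩ := he2 n k (Finset.mem_range.2 (by omega))
    rw [dist_eq_norm] at h1 h2 hk
    have h3 : ‖e n * (a - d)‖ ≤ ‖a - d‖ := (norm_mul_le _ _).trans
      (mul_le_of_le_one_left (norm_nonneg _) (he1 n))
    have h4 : ‖(a - d) * e n‖ ≤ ‖a - d‖ := (norm_mul_le _ _).trans
      (mul_le_of_le_one_right (norm_nonneg _) (he1 n))
    constructor
    · have : e n * a - a = e n * (a - d) + (e n * d - d) + (-(a - d)) := by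
        rw [mul_sub]; abel
      rw [this]
      refine (norm_add₃_le ..).trans_lt ?_
      rw [norm_neg]
      linarith
    · have : a * e n - a = (a - d) * e n + (d * e n - d) + (-(a - d)) := by
        rw [sub_mul]; abel
      rw [this]
      refine (norm_add₃_le ..).trans_lt ?_
      rw [norm_neg]
      linarith
  constructor <;> rw [Metric.tendsto_nhds] <;> intro ε hε <;>
    filter_upwards [aux ε hε] with n hn <;> rw [dist_eq_norm]
  exacts [hn.1, hn.2]

end ApproximateUnit

/-! ### A norm estimate for sums of conjugates -/

section ConjugateSum

/-- A row contraction bound: `‖∑ zᵢ aᵢ zᵢ*‖ ≤ M ‖∑ zᵢ zᵢ*‖` if `‖aᵢ‖ ≤ M` for all `i`. -/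
theorem norm_sum_mul_mul_star_le {E ι : Type*} [NonUnitalCStarAlgebra E] [Fintype ι]
    (z a : ι → E) {M : ℝ} (hM : 0 ≤ M) (ha : ∀ i, ‖a i‖ ≤ M) :
    ‖∑ i, z i * a i * star (z i)‖ ≤ M * ‖∑ i, z i * star (z i)‖ := by
  let _ := CStarAlgebra.spectralOrder E
  let _ := CStarAlgebra.spectralOrderedRing E
  -- The sum is the inner product of `z` and `(z i * a i)` in the Hilbert module `E^ι`, so
  -- Cauchy–Schwarz applies; the second vector has norm at most `M` times that of the first.
  let v : WithCStarModule E (ι → E) := (WithCStarModule.equiv E (ι → E)).symm z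
  let w : WithCStarModule E (ι → E) := (WithCStarModule.equiv E (ι → E)).symm fun i => z i * a i
  have h1 : inner E v w = ∑ i, z i * a i * star (z i) := rfl
  have h2 : ‖v‖ ^ 2 = ‖∑ i, z i * star (z i)‖ := CStarModule.norm_sq_eq E (x := v)
  have h3 : ‖w‖ ^ 2 = ‖∑ i, z i * a i * star (z i * a i)‖ := CStarModule.norm_sq_eq E (x := w)
  have h4 : ‖w‖ ^ 2 ≤ (M * ‖v‖) ^ 2 := by
    rw [h3, mul_pow, h2]
    have h5 : ∑ i, z i * a i * star (z i * a i) ≤ M ^ 2 • ∑ i, z i * star (z i) := by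
      rw [Finset.smul_sum]
      refine Finset.sum_le_sum fun i _ => ?_
      have h6 := CStarAlgebra.star_right_conjugate_le_norm_smul (a := z i)
        (IsSelfAdjoint.mul_star_self (a i))
      rw [star_mul, mul_assoc, ← mul_assoc (a i), ← mul_assoc]
      refine h6.trans (smul_le_smul_of_nonneg_right ?_ (mul_star_self_nonneg _))
      rw [CStarRing.norm_self_mul_star, ← sq]
      exact pow_le_pow_left₀ (norm_nonneg _) (ha i) 2
    refine (CStarAlgebra.norm_le_norm_of_nonneg_of_le
      (Finset.sum_nonneg fun i _ => mul_star_self_nonneg _) h5).trans ?_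
    rw [norm_smul, Real.norm_of_nonneg (by positivity)]
  have h5 : ‖w‖ ≤ M * ‖v‖ := abs_le_of_sq_le_sq' h4 (by positivity) |>.2
  rw [← h1, ← h2]
  calc _ ≤ ‖v‖ * ‖w‖ := CStarModule.norm_inner_le _
    _ ≤ ‖v‖ * (M * ‖v‖) := by gcongr
    _ = _ := by ring

end ConjugateSum

/-! ### The product of the central sequence algebra with `A` -/

section CentralAction

variable {A : Type*} [NonUnitalCStarAlgebra A]

theorem annIdeal_proj_surjective (y : CentralSeqAlg A) : ∃ x, (annIdeal A).proj x = y :=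
  (annIdeal A).mkₗ_surjective y

/-- The product `F_∞(A) × A → A_∞`. -/
def centralAct (y : CentralSeqAlg A) (a : A) : SeqAlg A :=
  (annIdeal_proj_surjective y).choose.1 * toSeqAlg A a

/-- Two representatives differ by an annihilator of `A`, so any representative computes the product.
-/
theorem centralAct_proj (x : relCommutant A) (a : A) :
    centralAct ((annIdeal A).proj x) a = x.1 * toSeqAlg A a := by
  have h := (annIdeal_proj_surjective ((annIdeal A).proj x)).choose_spec
  have h2 : _ ∈ (annIdeal A).toSubmodule := (annIdeal A).mkₗ_eq_iff.1 h
  have h3 := (h2 a).1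
  rw [← sub_eq_zero, centralAct, ← sub_mul]
  exact h3

theorem centralAct_add_left (y y' : CentralSeqAlg A) (a : A) :
    centralAct (y + y') a = centralAct y a + centralAct y' a := by
  obtain ⟨x, rfl⟩ := annIdeal_proj_surjective y
  obtain ⟨x', rfl⟩ := annIdeal_proj_surjective y'
  rw [← map_add, centralAct_proj, centralAct_proj, centralAct_proj, ← add_mul]
  rfl

theorem centralAct_smul_left (c : ℂ) (y : CentralSeqAlg A) (a : A) :
    centralAct (c • y) a = c • centralAct y a := by
  obtain ⟨x, rfl⟩ := annIdeal_proj_surjective y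
  rw [← map_smul, centralAct_proj, centralAct_proj, ← smul_mul_assoc]
  rfl

theorem centralAct_add_right (y : CentralSeqAlg A) (a a' : A) :
    centralAct y (a + a') = centralAct y a + centralAct y a' := by
  rw [centralAct, map_add, mul_add]
  rfl

theorem centralAct_smul_right (c : ℂ) (y : CentralSeqAlg A) (a : A) :
    centralAct y (c • a) = c • centralAct y a := by
  rw [centralAct, map_smul, mul_smul_comm]
  rfl

theorem continuous_centralAct (y : CentralSeqAlg A) : Continuous (centralAct y) :=
  continuous_const.mul (KTheory.continuous_starHom (toSeqAlg A))

/-- Representatives commute with `A`, so `x x' a a' = (x a)(x' a')`. This makes `f ⊗ a ↦ φ(f) a`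
multiplicative. -/
theorem centralAct_mul (y y' : CentralSeqAlg A) (a a' : A) :
    centralAct (y * y') (a * a') = centralAct y a * centralAct y' a' := by
  obtain ⟨x, rfl⟩ := annIdeal_proj_surjective y
  obtain ⟨x', rfl⟩ := annIdeal_proj_surjective y'
  rw [← map_mul, centralAct_proj, centralAct_proj, centralAct_proj, map_mul, mul_assoc,
    ← mul_assoc (toSeqAlg A a), ← x'.2 a]
  show x.1 * x'.1 * _ = _
  simp only [mul_assoc]

theorem centralAct_star (y : CentralSeqAlg A) (a : A) :
    centralAct (star y) (star a) = star (centralAct y a) := by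
  obtain ⟨x, rfl⟩ := annIdeal_proj_surjective y
  rw [← map_star, centralAct_proj, centralAct_proj, star_mul, ← map_star]
  exact (star x).2 (star a)

theorem seqAlgMap_centralAct (θ : A ≃⋆ₐ[ℂ] A) (y : CentralSeqAlg A) (a : A) :
    seqAlgMap (θ : A →⋆ₙₐ[ℂ] A) (centralAct y a) = centralAct (centralSeqMap θ y) (θ a) := by
  obtain ⟨x, rfl⟩ := annIdeal_proj_surjective y
  have h : centralSeqMap θ ((annIdeal A).proj x) = (annIdeal A).proj (relCommutantMap θ x) := rfl
  rw [h, centralAct_proj, centralAct_proj, map_mul]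
  rfl

/-- A unit of `F_∞(A)` acts as the identity on `A`. -/
theorem centralAct_unit [TopologicalSpace.SeparableSpace A] {u : CentralSeqAlg A}
    (hu : ∀ y, u * y = y) (a : A) : centralAct u a = toSeqAlg A a := by
  obtain ⟨e, he1, he⟩ := exists_seq_approximateUnit (A := A)
  -- A sequential approximate unit defines an element of the relative commutant that acts as the
  -- identity on `A`. Multiplying it by `u` and then by `a` computes `u a`.
  let E : SeqAlg A := (nullSeq A).proj (BddSeq.ofBound e 1 he1)
  have hE1 : ∀ a, E * toSeqAlg A a = toSeqAlg A a := fun a => by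
    refine (map_mul (nullSeq A).proj _ _).symm.trans (proj_eq_proj_iff.2 ?_)
    exact tendsto_sub_nhds_zero_iff.2 (he a).1
  have hE2 : ∀ a, toSeqAlg A a * E = toSeqAlg A a := fun a => by
    refine (map_mul (nullSeq A).proj _ _).symm.trans (proj_eq_proj_iff.2 ?_)
    exact tendsto_sub_nhds_zero_iff.2 (he a).2
  let E' : relCommutant A := ⟨E, fun a => by rw [hE1, hE2]⟩
  obtain ⟨x, rfl⟩ := annIdeal_proj_surjective u
  have h := congrArg (fun y => centralAct y a) (hu ((annIdeal A).proj E'))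
  simp only [← map_mul, centralAct_proj] at h
  rw [centralAct_proj]
  have h1 : (x * E').1 * toSeqAlg A a = x.1 * (E * toSeqAlg A a) := mul_assoc _ _ _
  rw [h1, hE1] at h
  rw [h]

end CentralAction

end Rokhlin
end

noncomputable section

namespace Rokhlin

/-! ### Partitions of unity on `G` -/

section PartitionOfUnity

/-- On a compact metrizable space there are finite partitions of unity, with sample points, along
which Riemann sums of continuous functions converge uniformly. -/
theorem exists_seq_partition (G : Type*) [TopologicalSpace G] [CompactSpace G] [T2Space G]
    [SecondCountableTopology G] :
    ∃ (N : ℕ → Finset G) (ρ : ∀ n, N n → C(G, ℝ)), (∀ n k x, 0 ≤ ρ n k x) ∧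
      (∀ n x, ∑ k, ρ n k x = 1) ∧
      ∀ (V : Type _) [NormedAddCommGroup V] [NormedSpace ℝ V] (F : C(G, V)) (ε : ℝ), 0 < ε →
        ∀ᶠ n in atTop, ∀ x, ‖∑ k, ρ n k x • F k.1 - F x‖ ≤ ε := by
  let _ : MetricSpace G := TopologicalSpace.metrizableSpaceMetric G
  -- Supports shrink to radius `1 / (n + 1)` in a fixed metric, so one sequence of partitions serves
  -- every `F` by uniform continuity.
  have key : ∀ n : ℕ, ∃ (N : Finset G) (ρ : N → C(G, ℝ)), (∀ k x, 0 ≤ ρ k x) ∧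
      (∀ x, ∑ k, ρ k x = 1) ∧ ∀ k x, ρ k x ≠ 0 → dist x k.1 < 1 / ((n : ℝ) + 1) := by
    intro n
    have hn : (0 : ℝ) < 1 / ((n : ℝ) + 1) := Nat.one_div_pos_of_nat
    obtain ⟨N, -, hN⟩ := isCompact_univ.elim_nhds_subcover
      (fun x : G => Metric.ball x (1 / ((n : ℝ) + 1))) fun x _ => Metric.ball_mem_nhds x hn
    obtain ⟨f, hf⟩ := PartitionOfUnity.exists_isSubordinate (s := Set.univ) isClosed_univ
      (fun k : N => Metric.ball k.1 (1 / ((n : ℝ) + 1))) (fun _ => Metric.isOpen_ball) (by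
        intro x hx
        obtain ⟨k, hk, hxk⟩ := Set.mem_iUnion₂.1 (hN hx)
        exact Set.mem_iUnion.2 ⟨⟨k, hk⟩, hxk⟩)
    refine ⟨N, fun k => f k, fun k x => f.nonneg k x, fun x => ?_, fun k x hx => ?_⟩
    · rw [← finsum_eq_sum_of_fintype]
      exact f.sum_eq_one (Set.mem_univ x)
    · exact hf k (subset_tsupport _ hx)
  choose N ρ h0 h1 h2 using key
  refine ⟨N, ρ, h0, h1, fun V _ _ F ε hε => ?_⟩
  obtain ⟨δ, hδ, hF⟩ := Metric.uniformContinuous_iff.1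
    (CompactSpace.uniformContinuous_of_continuous F.continuous) ε hε
  filter_upwards [(tendsto_one_div_add_atTop_nhds_zero_nat (𝕜 := ℝ)).eventually
    (gt_mem_nhds hδ)] with n hn x
  have h3 : ∑ k, ρ n k x • F k.1 - F x = ∑ k, ρ n k x • (F k.1 - F x) := by
    simp only [smul_sub, Finset.sum_sub_distrib, ← Finset.sum_smul, h1, one_smul]
  rw [h3]
  calc _ ≤ ∑ k, ρ n k x * ε := by
        refine norm_sum_le_of_le _ fun k _ => ?_
        rw [norm_smul, Real.norm_of_nonneg (h0 n k x)]
        by_cases hk : ρ n k x = 0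
        · simp [hk]
        · refine mul_le_mul_of_nonneg_left ?_ (h0 n k x)
          rw [← dist_eq_norm, dist_comm]
          exact (hF ((h2 n k x hk).trans hn)).le
    _ = ε := by rw [← Finset.sum_mul, h1, one_mul]

end PartitionOfUnity

/-! ### The homomorphism `C(G, A) → A_∞` -/

section Evaluation

open scoped TensorProduct

variable {A G : Type*} [NonUnitalCStarAlgebra A] [TopologicalSpace G]

/-- The elementary tensor `f ⊗ a` as a function `G → A`. -/
def smulConst (f : C(G, ℂ)) (a : A) : C(G, A) := ⟨fun g => f g • a, by fun_prop⟩

@[simp]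
theorem smulConst_apply (f : C(G, ℂ)) (a : A) (g : G) : smulConst f a g = f g • a := rfl

variable (A G) in
/-- The canonical map `C(G) ⊙ A → C(G, A)`. -/
def smulConstLin : C(G, ℂ) ⊗[ℂ] A →ₗ[ℂ] C(G, A) :=
  TensorProduct.lift (LinearMap.mk₂ ℂ smulConst
    (fun f f' a => by ext g; simp [add_smul])
    (fun c f a => by ext g; simp [mul_smul])
    (fun f a a' => by ext g; simp)
    (fun c f a => by ext g; exact smul_comm _ _ _))

theorem smulConstLin_tmul (f : C(G, ℂ)) (a : A) :
    smulConstLin A G (f ⊗ₜ a) = smulConst f a := rfl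

/-- A real-valued function as a complex-valued one. -/
def complexify (f : C(G, ℝ)) : C(G, ℂ) := ⟨fun g => (f g : ℂ), by fun_prop⟩

@[simp]
theorem complexify_apply (f : C(G, ℝ)) (g : G) : complexify f g = (f g : ℂ) := rfl

/-- The square root of a function. -/
def sqrtFun (f : C(G, ℝ)) : C(G, ℂ) := ⟨fun g => (Real.sqrt (f g) : ℂ), by fun_prop⟩

theorem sqrtFun_mul_star (f : C(G, ℝ)) (hf : ∀ g, 0 ≤ f g) :
    sqrtFun f * star (sqrtFun f) = complexify f := by
  ext g
  show (Real.sqrt (f g) : ℂ) * star (Real.sqrt (f g) : ℂ) = (f g : ℂ)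
  rw [Complex.star_def, Complex.conj_ofReal, ← Complex.ofReal_mul, Real.mul_self_sqrt (hf g)]

/-- For `c` in `A` and `z k = φ(√ρ k) c`, one has `φ(ρ k) (c (a k) c*) = z k (a k) (z k)*` and `∑ z
k (z k)* = c c*`. The estimate for sums of conjugates then gives the bound for contractive `c`, and
`c` runs through an approximate unit to remove it. -/
theorem norm_sum_centralAct_le [TopologicalSpace.SeparableSpace A]
    (φ : C(G, ℂ) →⋆ₙₐ[ℂ] CentralSeqAlg A) (hφ : ∀ y, φ 1 * y = y)
    {ι : Type*} [Fintype ι] (ρ : ι → C(G, ℝ))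
    (h0 : ∀ k x, 0 ≤ ρ k x) (h1 : ∀ x, ∑ k, ρ k x = 1) (a : ι → A) {M : ℝ} (hM : 0 ≤ M)
    (ha : ∀ k, ‖a k‖ ≤ M) : ‖∑ k, centralAct (φ (complexify (ρ k))) (a k)‖ ≤ M := by
  obtain ⟨e, he1, he⟩ := exists_seq_approximateUnit (A := A)
  have hsum : ∑ k, complexify (ρ k) = 1 := by
    ext x
    simp only [ContinuousMap.sum_apply, complexify_apply, ContinuousMap.one_apply]
    rw [← Complex.ofReal_sum, h1, Complex.ofReal_one]
  choose x hx using fun k => annIdeal_proj_surjective (φ (sqrtFun (ρ k)))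
  -- `x k` represents `φ(√ρ k)`. Since it and its adjoint commute with `A`, both can be moved to the
  -- outside, next to `c` and `star c`.
  have hconj : ∀ (c a : A) k, centralAct (φ (complexify (ρ k))) (c * a * star c)
      = ((x k).1 * toSeqAlg A c) * toSeqAlg A a * star ((x k).1 * toSeqAlg A c) := by
    intro c a k
    rw [← sqrtFun_mul_star _ (h0 k), map_mul, map_star, ← hx, mul_assoc c a, centralAct_mul,
      centralAct_proj, ← map_star, centralAct_proj, map_mul]
    have h2 : ((star (x k)).1 : SeqAlg A) = star (x k).1 := rfl
    have h3 := (star (x k)).2 (star c)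
    have h4 := (star (x k)).2 a
    rw [h2] at h3 h4 ⊢
    rw [star_mul, ← map_star, ← h3, mul_assoc ((x k).1 * toSeqAlg A c), ← mul_assoc (star (x k).1),
      h4]
    simp only [mul_assoc]
  have hconj' : ∀ (c : A) k, centralAct (φ (complexify (ρ k))) (c * star c)
      = ((x k).1 * toSeqAlg A c) * star ((x k).1 * toSeqAlg A c) := by
    intro c k
    rw [← sqrtFun_mul_star _ (h0 k), map_mul, map_star, ← hx, centralAct_mul, centralAct_star,
      centralAct_proj]
  have hadd : ∀ a, ∑ k, centralAct (φ (complexify (ρ k))) a = toSeqAlg A a := by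
    intro a
    let L : CentralSeqAlg A →+ SeqAlg A :=
      AddMonoidHom.mk' (fun y => centralAct y a) fun y y' => centralAct_add_left y y' a
    have : ∑ k, L (φ (complexify (ρ k))) = L (φ 1) := by rw [← map_sum, ← map_sum, hsum]
    exact this.trans (centralAct_unit hφ a)
  have hbound : ∀ c : A, ‖c‖ ≤ 1 →
      ‖∑ k, centralAct (φ (complexify (ρ k))) (c * a k * star c)‖ ≤ M := by
    intro c hc
    simp only [hconj]
    refine (norm_sum_mul_mul_star_le _ (fun k => toSeqAlg A (a k)) hM
      (fun k => (norm_toSeqAlg _).trans_le (ha k))).trans ?_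
    simp only [← hconj']
    rw [hadd, norm_toSeqAlg, CStarRing.norm_self_mul_star]
    exact mul_le_of_le_one_right hM (mul_le_one₀ hc (norm_nonneg _) hc)
  have hlim : Tendsto (fun n => ∑ k, centralAct (φ (complexify (ρ k))) (e n * a k * star (e n)))
      atTop (𝓝 (∑ k, centralAct (φ (complexify (ρ k))) (a k))) := by
    refine tendsto_finsetSum _ fun k _ => ?_
    refine ((continuous_centralAct _).tendsto _).comp ?_
    have h2 : Tendsto (fun n => a k * star (e n)) atTop (𝓝 (a k)) := by
      have := (continuous_star.tendsto _).comp (he (star (a k))).1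
      simpa [Function.comp_def] using this
    have h3 : Tendsto (fun n => e n * (a k * star (e n) - a k)) atTop (𝓝 0) := by
      refine squeeze_zero_norm (fun n => (norm_mul_le _ _).trans
        (mul_le_of_le_one_left (norm_nonneg _) (he1 n))) ?_
      exact tendsto_zero_iff_norm_tendsto_zero.1 (tendsto_sub_nhds_zero_iff.2 h2)
    have h4 := h3.add (he (a k)).1
    rw [zero_add] at h4
    refine h4.congr fun n => ?_
    rw [mul_sub, sub_add_cancel, mul_assoc]
  exact le_of_tendsto' hlim.norm fun n => hbound (e n) (he1 n)

variable [CompactSpace G]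

theorem denseRange_smulConstLin [T2Space G] [SecondCountableTopology G] :
    DenseRange (smulConstLin A G) := by
  obtain ⟨N, ρ, -, -, h⟩ := exists_seq_partition G
  intro F
  rw [Metric.mem_closure_iff]
  intro ε hε
  obtain ⟨n, hn⟩ := (h A F (ε / 2) (half_pos hε)).exists
  refine ⟨_, ⟨∑ k, complexify (ρ n k) ⊗ₜ F k.1, rfl⟩, ?_⟩
  refine lt_of_le_of_lt ?_ (half_lt_self hε)
  rw [dist_comm, dist_eq_norm, ContinuousMap.norm_le _ (half_pos hε).le]
  intro x
  refine le_of_eq_of_le ?_ (hn x)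
  simp [smulConstLin_tmul]

variable [TopologicalSpace.SeparableSpace A] (φ : C(G, ℂ) →⋆ₙₐ[ℂ] CentralSeqAlg A)

/-- Adding `|√r|²` with `r = ‖f‖² - |f|²` completes `|f|²` to a constant. In `A_∞` this bounds
`(φ(f) a)(φ(f) a)*` above by `‖f‖² a a*`. -/
theorem norm_centralAct_hom_le (hφ : ∀ y, φ 1 * y = y) (f : C(G, ℂ)) (a : A) :
    ‖centralAct (φ f) a‖ ≤ ‖f‖ * ‖a‖ := by
  let _ := CStarAlgebra.spectralOrder (SeqAlg A)
  let _ := CStarAlgebra.spectralOrderedRing (SeqAlg A)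
  let r : C(G, ℝ) := ⟨fun g => ‖f‖ ^ 2 - ‖f g‖ ^ 2, by fun_prop⟩
  have hr : ∀ g, 0 ≤ r g := fun g =>
    sub_nonneg.2 (pow_le_pow_left₀ (norm_nonneg _) (f.norm_coe_le_norm g) 2)
  have h1 : f * star f + sqrtFun r * star (sqrtFun r) = ((‖f‖ ^ 2 : ℝ) : ℂ) • (1 : C(G, ℂ)) := by
    rw [sqrtFun_mul_star r hr]
    ext g
    have : f g * star (f g) = ((‖f g‖ ^ 2 : ℝ) : ℂ) := by
      rw [Complex.star_def, Complex.mul_conj, Complex.normSq_eq_norm_sq]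
    simp only [ContinuousMap.add_apply, ContinuousMap.mul_apply, ContinuousMap.star_apply, this,
      complexify_apply, r, ContinuousMap.coe_mk, ContinuousMap.smul_apply, ContinuousMap.one_apply]
    push_cast
    simp
  have h2 : ∀ f, centralAct (φ f) a * star (centralAct (φ f) a)
      = centralAct (φ (f * star f)) (a * star a) := by
    intro f
    rw [map_mul, map_star, centralAct_mul, centralAct_star]
  have h3 : centralAct (φ f) a * star (centralAct (φ f) a)
      + centralAct (φ (sqrtFun r)) a * star (centralAct (φ (sqrtFun r)) a)
      = ((‖f‖ ^ 2 : ℝ) : ℂ) • toSeqAlg A (a * star a) := by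
    rw [h2, h2, ← centralAct_add_left, ← map_add, h1, map_smul, centralAct_smul_left,
      centralAct_unit hφ]
  have h4 : ‖centralAct (φ f) a * star (centralAct (φ f) a)‖
      ≤ ‖((‖f‖ ^ 2 : ℝ) : ℂ) • toSeqAlg A (a * star a)‖ := by
    rw [← h3]
    exact CStarAlgebra.norm_le_norm_of_nonneg_of_le (mul_star_self_nonneg _)
      (le_add_of_nonneg_right (mul_star_self_nonneg _))
  rw [CStarRing.norm_self_mul_star, norm_smul, norm_toSeqAlg, CStarRing.norm_self_mul_star,
    Complex.norm_real, Real.norm_of_nonneg (by positivity)] at h4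
  refine abs_le_of_sq_le_sq' (a := ‖centralAct (φ f) a‖) ?_ (by positivity) |>.2
  calc _ = _ := sq _
    _ ≤ _ := h4
    _ = _ := by ring

/-- A unital `*`-homomorphism `C(G) → F_∞(A)` induces a `*`-homomorphism `C(G, A) → A_∞`. -/
theorem exists_evaluation_hom [T2Space G] [SecondCountableTopology G]
    (hφ : ∀ y, φ 1 * y = y) :
    ∃ ψ : C(G, A) →⋆ₙₐ[ℂ] SeqAlg A, ∀ f a, ψ (smulConst f a) = centralAct (φ f) a := by
  obtain ⟨N, ρ, h0, h1, h⟩ := exists_seq_partition G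
  let L : C(G, ℂ) ⊗[ℂ] A →ₗ[ℂ] SeqAlg A :=
    TensorProduct.lift (LinearMap.mk₂ ℂ (fun f a => centralAct (φ f) a)
      (fun f f' a => by rw [map_add, centralAct_add_left])
      (fun c f a => by rw [map_smul, centralAct_smul_left])
      (fun f a a' => centralAct_add_right _ _ _)
      (fun c f a => centralAct_smul_right _ _ _))
  have hL : ∀ f a, L (f ⊗ₜ a) = centralAct (φ f) a := fun f a => rfl
  -- `L t` is a limit of Riemann sums built from the values of `t` as a function `G → A`. Each sum
  -- has norm at most the sup norm of that function, which is the bound needed to extend `L` to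
  -- `C(G, A)`.
  have hlim : ∀ t, Tendsto (fun n => ∑ k, centralAct (φ (complexify (ρ n k)))
      (smulConstLin A G t k.1)) atTop (𝓝 (L t)) := by
    intro t
    induction t with
    | zero =>
      simp only [map_zero, ContinuousMap.zero_apply]
      have : ∀ y : CentralSeqAlg A, centralAct y 0 = 0 := fun y => by
        rw [← zero_smul ℂ (0 : A), centralAct_smul_right, zero_smul]
      simp only [this, Finset.sum_const_zero]
      exact tendsto_const_nhds
    | add s t hs ht =>
      simp only [map_add, ContinuousMap.add_apply, centralAct_add_right, Finset.sum_add_distrib]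
      exact hs.add ht
    | tmul f a =>
      have hsum : ∀ n, ∑ k, centralAct (φ (complexify (ρ n k))) (smulConstLin A G (f ⊗ₜ a) k.1)
          = L ((∑ k, f k.1 • complexify (ρ n k)) ⊗ₜ a) := by
        intro n
        rw [TensorProduct.sum_tmul, map_sum]
        refine Finset.sum_congr rfl fun k _ => ?_
        rw [hL, smulConstLin_tmul, smulConst_apply, centralAct_smul_right, map_smul,
          centralAct_smul_left]
      simp only [hsum]
      rw [← tendsto_sub_nhds_zero_iff, Metric.tendsto_nhds]
      intro ε hε
      have hε' : 0 < ε / (2 * (‖a‖ + 1)) := by positivity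
      filter_upwards [h ℂ f _ hε'] with n hn
      rw [dist_zero_right, ← map_sub, ← TensorProduct.sub_tmul, hL]
      refine (norm_centralAct_hom_le φ hφ _ a).trans_lt ?_
      have h2 : ‖∑ k, f k.1 • complexify (ρ n k) - f‖ ≤ ε / (2 * (‖a‖ + 1)) := by
        rw [ContinuousMap.norm_le _ hε'.le]
        intro x
        refine le_of_eq_of_le ?_ (hn x)
        simp [mul_comm]
      calc _ ≤ ε / (2 * (‖a‖ + 1)) * ‖a‖ := by gcongr
        _ < ε / (2 * (‖a‖ + 1)) * (2 * (‖a‖ + 1)) := by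
          gcongr
          linarith [norm_nonneg a]
        _ = ε := by field_simp
  obtain ⟨ψ, hψ⟩ := exists_starHom_extension (smulConstLin A G) L {t | ∃ f a, f ⊗ₜ a = t}
    (TensorProduct.span_tmul_eq_top ℂ C(G, ℂ) A) denseRange_smulConstLin
    ⟨1, fun t => by
      rw [one_mul]
      exact le_of_tendsto' (hlim t).norm fun n => norm_sum_centralAct_le φ hφ (ρ n) (h0 n) (h1 n)
        (fun k => smulConstLin A G t k.1) (norm_nonneg _)
        fun k => ContinuousMap.norm_coe_le_norm _ _⟩
    (by
      rintro _ ⟨f, a, rfl⟩ _ ⟨f', a', rfl⟩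
      refine ⟨(f * f') ⊗ₜ (a * a'), ?_, ?_⟩
      · ext g
        simp [smulConstLin_tmul, smul_mul_smul_comm]
      · rw [hL, hL, hL, map_mul, centralAct_mul])
    (by
      rintro _ ⟨f, a, rfl⟩
      refine ⟨star f ⊗ₜ star a, ?_, ?_⟩
      · ext g
        simp [smulConstLin_tmul]
      · rw [hL, hL, map_star, centralAct_star])
  exact ⟨ψ, fun f a => hψ (f ⊗ₜ a)⟩

end Evaluation

end Rokhlin
end

noncomputable section

namespace Rokhlin

/-! ### Averaging fixed elements of the sequence algebra -/

section FixedPoints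

open MeasureTheory

variable {A G : Type*} [NonUnitalCStarAlgebra A] [Group G] [TopologicalSpace G]
  [IsTopologicalGroup G] [CompactSpace G] [SecondCountableTopology G]

/-- An element of `A_∞` that is fixed by all `α_g` is represented by a sequence in the fixed point
algebra. -/
theorem exists_fixedPoints_lift (α : G →* (A ≃⋆ₐ[ℂ] A)) (hα : ∀ a, Continuous fun g => α g a)
    (x : SeqAlg A) (hx : ∀ g, seqAlgMap (α g : A →⋆ₙₐ[ℂ] A) x = x) :
    ∃ y : SeqAlg (fixedPoints α), seqAlgMap (fixedIncl α) y = x := by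
  obtain ⟨x, rfl⟩ := proj_surjective x
  let _ : MeasurableSpace G := borel G
  have _ : BorelSpace G := ⟨rfl⟩
  let μ : Measure G := Measure.haarMeasure ⊤
  have hμ : IsProbabilityMeasure μ := ⟨by
    simpa using Measure.haarMeasure_self (K₀ := (⊤ : TopologicalSpace.PositiveCompacts G))⟩
  have hnorm : ∀ g a, ‖α g a‖ ≤ ‖a‖ := fun g a =>
    NonUnitalStarAlgHom.norm_apply_le ((α g : A ≃⋆ₐ[ℂ] A) : A →⋆ₙₐ[ℂ] A) a
  have h_int : ∀ a, Integrable (fun g => α g a) μ := fun a =>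
    (hα a).integrable_of_hasCompactSupport (HasCompactSupport.of_compactSpace _)
  let avg : A → A := fun a => ∫ g, α g a ∂μ
  have havg : ∀ a, avg a ∈ fixedPoints α := by
    intro a h
    let T : A →L[ℂ] A := LinearMap.mkContinuous
      { toFun := α h, map_add' := map_add (α h), map_smul' := map_smul (α h) } 1
      fun b => by simpa using hnorm h b
    have h1 : α h (avg a) = ∫ g, T (α g a) ∂μ := (T.integral_comp_comm (h_int a)).symm
    rw [h1]
    have h2 : ∀ g, T (α g a) = α (h * g) a := fun g => by rw [map_mul]; rfl
    simp only [h2]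
    exact integral_mul_left_eq_self (fun g => α g a) h
  have hb : ∀ a, ‖avg a‖ ≤ ‖a‖ := fun a => by
    simpa using norm_integral_le_of_norm_le_const (μ := μ) (.of_forall fun g => hnorm g a)
  let y : BddSeq (fixedPoints α) := BddSeq.ofBound (fun n => ⟨avg (x n), havg _⟩) ‖x‖ fun n =>
    (hb (x n)).trans (x.norm_apply_le n)
  refine ⟨(nullSeq _).proj y, ?_⟩
  rw [seqAlgMap_proj, proj_eq_proj_iff]
  show Tendsto (fun n => avg (x n) - x n) atTop (𝓝 0)
  -- Invariance of the class only says that `α g (x n) - x n` is null for each single `g`. Dominated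
  -- convergence turns this into convergence of the averages, with no uniformity in `g`.
  have hdc : Tendsto (fun n => ∫ g, (α g (x n) - x n) ∂μ) atTop (𝓝 (∫ _, (0 : A) ∂μ)) := by
    refine tendsto_integral_of_dominated_convergence (fun _ => 2 * ‖x‖)
      (fun n => ((hα (x n)).sub continuous_const).aestronglyMeasurable) (integrable_const _)
      (fun n => .of_forall fun g => ?_) (.of_forall fun g => ?_)
    · refine (norm_sub_le _ _).trans ?_
      linarith [hnorm g (x n), x.norm_apply_le n]
    · exact proj_eq_proj_iff.1 (hx g)
  rw [integral_zero] at hdc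
  refine hdc.congr fun n => ?_
  rw [integral_sub (h_int _) (integrable_const _)]
  simp [avg]

end FixedPoints

/-! ### The splitting provided by the Rokhlin property -/

section Splitting

variable {A G : Type*} [NonUnitalCStarAlgebra A] [TopologicalSpace.SeparableSpace A] [Group G]
  [TopologicalSpace G] [IsTopologicalGroup G] [CompactSpace G] [T2Space G]
  [SecondCountableTopology G]

/-- The diagonal action of `g` on `C(G, A)`. -/
def diagAction (α : G →* (A ≃⋆ₐ[ℂ] A)) (g : G) : C(G, A) →⋆ₙₐ[ℂ] C(G, A) where
  toFun F := ⟨fun h => α g (F (g⁻¹ * h)),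
    (KTheory.continuous_starHom ((α g : A ≃⋆ₐ[ℂ] A) : A →⋆ₙₐ[ℂ] A)).comp
      (F.continuous.comp (continuous_const_mul g⁻¹))⟩
  map_smul' c F := by ext h; exact map_smul (α g) c _
  map_zero' := by ext h; exact map_zero (α g)
  map_add' F F' := by ext h; exact map_add (α g) _ _
  map_mul' F F' := by ext h; exact map_mul (α g) _ _
  map_star' F := by ext h; exact map_star (α g) _

/-- The Rokhlin property provides a `*`-homomorphism `C(G, A) → A_∞` that restricts to the canonical
embedding on constant functions and maps the range of the coaction into `(A^α)_∞`. -/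
theorem HasRokhlinProperty.exists_splitting {α : G →* (A ≃⋆ₐ[ℂ] A)}
    (hR : HasRokhlinProperty α) (hα : ∀ a, Continuous fun g => α g a) :
    ∃ (ψ : C(G, A) →⋆ₙₐ[ℂ] SeqAlg A) (θ : A →⋆ₙₐ[ℂ] SeqAlg (fixedPoints α)),
      ψ.comp (constEmb A G) = toSeqAlg A ∧
      ψ.comp (coaction α hα) = (seqAlgMap (fixedIncl α)).comp θ ∧
      θ.comp (fixedIncl α) = toSeqAlg (fixedPoints α) := by
  obtain ⟨φ, -, hφ1, hφ⟩ := hR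
  obtain ⟨ψ, hψ⟩ := exists_evaluation_hom φ fun y => (hφ1 y).1
  have hconst : ψ.comp (constEmb A G) = toSeqAlg A := by
    ext a
    have : constEmb A G a = smulConst 1 a := by ext g; exact (one_smul ℂ a).symm
    show ψ (constEmb A G a) = _
    rw [this, hψ, centralAct_unit fun y => (hφ1 y).1]
  -- Both sides are continuous in `F`, so elementary tensors suffice; there the claim is the
  -- equivariance of `φ`.
  have hequiv : ∀ g F, seqAlgMap (α g : A →⋆ₙₐ[ℂ] A) (ψ F) = ψ (diagAction α g F) := by
    intro g F
    refine congrFun (denseRange_smulConstLin.equalizer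
      ((KTheory.continuous_starHom (seqAlgMap (α g : A →⋆ₙₐ[ℂ] A))).comp
        (KTheory.continuous_starHom ψ))
      ((KTheory.continuous_starHom ψ).comp (KTheory.continuous_starHom (diagAction α g)))
      (funext fun t => ?_)) F
    simp only [Function.comp_apply]
    induction t with
    | zero => simp
    | add s t hs ht => simp only [map_add, hs, ht]
    | tmul f a =>
      have : diagAction α g (smulConst f a) = smulConst (shift g f) (α g a) := by
        ext h
        exact map_smul (α g) _ _
      rw [smulConstLin_tmul, this, hψ, hψ, seqAlgMap_centralAct, hφ]
  have hfix : ∀ a, ∃ y, seqAlgMap (fixedIncl α) y = ψ (coaction α hα a) := by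
    intro a
    refine exists_fixedPoints_lift α hα _ fun g => ?_
    rw [hequiv]
    congr 1
    ext h
    show α g (α (g⁻¹ * h) a) = α h a
    rw [← StarAlgEquiv.mul_apply, ← map_mul, mul_inv_cancel_left]
  -- Lifts to `(A^α)_∞` are unique, so the pointwise chosen `θ` is automatically a `*`-homomorphism.
  have hinj : Function.Injective (seqAlgMap (fixedIncl α)) :=
    seqAlgMap_injective _ Subtype.val_injective
  choose θ hθ using hfix
  let Θ : A →⋆ₙₐ[ℂ] SeqAlg (fixedPoints α) :=
    { toFun := θ
      map_smul' := fun c a => hinj (by simp only [hθ, map_smul, MonoidHom.id_apply])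
      map_zero' := hinj (by simp only [hθ, map_zero])
      map_add' := fun a b => hinj (by simp only [hθ, map_add])
      map_mul' := fun a b => hinj (by simp only [hθ, map_mul])
      map_star' := fun a => hinj (by simp only [hθ, map_star]) }
  refine ⟨ψ, Θ, hconst, ?_, ?_⟩
  · ext a
    exact (hθ a).symm
  · ext a
    refine hinj ((hθ (fixedIncl α a)).trans ?_)
    have : coaction α hα (fixedIncl α a) = constEmb A G (fixedIncl α a) := by
      ext g
      exact a.2 g
    rw [this, seqAlgMap_toSeqAlg]
    exact DFunLike.congr_fun hconst _

end Splitting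

end Rokhlin
end

noncomputable section

namespace KTheory

/-! ### Perturbation to projections and unitaries -/

section Perturbation

variable {M : Type*} [CStarAlgebra M]

/-- An almost idempotent self-adjoint element is close to a projection. -/
theorem exists_isStarProjection_near {y : M} (hy : IsSelfAdjoint y) (h : ‖y * y - y‖ < 1 / 4) :
    ∃ q : M, IsStarProjection q ∧ ‖q - y‖ ≤ 2 * ‖y * y - y‖ := by
  have hspec : ∀ t ∈ spectrum ℝ y, |t * t - t| ≤ ‖y * y - y‖ := by
    intro t ht
    have h1 : cfc (fun t : ℝ => t * t - t) y = y * y - y := by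
      rw [cfc_sub (fun t : ℝ => t * t) (fun t => t) y, cfc_mul (fun t : ℝ => t) (fun t => t) y,
        cfc_id' ℝ y]
    rw [← h1]
    exact norm_apply_le_norm_cfc (fun t : ℝ => t * t - t) y ht
  -- The constant `1 / 4` is `|t * t - t|` at `t = 1 / 2`: below it the spectrum has a gap there.
  have hne : ∀ t ∈ spectrum ℝ y, |2 * t - 1| ≠ 0 := by
    intro t ht h0
    have h1 : t = 1 / 2 := by linarith [abs_eq_zero.1 h0]
    have h2 := (hspec t ht).trans_lt h
    rw [h1, show (1 / 2 * (1 / 2) - 1 / 2 : ℝ) = -(1 / 4) by norm_num, abs_neg,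
      abs_of_pos (by norm_num)] at h2
    exact lt_irrefl _ h2
  -- The indicator of `t > 1 / 2` away from that point, in a form whose continuity on the spectrum
  -- is immediate.
  let χ : ℝ → ℝ := fun t => (1 + (2 * t - 1) / |2 * t - 1|) / 2
  have hχ : ContinuousOn χ (spectrum ℝ y) := by
    refine ContinuousOn.div_const (continuousOn_const.add (ContinuousOn.div ?_ ?_ hne)) 2 <;>
      fun_prop
  have hval : ∀ t ∈ spectrum ℝ y, (χ t = 1 ∧ 1 / 2 < t) ∨ (χ t = 0 ∧ t < 1 / 2) := by
    intro t ht
    rcases lt_or_gt_of_ne (abs_ne_zero.1 (hne t ht)) with h0 | h0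
    · right
      refine ⟨?_, by linarith⟩
      simp only [χ, abs_of_neg h0, div_neg, div_self h0.ne]
      norm_num
    · left
      refine ⟨?_, by linarith⟩
      simp only [χ, abs_of_pos h0, div_self h0.ne']
      norm_num
  refine ⟨cfc χ y, ⟨?_, cfc_predicate χ y⟩, ?_⟩
  · show cfc χ y * cfc χ y = cfc χ y
    rw [← cfc_mul χ χ y]
    refine cfc_congr fun t ht => ?_
    rcases hval t ht with ⟨h1, -⟩ | ⟨h1, -⟩ <;> simp [h1]
  · nth_rewrite 2 [← cfc_id' ℝ y]
    rw [← cfc_sub χ (fun t => t) y]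
    refine norm_cfc_le (by positivity) fun t ht => ?_
    refine le_trans ?_ (mul_le_mul_of_nonneg_left (hspec t ht) zero_le_two)
    have h2 : |t * t - t| = |t| * |t - 1| := by rw [← abs_mul]; congr 1; ring
    rw [h2, Real.norm_eq_abs]
    rcases hval t ht with ⟨h1, h3⟩ | ⟨h1, h3⟩
    · rw [h1, abs_sub_comm, abs_of_pos (by linarith : 0 < t)]
      nlinarith [abs_nonneg (t - 1)]
    · rw [h1, zero_sub, abs_neg, abs_of_neg (by linarith : t - 1 < 0)]
      nlinarith [abs_nonneg t]

/-- The inverse square root of a self-adjoint element close to `1`. -/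
theorem exists_inv_sqrt {h : M} (hs : IsSelfAdjoint h) (h1 : ‖h - 1‖ < 1) :
    ∃ r : M, IsSelfAdjoint r ∧ r * r * h = 1 ∧ (∀ b, Commute h b → Commute r b) ∧
      (‖h - 1‖ ≤ 1 / 2 → ‖r - 1‖ ≤ 2 * ‖h - 1‖) := by
  have hspec : ∀ t ∈ spectrum ℝ h, |t - 1| ≤ ‖h - 1‖ := by
    intro t ht
    have h2 : cfc (fun t : ℝ => t - 1) h = h - 1 := by
      rw [cfc_sub (fun t : ℝ => t) (fun _ => 1) h, cfc_id' ℝ h, cfc_const_one ℝ h]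
    rw [← h2]
    exact norm_apply_le_norm_cfc (fun t : ℝ => t - 1) h ht
  have hpos : ∀ t ∈ spectrum ℝ h, 0 < t := fun t ht => by
    linarith [neg_le_of_abs_le (hspec t ht)]
  let f : ℝ → ℝ := fun t => (√t)⁻¹
  have hf : ContinuousOn f (spectrum ℝ h) :=
    ContinuousOn.inv₀ (by fun_prop) fun t ht => (Real.sqrt_pos.2 (hpos t ht)).ne'
  refine ⟨cfc f h, cfc_predicate f h, ?_, fun b hb => ?_, fun h2 => ?_⟩
  · nth_rewrite 3 [← cfc_id' ℝ h]
    rw [← cfc_mul f f h, ← cfc_mul (fun t => f t * f t) (fun t => t) h (hf.mul hf),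
      ← cfc_const_one ℝ h]
    refine cfc_congr fun t ht => ?_
    have h3 := Real.mul_self_sqrt (hpos t ht).le
    have h4 := (Real.sqrt_pos.2 (hpos t ht)).ne'
    simp only [f]
    nth_rewrite 3 [← h3]
    field_simp
  · exact hb.cfc_real f
  · rw [← cfc_const_one ℝ h, ← cfc_sub f (fun _ => 1) h hf]
    rw [cfc_const_one ℝ h]
    refine norm_cfc_le (by positivity) fun t ht => ?_
    refine le_trans ?_ (mul_le_mul_of_nonneg_left (hspec t ht) zero_le_two)
    have ht2 : 1 / 2 ≤ t := by linarith [neg_le_of_abs_le (hspec t ht)]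
    have h3 := Real.mul_self_sqrt (hpos t ht).le
    have h4 := Real.sqrt_pos.2 (hpos t ht)
    -- Then `√t (1 + √t) ≥ 3 / 4`, more than enough for the factor `2`.
    have h5 : 1 / 2 ≤ √t := Real.le_sqrt_of_sq_le (by linarith)
    have h6 : f t - 1 = -(t - 1) / (√t * (1 + √t)) := by
      simp only [f]
      field_simp
      linear_combination (-1 : ℝ) * h3
    rw [h6, norm_div, norm_neg, Real.norm_eq_abs, Real.norm_of_nonneg (by positivity),
      div_le_iff₀ (by positivity)]
    nlinarith [abs_nonneg (t - 1), mul_nonneg (abs_nonneg (t - 1)) (sub_nonneg.2 h5)]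

/-- An almost unitary element is close to a unitary. -/
theorem exists_unitary_near {x : M} (h1 : ‖star x * x - 1‖ ≤ 1 / 2) (h2 : ‖x * star x - 1‖ < 1) :
    ∃ u ∈ unitary M, ‖u - x‖ ≤ ‖x‖ * (2 * ‖star x * x - 1‖) := by
  obtain ⟨r, hr, hrh, hc, hn⟩ := exists_inv_sqrt (IsSelfAdjoint.star_mul_self x)
    (h1.trans_lt (by norm_num))
  obtain ⟨s, -, hsk, -, -⟩ := exists_inv_sqrt (IsSelfAdjoint.mul_star_self x) h2
  have hrc : r * (star x * x) = star x * x * r := (hc _ rfl)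
  have hhr : star x * x * (r * r) = 1 := by
    rw [← hrh, ← mul_assoc, ← hrc, mul_assoc r, ← hrc, mul_assoc]
  -- This is `(x x*)⁻¹ x = x (x* x)⁻¹`. It shows that the polar part `x * r`, an isometry by
  -- construction, is also a coisometry.
  have hx : s * s * x = x * (r * r) := by
    calc s * s * x = s * s * x * (star x * x * (r * r)) := by rw [hhr, mul_one]
      _ = (s * s * (x * star x)) * (x * (r * r)) := by simp only [mul_assoc]
      _ = _ := by rw [hsk, one_mul]
  refine ⟨x * r, Unitary.mem_iff.2 ⟨?_, ?_⟩, ?_⟩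
  · rw [star_mul, hr.star_eq]
    calc r * star x * (x * r) = r * (star x * x * r) := by simp only [mul_assoc]
      _ = r * r * (star x * x) := by rw [← hrc, mul_assoc]
      _ = 1 := hrh
  · rw [star_mul, hr.star_eq]
    calc x * r * (r * star x) = x * (r * r) * star x := by simp only [mul_assoc]
      _ = s * s * (x * star x) := by rw [← hx, mul_assoc]
      _ = 1 := hsk
  · calc ‖x * r - x‖ = ‖x * (r - 1)‖ := by rw [mul_sub, mul_one]
      _ ≤ ‖x‖ * ‖r - 1‖ := norm_mul_le _ _
      _ ≤ _ := by gcongr; exact hn h1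

end Perturbation

/-! ### Almost equivalent matrix projections -/

section MatrixPerturbation

attribute [local instance] CStarAlgebra.spectralOrder CStarAlgebra.spectralOrderedRing

variable {E : Type*} [CStarAlgebra E] {ι κ : Type*} [Fintype ι] [Fintype κ]

/-- For finite matrices the entrywise topology agrees with that of the C*-norm, so entrywise
information about lifts feeds norm estimates. -/
theorem tendsto_norm_ofMatrix {x : ℕ → Matrix ι κ E}
    (h : ∀ i j, Tendsto (fun n => x n i j) atTop (𝓝 0)) :
    Tendsto (fun n => ‖CStarMatrix.ofMatrix (x n)‖) atTop (𝓝 0) := by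
  have h1 : Tendsto x atTop (𝓝 0) := tendsto_pi_nhds.2 fun i => tendsto_pi_nhds.2 fun j => h i j
  have h2 := ((CStarMatrix.ofMatrixL (m := ι) (n := κ) (A := E)).continuous.tendsto 0).comp h1
  rw [map_zero] at h2
  exact tendsto_zero_iff_norm_tendsto_zero.1 h2

variable [DecidableEq ι] [DecidableEq κ]

theorem exists_matrix_inv_sqrt (h : Matrix ι ι E) (hh : hᴴ = h)
    (hn : ‖CStarMatrix.ofMatrix (h - 1)‖ < 1) :
    ∃ r : Matrix ι ι E, rᴴ = r ∧ r * r * h = 1 ∧ ∀ b, h * b = b * h → r * b = b * r := by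
  obtain ⟨r, hr1, hr2, hr3, -⟩ := exists_inv_sqrt (M := CStarMatrix ι ι E)
    (h := CStarMatrix.ofMatrix h) hh hn
  exact ⟨r, hr1, hr2, hr3⟩

/-- Projections that are almost Murray--von Neumann equivalent are equivalent. -/
theorem MvN.of_near {p : Matrix ι ι E} {q : Matrix κ κ E} (hp : IsStarProjection p)
    (hq : IsStarProjection q) {w : Matrix κ ι E} (hwp : w * p = w) (hqw : q * w = w)
    (h1 : ‖CStarMatrix.ofMatrix (wᴴ * w - p)‖ < 1)
    (h2 : ‖CStarMatrix.ofMatrix (w * wᴴ - q)‖ < 1) : MvN p q := by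
  have hp1 : pᴴ = p := hp.isSelfAdjoint
  have hp2 : p * p = p := hp.isIdempotentElem
  have hq1 : qᴴ = q := hq.isSelfAdjoint
  have hq2 : q * q = q := hq.isIdempotentElem
  have hpw : p * wᴴ = wᴴ := by
    have := congrArg Matrix.conjTranspose hwp
    rwa [Matrix.conjTranspose_mul, hp1] at this
  have hwq : wᴴ * q = wᴴ := by
    have := congrArg Matrix.conjTranspose hqw
    rwa [Matrix.conjTranspose_mul, hq1] at this
  -- Adding `1 - p` makes `wᴴ * w` close to `1` in the full matrix algebra while leaving it
  -- unchanged under multiplication by `p`. The equivalence is then the polar part `w h^{-1/2}`.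
  set h := wᴴ * w + 1 - p with hdef
  set k := w * wᴴ + 1 - q with kdef
  obtain ⟨r, hr1, hr2, hr3⟩ := exists_matrix_inv_sqrt h
    (by simp [hdef, Matrix.conjTranspose_mul, hp1])
    (by rwa [hdef, add_sub_right_comm, add_sub_cancel_right])
  obtain ⟨s, -, hs2, -⟩ := exists_matrix_inv_sqrt k
    (by simp [kdef, Matrix.conjTranspose_mul, hq1])
    (by rwa [kdef, add_sub_right_comm, add_sub_cancel_right])
  have hph : p * h = wᴴ * w := by
    rw [hdef, Matrix.mul_sub, Matrix.mul_add, ← Matrix.mul_assoc, hpw, Matrix.mul_one, hp2,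
      add_sub_cancel_right]
  have hhp : h * p = wᴴ * w := by
    rw [hdef, Matrix.sub_mul, Matrix.add_mul, Matrix.mul_assoc, hwp, Matrix.one_mul, hp2,
      add_sub_cancel_right]
  have hkq : k * q = w * wᴴ := by
    rw [kdef, Matrix.sub_mul, Matrix.add_mul, Matrix.mul_assoc, hwq, Matrix.one_mul, hq2,
      add_sub_cancel_right]
  -- The intertwining passes to inverses, as `s * s * w = w * (r * r)`, which identifies the range
  -- projection of `w * r` with `q`.
  have hkw : k * w = w * h := by
    rw [kdef, hdef, Matrix.sub_mul, Matrix.add_mul, Matrix.mul_sub, Matrix.mul_add, hqw, hwp,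
      Matrix.one_mul, Matrix.mul_one, Matrix.mul_assoc]
  have hrp : r * p = p * r := hr3 p (hhp.trans hph.symm)
  have hrh : r * h = h * r := hr3 h rfl
  have hhr : h * (r * r) = 1 := by
    rw [← hr2, ← Matrix.mul_assoc, ← hrh, Matrix.mul_assoc r, ← hrh, Matrix.mul_assoc]
  have hw : s * s * w = w * (r * r) := by
    calc s * s * w = s * s * w * (h * (r * r)) := by rw [hhr, Matrix.mul_one]
      _ = s * s * (w * h) * (r * r) := by simp only [Matrix.mul_assoc]
      _ = s * s * k * w * (r * r) := by rw [← hkw]; simp only [Matrix.mul_assoc]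
      _ = _ := by rw [hs2, Matrix.one_mul]
  refine ⟨w * r, ?_, ?_⟩
  · rw [Matrix.conjTranspose_mul, hr1]
    calc r * wᴴ * (w * r) = r * (wᴴ * w) * r := by simp only [Matrix.mul_assoc]
      _ = p * (r * (h * r)) := by rw [← hph, ← Matrix.mul_assoc r p, hrp]; simp only [Matrix.mul_assoc]
      _ = p := by rw [← hrh, ← Matrix.mul_assoc r, hr2, Matrix.mul_one]
  · rw [Matrix.conjTranspose_mul, hr1]
    calc w * r * (r * wᴴ) = w * (r * r) * wᴴ := by simp only [Matrix.mul_assoc]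
      _ = s * s * (w * wᴴ) := by rw [← hw, Matrix.mul_assoc]
      _ = q := by rw [← hkq, ← Matrix.mul_assoc, hs2, Matrix.one_mul]

end MatrixPerturbation

/-! ### Calculus of sequential lifts of matrices -/

section Lift

open Rokhlin

variable {E : Type*} [NonUnitalCStarAlgebra E] {ι κ ν : Type*}

/-- A sequence of matrices over `E` that represents a matrix over `E_∞`. -/
def IsLift (P : Matrix ι κ (SeqAlg E)) (x : ℕ → Matrix ι κ E) : Prop :=
  ∀ i j, ∃ y : BddSeq E, (nullSeq E).proj y = P i j ∧ ∀ n, y n = x n i j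

theorem exists_isLift (P : Matrix ι κ (SeqAlg E)) : ∃ x, IsLift P x := by
  choose y hy using fun i j => proj_surjective (P i j)
  exact ⟨fun n => Matrix.of fun i j => y i j n, fun i j => ⟨y i j, hy i j, fun n => rfl⟩⟩

theorem IsLift.tendsto {P : Matrix ι κ (SeqAlg E)} {x y : ℕ → Matrix ι κ E} (hx : IsLift P x)
    (hy : IsLift P y) (i : ι) (j : κ) : Tendsto (fun n => (x n - y n) i j) atTop (𝓝 0) := by
  obtain ⟨x', h1, h2⟩ := hx i j
  obtain ⟨y', h3, h4⟩ := hy i j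
  refine (proj_eq_proj_iff.1 (h1.trans h3.symm)).congr fun n => ?_
  rw [h2, h4, Matrix.sub_apply]

theorem IsLift.congr {P : Matrix ι κ (SeqAlg E)} {x y : ℕ → Matrix ι κ E} (hx : IsLift P x)
    (h : ∀ i j, Tendsto (fun n => (y n - x n) i j) atTop (𝓝 0)) : IsLift P y := by
  intro i j
  obtain ⟨x', h1, h2⟩ := hx i j
  obtain ⟨c, hc⟩ := (h i j).norm.bddAbove_range
  have hb : ∀ n, ‖y n i j‖ ≤ c + ‖x'‖ := by
    intro n
    have h3 : ‖(y n - x n) i j‖ ≤ c := hc ⟨n, rfl⟩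
    have h4 := x'.norm_apply_le n
    have h5 := norm_add_le ((y n - x n) i j) (x n i j)
    rw [Matrix.sub_apply, sub_add_cancel] at h5
    rw [h2] at h4
    rw [Matrix.sub_apply] at h3
    linarith
  refine ⟨BddSeq.ofBound (fun n => y n i j) _ hb, ?_, fun n => rfl⟩
  rw [← h1, proj_eq_proj_iff]
  refine (h i j).congr fun n => ?_
  rw [BddSeq.ofBound_apply, h2, Matrix.sub_apply]

theorem IsLift.add {P Q : Matrix ι κ (SeqAlg E)} {x y : ℕ → Matrix ι κ E} (hx : IsLift P x)
    (hy : IsLift Q y) : IsLift (P + Q) fun n => x n + y n := by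
  intro i j
  obtain ⟨x', h1, h2⟩ := hx i j
  obtain ⟨y', h3, h4⟩ := hy i j
  refine ⟨x' + y', by rw [map_add, h1, h3, Matrix.add_apply], fun n => ?_⟩
  exact congrArg₂ (· + ·) (h2 n) (h4 n)

theorem IsLift.sub {P Q : Matrix ι κ (SeqAlg E)} {x y : ℕ → Matrix ι κ E} (hx : IsLift P x)
    (hy : IsLift Q y) : IsLift (P - Q) fun n => x n - y n := by
  intro i j
  obtain ⟨x', h1, h2⟩ := hx i j
  obtain ⟨y', h3, h4⟩ := hy i j
  refine ⟨x' - y', by rw [map_sub, h1, h3, Matrix.sub_apply], fun n => ?_⟩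
  exact congrArg₂ (· - ·) (h2 n) (h4 n)

theorem IsLift.smul {P : Matrix ι κ (SeqAlg E)} {x : ℕ → Matrix ι κ E} (hx : IsLift P x)
    (c : ℂ) : IsLift (c • P) fun n => c • x n := by
  intro i j
  obtain ⟨x', h1, h2⟩ := hx i j
  refine ⟨c • x', by rw [map_smul, h1, Matrix.smul_apply], fun n => ?_⟩
  exact congrArg (c • ·) (h2 n)

theorem IsLift.conjTranspose {P : Matrix ι κ (SeqAlg E)} {x : ℕ → Matrix ι κ E}
    (hx : IsLift P x) : IsLift Pᴴ fun n => (x n)ᴴ := by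
  intro i j
  obtain ⟨x', h1, h2⟩ := hx j i
  refine ⟨star x', by rw [map_star, h1, Matrix.conjTranspose_apply], fun n => ?_⟩
  exact congrArg star (h2 n)

theorem IsLift.mul [Fintype κ] {P : Matrix ι κ (SeqAlg E)} {Q : Matrix κ ν (SeqAlg E)}
    {x : ℕ → Matrix ι κ E} {y : ℕ → Matrix κ ν E} (hx : IsLift P x) (hy : IsLift Q y) :
    IsLift (P * Q) fun n => x n * y n := by
  intro i j
  choose x' h1 h2 using fun k => hx i k
  choose y' h3 h4 using fun k => hy k j
  refine ⟨∑ k, x' k * y' k, ?_, fun n => ?_⟩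
  · rw [map_sum, Matrix.mul_apply]
    exact Finset.sum_congr rfl fun k _ => by rw [map_mul, h1, h3]
  · show (∑ k, x' k * y' k : BddSeq E) n = ∑ k, x n i k * y n k j
    rw [lp.coeFn_sum, Finset.sum_apply]
    exact Finset.sum_congr rfl fun k _ => by rw [← h2, ← h4]; rfl

theorem IsLift.const (p : Matrix ι κ E) : IsLift (p.map (toSeqAlg E)) fun _ => p :=
  fun i j => ⟨constSeq E (p i j), rfl, fun _ => rfl⟩

theorem IsLift.map {F : Type*} [NonUnitalCStarAlgebra F] (φ : E →⋆ₙₐ[ℂ] F)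
    {P : Matrix ι κ (SeqAlg E)} {x : ℕ → Matrix ι κ E} (hx : IsLift P x) :
    IsLift (P.map (seqAlgMap φ)) fun n => (x n).map φ := by
  intro i j
  obtain ⟨x', h1, h2⟩ := hx i j
  refine ⟨bddSeqMap φ x', ?_, fun n => ?_⟩
  · rw [Matrix.map_apply, ← h1, seqAlgMap_proj]
  · exact congrArg φ (h2 n)

theorem IsLift.fromBlocks {ι' κ' : Type*} {P : Matrix ι κ (SeqAlg E)} {Q : Matrix ι' κ' (SeqAlg E)}
    {x : ℕ → Matrix ι κ E} {y : ℕ → Matrix ι' κ' E} (hx : IsLift P x) (hy : IsLift Q y) :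
    IsLift (Matrix.fromBlocks P 0 0 Q) fun n => Matrix.fromBlocks (x n) 0 0 (y n) := by
  rintro (i | i) (j | j)
  · exact hx i j
  · exact ⟨0, map_zero _, fun _ => rfl⟩
  · exact ⟨0, map_zero _, fun _ => rfl⟩
  · exact hy i j

theorem IsLift.submatrix {ι' κ' : Type*} {P : Matrix ι κ (SeqAlg E)} {x : ℕ → Matrix ι κ E}
    (hx : IsLift P x) (e : ι' → ι) (f : κ' → κ) :
    IsLift (P.submatrix e f) fun n => (x n).submatrix e f :=
  fun i j => hx (e i) (f j)

end Lift

/-! ### Lifting projections, equivalences and unitaries -/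

section LiftProjection

attribute [local instance] CStarAlgebra.spectralOrder CStarAlgebra.spectralOrderedRing

open Rokhlin

variable {E : Type*} [CStarAlgebra E] {ι κ : Type*} [Fintype ι] [Fintype κ]

theorem IsLift.congr_norm {P : Matrix ι κ (SeqAlg E)} {x y : ℕ → Matrix ι κ E} (hx : IsLift P x)
    {b : ℕ → ℝ} (hb : Tendsto b atTop (𝓝 0))
    (h : ∀ᶠ n in atTop, ‖CStarMatrix.ofMatrix (y n - x n)‖ ≤ b n) : IsLift P y := by
  refine hx.congr fun i j => ?_
  refine squeeze_zero_norm' (h.mono fun n hn => le_trans ?_ hn) hb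
  exact CStarMatrix.norm_entry_le_norm (M := CStarMatrix.ofMatrix (y n - x n))

variable [DecidableEq ι] [DecidableEq κ]

/-- Projections in matrices over `E_∞` lift to sequences of projections. -/
theorem exists_isLift_isStarProjection {P : Matrix ι ι (SeqAlg E)} (hP : IsStarProjection P) :
    ∃ q, IsLift P q ∧ ∀ n, IsStarProjection (q n) := by
  have hP1 : Pᴴ = P := hP.isSelfAdjoint
  have hP2 : P * P = P := hP.isIdempotentElem
  obtain ⟨x, hx⟩ := exists_isLift P
  -- Averaging with the adjoint gives a self-adjoint lift, as functional calculus requires.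
  let y : ℕ → Matrix ι ι E := fun n => (1 / 2 : ℂ) • (x n + (x n)ᴴ)
  have hy : IsLift P y := by
    have := (hx.add hx.conjTranspose).smul (1 / 2 : ℂ)
    rwa [hP1, ← two_smul ℂ P, smul_smul, show (1 / 2 * 2 : ℂ) = 1 by norm_num, one_smul] at this
  have hys : ∀ n, (y n)ᴴ = y n := fun n => by
    simp only [y, Matrix.conjTranspose_smul, Matrix.conjTranspose_add,
      Matrix.conjTranspose_conjTranspose, add_comm]
    norm_num
  have hyy := hy.mul hy
  rw [hP2] at hyy
  have hlim := tendsto_norm_ofMatrix (hyy.tendsto hy)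
  -- At the finitely many `n` where `y n` is not yet almost idempotent, `q` is set to `0`; this does
  -- not affect the class.
  have key : ∀ n, ∃ q : Matrix ι ι E, IsStarProjection q ∧
      (‖CStarMatrix.ofMatrix (y n * y n - y n)‖ < 1 / 4 →
        ‖CStarMatrix.ofMatrix (q - y n)‖ ≤ 2 * ‖CStarMatrix.ofMatrix (y n * y n - y n)‖) := by
    intro n
    by_cases h : ‖CStarMatrix.ofMatrix (y n * y n - y n)‖ < 1 / 4
    · obtain ⟨q, hq, hqy⟩ := exists_isStarProjection_near (M := CStarMatrix ι ι E)
        (y := CStarMatrix.ofMatrix (y n)) (hys n) h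
      exact ⟨q, ⟨hq.isIdempotentElem, hq.isSelfAdjoint⟩, fun _ => hqy⟩
    · exact ⟨0, .zero _, fun h' => (h h').elim⟩
  choose q hq hqy using key
  refine ⟨q, hy.congr_norm (by simpa using hlim.const_mul 2) ?_, hq⟩
  filter_upwards [hlim.eventually (gt_mem_nhds (by norm_num : (0 : ℝ) < 1 / 4))] with n hn
  exact hqy n hn

/-- Murray--von Neumann equivalences over `E_∞` lift along projection lifts. -/
theorem eventually_mvn_of_isLift {p : ℕ → Matrix ι ι E} {q : ℕ → Matrix κ κ E}
    (hp : ∀ n, IsStarProjection (p n)) (hq : ∀ n, IsStarProjection (q n))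
    {V : Matrix κ ι (SeqAlg E)} (hlp : IsLift (Vᴴ * V) p) (hlq : IsLift (V * Vᴴ) q)
    (hV : V * Vᴴ * V = V) : ∀ᶠ n in atTop, MvN (p n) (q n) := by
  obtain ⟨v, hv⟩ := exists_isLift V
  -- The compression `q n * v n * p n` is exactly supported between the two projections and is still
  -- a lift of `V`, since `V * Vᴴ * V = V`.
  have hw := (hlq.mul hv).mul hlp
  rw [hV, ← Matrix.mul_assoc, hV] at hw
  have h1 := tendsto_norm_ofMatrix ((hw.conjTranspose.mul hw).tendsto hlp)
  have h2 := tendsto_norm_ofMatrix ((hw.mul hw.conjTranspose).tendsto hlq)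
  filter_upwards [h1.eventually (gt_mem_nhds one_pos), h2.eventually (gt_mem_nhds one_pos)]
    with n hn1 hn2
  have hp2 : p n * p n = p n := (hp n).isIdempotentElem
  have hq2 : q n * q n = q n := (hq n).isIdempotentElem
  refine MvN.of_near (hp n) (hq n) (w := q n * v n * p n) ?_ ?_ hn1 hn2
  · rw [Matrix.mul_assoc, hp2]
  · rw [← Matrix.mul_assoc, ← Matrix.mul_assoc, hq2]

/-- Unitary matrices over `E_∞` lift to sequences of unitary matrices. -/
theorem exists_isLift_unitary {U : Matrix ι ι (SeqAlg E)}
    (h1 : Uᴴ * U = (1 : Matrix ι ι E).map (toSeqAlg E))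
    (h2 : U * Uᴴ = (1 : Matrix ι ι E).map (toSeqAlg E)) :
    ∃ u : ℕ → unitary (Matrix ι ι E), IsLift U fun n => (u n).1 := by
  obtain ⟨x, hx⟩ := exists_isLift U
  have hl1 := hx.conjTranspose.mul hx
  have hl2 := hx.mul hx.conjTranspose
  rw [h1] at hl1
  rw [h2] at hl2
  have ht1 := tendsto_norm_ofMatrix (hl1.tendsto (IsLift.const 1))
  have ht2 := tendsto_norm_ofMatrix (hl2.tendsto (IsLift.const 1))
  -- From `‖x n‖² = ‖(x n)ᴴ * x n‖`, where the product differs from `1` by a null sequence. The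
  -- bound is needed because the distance to the nearby unitary is controlled by `‖x n‖` times the
  -- defect.
  have hbd : ∃ c, ∀ n, ‖CStarMatrix.ofMatrix (x n)‖ ≤ c := by
    obtain ⟨c, hc⟩ := ht1.bddAbove_range
    refine ⟨√(c + ‖(1 : CStarMatrix ι ι E)‖), fun n => Real.le_sqrt_of_sq_le ?_⟩
    have h3 : ‖CStarMatrix.ofMatrix ((x n)ᴴ * x n - 1)‖ ≤ c := hc ⟨n, rfl⟩
    have h4 : star (CStarMatrix.ofMatrix (x n)) * CStarMatrix.ofMatrix (x n)
      = CStarMatrix.ofMatrix ((x n)ᴴ * x n - 1) + 1 := (sub_add_cancel _ _).symm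
    rw [sq, ← CStarRing.norm_star_mul_self, h4]
    exact (norm_add_le _ _).trans (by gcongr)
  obtain ⟨c, hc⟩ := hbd
  have key : ∀ n, ∃ u : unitary (Matrix ι ι E),
      (‖CStarMatrix.ofMatrix ((x n)ᴴ * x n - 1)‖ ≤ 1 / 2 →
        ‖CStarMatrix.ofMatrix (x n * (x n)ᴴ - 1)‖ < 1 →
        ‖CStarMatrix.ofMatrix (u.1 - x n)‖
          ≤ c * (2 * ‖CStarMatrix.ofMatrix ((x n)ᴴ * x n - 1)‖)) := by
    intro n
    by_cases h : ‖CStarMatrix.ofMatrix ((x n)ᴴ * x n - 1)‖ ≤ 1 / 2 ∧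
        ‖CStarMatrix.ofMatrix (x n * (x n)ᴴ - 1)‖ < 1
    · obtain ⟨u, hu, hux⟩ := exists_unitary_near (M := CStarMatrix ι ι E)
        (x := CStarMatrix.ofMatrix (x n)) h.1 h.2
      refine ⟨⟨u, Unitary.mem_iff.2 (Unitary.mem_iff.1 hu)⟩, fun _ _ => hux.trans ?_⟩
      exact mul_le_mul_of_nonneg_right (hc n) (by positivity)
    · exact ⟨1, fun h' h'' => (h ⟨h', h''⟩).elim⟩
  choose u hu using key
  refine ⟨u, hx.congr_norm (b := fun n => c * (2 * ‖CStarMatrix.ofMatrix ((x n)ᴴ * x n - 1)‖))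
    (by simpa using (ht1.const_mul 2).const_mul c) ?_⟩
  filter_upwards [ht1.eventually (gt_mem_nhds (by norm_num : (0 : ℝ) < 1 / 2)),
    ht2.eventually (gt_mem_nhds one_pos)] with n hn1 hn2
  exact hu n hn1.le hn2

end LiftProjection

end KTheory
end

/-! ### Sequentially split equalizers and `K₀` -/

noncomputable section

namespace KTheory

open Rokhlin

/-- Data exhibiting a unital `*`-homomorphism `j : E → F` as a sequentially split equalizer of
`c₀, c₁ : F → H`. -/
structure SeqSplitEqualizer {E F H : Type*} [CStarAlgebra E] [CStarAlgebra F] [CStarAlgebra H]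
    (j : E →⋆ₐ[ℂ] F) (c₀ c₁ : F →⋆ₐ[ℂ] H) (Θ : F →⋆ₙₐ[ℂ] SeqAlg E) (Ψ : H →⋆ₙₐ[ℂ] SeqAlg F) :
    Prop where
  comp_eq : ∀ x, c₀ (j x) = c₁ (j x)
  map_one_left : Θ 1 = toSeqAlg E 1
  map_one_right : Ψ 1 = toSeqAlg F 1
  left_split : ∀ x, Θ (j x) = toSeqAlg E x
  right_split : ∀ y, Ψ (c₁ y) = toSeqAlg F y
  compat : ∀ y, Ψ (c₀ y) = seqAlgMap j.toNonUnitalStarAlgHom (Θ y)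

section VMonoidLift

variable {E F : Type*} [CStarAlgebra E] [CStarAlgebra F]

/-- The sequence `s` in `V(E)` represents the image of `a ∈ V(F)` under `Θ : F → E_∞`. -/
def VMonoid.IsLift (Θ : F →⋆ₙₐ[ℂ] SeqAlg E) (a : VMonoid F) (s : ℕ → VMonoid E) : Prop :=
  ∃ (m : ℕ) (p : Matrix (Fin m) (Fin m) F) (hp : IsStarProjection p)
    (x : ℕ → Matrix (Fin m) (Fin m) E) (hx : ∀ n, IsStarProjection (x n)),
    a = VMonoid.mk ⟨m, p, hp⟩ ∧ (∀ n, s n = VMonoid.mk ⟨m, x n, hx n⟩) ∧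
      KTheory.IsLift (p.map Θ) x

theorem isStarProjection_map {R S : Type*} [NonUnitalCStarAlgebra R] [NonUnitalCStarAlgebra S]
    (φ : R →⋆ₙₐ[ℂ] S) {ι : Type*} [Fintype ι] {p : Matrix ι ι R} (hp : IsStarProjection p) :
    IsStarProjection (p.map φ) := by
  have h1 : pᴴ = p := hp.isSelfAdjoint
  have h2 : p * p = p := hp.isIdempotentElem
  constructor
  · show _ * _ = _
    rw [← Matrix.map_mul, h2]
  · show (_)ᴴ = _
    rw [← Matrix.conjTranspose_map (f := φ) (fun x => map_star φ x), h1]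

theorem VMonoid.exists_isLift (Θ : F →⋆ₙₐ[ℂ] SeqAlg E) (a : VMonoid F) :
    ∃ s, VMonoid.IsLift Θ a s := by
  obtain ⟨⟨m, p, hp⟩⟩ := a
  obtain ⟨x, hx, hxp⟩ := exists_isLift_isStarProjection (isStarProjection_map Θ hp)
  exact ⟨fun n => VMonoid.mk ⟨m, x n, hxp n⟩, m, p, hp, x, hxp, rfl, fun n => rfl, hx⟩

theorem VMonoid.IsLift.add {Θ : F →⋆ₙₐ[ℂ] SeqAlg E} {a b : VMonoid F} {s t : ℕ → VMonoid E}
    (h : VMonoid.IsLift Θ a s) (h' : VMonoid.IsLift Θ b t) :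
    VMonoid.IsLift Θ (a + b) fun n => s n + t n := by
  obtain ⟨m, p, hp, x, hx, rfl, hs, hl⟩ := h
  obtain ⟨m', p', hp', x', hx', rfl, ht, hl'⟩ := h'
  refine ⟨m + m', (MatProj.dsum ⟨m, p, hp⟩ ⟨m', p', hp'⟩).2.1, (MatProj.dsum _ _).2.2,
    fun n => (MatProj.dsum ⟨m, x n, hx n⟩ ⟨m', x' n, hx' n⟩).2.1,
    fun n => (MatProj.dsum _ _).2.2, rfl, fun n => ?_, ?_⟩
  · exact congrArg₂ (· + ·) (hs n) (ht n)
  · have := (hl.fromBlocks hl').submatrix (finSumFinEquiv (m := m) (n := m')).symm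
      (finSumFinEquiv (m := m) (n := m')).symm
    have e : ((Matrix.fromBlocks p 0 0 p').submatrix (finSumFinEquiv (m := m) (n := m')).symm
        (finSumFinEquiv (m := m) (n := m')).symm).map Θ
        = (Matrix.fromBlocks (p.map Θ) 0 0 (p'.map Θ)).submatrix
          (finSumFinEquiv (m := m) (n := m')).symm (finSumFinEquiv (m := m) (n := m')).symm := by
      rw [← Matrix.submatrix_map, Matrix.fromBlocks_map, Matrix.map_zero _ (map_zero Θ),
        Matrix.map_zero _ (map_zero Θ)]
    rw [← e] at this
    exact this

/-- An equivalence over `F` maps to one over `E_∞`, which lifts to eventual equivalences. So `Θ`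
induces a well-defined map from `V(F)` to sequences in `V(E)` modulo finitely many terms. -/
theorem VMonoid.IsLift.eventually_eq {Θ : F →⋆ₙₐ[ℂ] SeqAlg E} {a : VMonoid F}
    {s t : ℕ → VMonoid E} (h : VMonoid.IsLift Θ a s) (h' : VMonoid.IsLift Θ a t) :
    ∀ᶠ n in atTop, s n = t n := by
  obtain ⟨m, p, hp, x, hx, ha, hs, hl⟩ := h
  obtain ⟨m', q, hq, y, hy, ha', ht, hl'⟩ := h'
  have hpq : MvN p q := Quotient.exact (ha.symm.trans ha')
  obtain ⟨v, hv1, hv2⟩ := hpq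
  have hp1 : pᴴ = p := hp.isSelfAdjoint
  have hp2 : p * p = p := hp.isIdempotentElem
  have hq1 : qᴴ = q := hq.isSelfAdjoint
  have hq2 : q * q = q := hq.isIdempotentElem
  -- Compressing `v` gives the identity `w * wᴴ * w = w` by pure algebra.
  set w := q * v * p with hw
  have hw1 : wᴴ * w = p := by
    calc wᴴ * w = pᴴ * vᴴ * (qᴴ * q) * v * p := by
          simp only [hw, Matrix.conjTranspose_mul, Matrix.mul_assoc]
      _ = p * (vᴴ * v) * (vᴴ * v) * p := by
          rw [hp1, hq1, hq2, ← hv2]; simp only [Matrix.mul_assoc]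
      _ = p := by rw [hv1, hp2, hp2, hp2]
  have hw2 : w * wᴴ = q := by
    calc w * wᴴ = q * v * (p * pᴴ) * vᴴ * qᴴ := by
          simp only [hw, Matrix.conjTranspose_mul, Matrix.mul_assoc]
      _ = q * (v * vᴴ) * (v * vᴴ) * q := by
          rw [hp1, hq1, hp2, ← hv1]; simp only [Matrix.mul_assoc]
      _ = q := by rw [hv2, hq2, hq2, hq2]
  have hw3 : w * wᴴ * w = w := by rw [hw2, hw, ← Matrix.mul_assoc, ← Matrix.mul_assoc, hq2]
  have hstar : (w.map Θ)ᴴ = wᴴ.map Θ :=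
    (Matrix.conjTranspose_map (f := Θ) (fun x => map_star Θ x)).symm
  have key := eventually_mvn_of_isLift hx hy (V := w.map Θ)
    (by rwa [hstar, ← Matrix.map_mul, hw1]) (by rwa [hstar, ← Matrix.map_mul, hw2])
    (by rw [hstar, ← Matrix.map_mul, ← Matrix.map_mul, hw3])
  filter_upwards [key] with n hn
  rw [hs, ht]
  exact Quotient.sound hn

/-- A one-sided inverse on `V`: where `Θ ∘ j` is the canonical embedding, constant sequences serve
as lifts. -/
theorem VMonoid.isLift_map_const {Θ : F →⋆ₙₐ[ℂ] SeqAlg E} {j : E →⋆ₐ[ℂ] F}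
    (h : ∀ x, Θ (j x) = toSeqAlg E x) (a : VMonoid E) :
    VMonoid.IsLift Θ (VMonoid.map j a) fun _ => a := by
  obtain ⟨⟨m, p, hp⟩⟩ := a
  refine ⟨m, _, (MatProj.map j ⟨m, p, hp⟩).2.2, fun _ => p, fun _ => hp, rfl, fun _ => rfl, ?_⟩
  convert IsLift.const p using 1
  ext i k
  exact h _

/-- The level of `V` for the compatibility `Ψ ∘ c = j_∞ ∘ Θ`: a lift along `Θ`, pushed forward by
`j`, is a lift along `Ψ`. -/
theorem VMonoid.IsLift.map_map {H : Type*} [CStarAlgebra H] {j : E →⋆ₐ[ℂ] F} {c : F →⋆ₐ[ℂ] H}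
    {Θ : F →⋆ₙₐ[ℂ] SeqAlg E} {Ψ : H →⋆ₙₐ[ℂ] SeqAlg F}
    (hc : ∀ y, Ψ (c y) = seqAlgMap j.toNonUnitalStarAlgHom (Θ y)) {a : VMonoid F}
    {s : ℕ → VMonoid E} (h : VMonoid.IsLift Θ a s) :
    VMonoid.IsLift Ψ (VMonoid.map c a) fun n => VMonoid.map j (s n) := by
  obtain ⟨m, p, hp, x, hx, rfl, hs, hl⟩ := h
  refine ⟨m, _, (MatProj.map c ⟨m, p, hp⟩).2.2, fun n => (x n).map j,
    fun n => (MatProj.map j ⟨m, x n, hx n⟩).2.2, rfl, fun n => ?_, ?_⟩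
  · exact congrArg (VMonoid.map j) (hs n)
  · have := hl.map j.toNonUnitalStarAlgHom
    have e : (p.map c).map Ψ = (p.map Θ).map (seqAlgMap j.toNonUnitalStarAlgHom) := by
      ext i k
      exact hc _
    rw [← e] at this
    exact this

theorem K00.exists_eq_sub {B : Type*} [Ring B] [StarRing B] (x : K00 B) :
    ∃ a b : VMonoid B, x = Algebra.GrothendieckAddGroup.of a - Algebra.GrothendieckAddGroup.of b := by
  obtain ⟨⟨a, b⟩, h⟩ := (AddLocalization.addMonoidOf (⊤ : AddSubmonoid (VMonoid B))).surj x
  exact ⟨a, b, eq_sub_of_add_eq h⟩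

theorem K00.of_eq_of_iff {B : Type*} [Ring B] [StarRing B] {a b : VMonoid B} :
    (Algebra.GrothendieckAddGroup.of a : K00 B) = Algebra.GrothendieckAddGroup.of b ↔
      ∃ c, c + a = c + b := by
  refine ((AddLocalization.addMonoidOf (⊤ : AddSubmonoid (VMonoid B))).eq_iff_exists).trans ?_
  exact ⟨fun ⟨c, hc⟩ => ⟨c, hc⟩, fun ⟨c, hc⟩ => ⟨⟨c, trivial⟩, hc⟩⟩

variable {H : Type*} [CStarAlgebra H] {j : E →⋆ₐ[ℂ] F} {c₀ c₁ : F →⋆ₐ[ℂ] H}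
  {Θ : F →⋆ₙₐ[ℂ] SeqAlg E} {Ψ : H →⋆ₙₐ[ℂ] SeqAlg F}

/-- Equality over `F` holds after adding some `c` in `V(F)`. The stabilizer `c` need not come from
`E`, but a late term `s n` of its lift along `Θ` stabilizes the equality over `E`. -/
theorem SeqSplitEqualizer.k00_map_injective (h : SeqSplitEqualizer j c₀ c₁ Θ Ψ) :
    Function.Injective (K00.map j) := by
  rw [injective_iff_map_eq_zero]
  intro x hx
  obtain ⟨a, b, rfl⟩ := K00.exists_eq_sub x
  rw [map_sub, sub_eq_zero, K00.map_of, K00.map_of, K00.of_eq_of_iff] at hx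
  obtain ⟨c, hc⟩ := hx
  obtain ⟨s, hs⟩ := VMonoid.exists_isLift Θ c
  have ha := hs.add (VMonoid.isLift_map_const h.left_split a)
  have hb := hs.add (VMonoid.isLift_map_const h.left_split b)
  rw [hc] at ha
  obtain ⟨n, hn⟩ := (ha.eventually_eq hb).exists
  rw [sub_eq_zero, K00.of_eq_of_iff]
  exact ⟨s n, hn⟩

theorem SeqSplitEqualizer.k00_map_comp (h : SeqSplitEqualizer j c₀ c₁ Θ Ψ) (x : K00 E) :
    K00.map c₀ (K00.map j x) = K00.map c₁ (K00.map j x) := by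
  have key : ∀ a, VMonoid.map c₀ (VMonoid.map j a) = VMonoid.map c₁ (VMonoid.map j a) := by
    rintro ⟨p⟩
    refine congrArg (Quotient.mk _) (Sigma.ext rfl (heq_of_eq (Subtype.ext ?_)))
    ext i k
    exact h.comp_eq _
  obtain ⟨a, b, rfl⟩ := K00.exists_eq_sub x
  simp only [map_sub, K00.map_of, key]

/-- For `x = [a] - [b]` the hypothesis reads `c + c₀ a + c₁ b = c + c₁ a + c₀ b` in `V(H)`. Lifting
along `Ψ` replaces `c₁` by the identity and `c₀` by `j` of a lift along `Θ`, so a late term gives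
`[a] - [b] = j([a' n] - [b' n])`. -/
theorem SeqSplitEqualizer.k00_mem_range (h : SeqSplitEqualizer j c₀ c₁ Θ Ψ) (x : K00 F)
    (hx : K00.map c₀ x = K00.map c₁ x) : ∃ y, K00.map j y = x := by
  obtain ⟨a, b, rfl⟩ := K00.exists_eq_sub x
  rw [map_sub, map_sub, K00.map_of, K00.map_of, K00.map_of, K00.map_of, sub_eq_sub_iff_add_eq_add,
    ← map_add, ← map_add, K00.of_eq_of_iff] at hx
  obtain ⟨c, hc⟩ := hx
  obtain ⟨s, hs⟩ := VMonoid.exists_isLift Ψ c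
  obtain ⟨a', ha'⟩ := VMonoid.exists_isLift Θ a
  obtain ⟨b', hb'⟩ := VMonoid.exists_isLift Θ b
  have h1 := hs.add ((ha'.map_map h.compat).add (VMonoid.isLift_map_const h.right_split b))
  have h2 := hs.add ((VMonoid.isLift_map_const h.right_split a).add (hb'.map_map h.compat))
  rw [hc] at h1
  obtain ⟨n, hn⟩ := (h1.eventually_eq h2).exists
  refine ⟨Algebra.GrothendieckAddGroup.of (a' n) - Algebra.GrothendieckAddGroup.of (b' n), ?_⟩
  rw [map_sub, K00.map_of, K00.map_of, sub_eq_sub_iff_add_eq_add, ← map_add, ← map_add,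
    K00.of_eq_of_iff]
  exact ⟨s n, hn⟩

end VMonoidLift

/-! ### Homotopies of unitaries and sequential lifts -/

section UnitaryLift

attribute [local instance] CStarAlgebra.spectralOrder CStarAlgebra.spectralOrderedRing

variable {E F : Type*} [CStarAlgebra E] [CStarAlgebra F] {ι : Type*} [Fintype ι] [DecidableEq ι]

/-- Unitaries of a C*-algebra at distance less than `2` are joined by a path; the path is carried
from the C*-norm topology to the entrywise one. -/
theorem joined_of_norm_lt_two (u v : unitary (Matrix ι ι E))
    (h : ‖CStarMatrix.ofMatrix (v.1 - u.1)‖ < 2) : Joined u v := by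
  let u' : unitary (CStarMatrix ι ι E) := ⟨CStarMatrix.ofMatrix u.1, u.2⟩
  let v' : unitary (CStarMatrix ι ι E) := ⟨CStarMatrix.ofMatrix v.1, v.2⟩
  have h' : Joined u' v' := Unitary.joined u' v' h
  let f : unitary (CStarMatrix ι ι E) → unitary (Matrix ι ι E) := fun w => ⟨w.1, w.2⟩
  have hf : Continuous f := continuous_induced_rng.2
    ((CStarMatrix.ofMatrixL (m := ι) (n := ι) (A := E)).symm.continuous.comp
      continuous_subtype_val)
  exact h'.map hf

theorem exists_entry_bound (E ι : Type*) [CStarAlgebra E] [Fintype ι] :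
    ∃ δ > 0, ∀ x : Matrix ι ι E, (∀ i j, ‖x i j‖ < δ) → ‖CStarMatrix.ofMatrix x‖ < 2 := by
  have h1 : Tendsto (fun x : ι → ι → E => ‖CStarMatrix.ofMatrixL (m := ι) (n := ι) (A := E) x‖)
      (𝓝 0) (𝓝 0) := by
    have := (CStarMatrix.ofMatrixL (m := ι) (n := ι) (A := E)).continuous.norm.tendsto 0
    rwa [map_zero, norm_zero] at this
  obtain ⟨δ, hδ, hb⟩ := Metric.mem_nhds_iff.1 (h1.eventually (gt_mem_nhds two_pos))
  refine ⟨δ, hδ, fun x hx => ?_⟩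
  let y : ι → ι → E := x
  refine hb (?_ : dist y 0 < δ)
  refine (dist_pi_lt_iff hδ).2 fun i => (dist_pi_lt_iff hδ).2 fun j => ?_
  rw [dist_eq_norm]
  simpa [y] using hx i j

theorem unitary_map_isLift {Θ : F →⋆ₙₐ[ℂ] SeqAlg E} (h1 : Θ 1 = toSeqAlg E 1)
    (w : unitary (Matrix ι ι F)) :
    ∃ u : ℕ → unitary (Matrix ι ι E), IsLift (w.1.map Θ) fun n => (u n).1 := by
  have hone : (1 : Matrix ι ι F).map Θ = (1 : Matrix ι ι E).map (toSeqAlg E) := by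
    ext i j
    by_cases hij : i = j
    · subst hij
      simp [h1]
    · simp [hij]
  have hstar : (w.1.map Θ)ᴴ = (w.1ᴴ).map Θ :=
    (Matrix.conjTranspose_map (f := Θ) (fun x => map_star Θ x)).symm
  refine exists_isLift_unitary ?_ ?_
  · rw [hstar, ← Matrix.map_mul, ← hone]
    exact congrArg (fun x => Matrix.map x Θ) (Unitary.mem_iff.1 w.2).1
  · rw [hstar, ← Matrix.map_mul, ← hone]
    exact congrArg (fun x => Matrix.map x Θ) (Unitary.mem_iff.1 w.2).2

/-- Homotopic unitaries over `F` have eventually homotopic lifts along `Θ : F → E_∞`. -/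
theorem eventually_joined_of_isLift {Θ : F →⋆ₙₐ[ℂ] SeqAlg E} (h1 : Θ 1 = toSeqAlg E 1)
    {w w' : unitary (Matrix ι ι F)} (h : Joined w w') {u u' : ℕ → unitary (Matrix ι ι E)}
    (hu : IsLift (w.1.map Θ) fun n => (u n).1) (hu' : IsLift (w'.1.map Θ) fun n => (u' n).1) :
    ∀ᶠ n in atTop, Joined (u n) (u' n) := by
  obtain ⟨δ, hδ, hb⟩ := exists_entry_bound E ι
  obtain ⟨γ⟩ := h
  -- The homotopy itself is never lifted. Quantifying over all lifts at both ends makes `P`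
  -- symmetric and transitive, so by connectedness of the interval it only has to be checked
  -- locally.
  let P : unitInterval → unitInterval → Prop := fun t s =>
    ∀ u u' : ℕ → unitary (Matrix ι ι E), IsLift ((γ t).1.map Θ) (fun n => (u n).1) →
      IsLift ((γ s).1.map Θ) (fun n => (u' n).1) → ∀ᶠ n in atTop, Joined (u n) (u' n)
  have hsymm : ∀ t s, P t s → P s t := fun t s hts u u' hu hu' =>
    (hts u' u hu' hu).mono fun n hn => hn.symm
  have htrans : IsTrans _ P := ⟨fun t s r hts hsr u u' hu hu' => by
    obtain ⟨v, hv⟩ := unitary_map_isLift h1 (γ s)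
    filter_upwards [hts u v hu hv, hsr v u' hv hu'] with n hn hn'
    exact hn.trans hn'⟩
  -- `Θ` is contractive, so the lifts of nearby unitaries are eventually entrywise within `δ`, hence
  -- at distance less than `2`.
  have hloc : ∀ t, ∀ᶠ s in 𝓝 t, P t s := by
    intro t
    have hc : ∀ i j, ∀ᶠ s in 𝓝 t, ‖(γ s).1 i j - (γ t).1 i j‖ < δ := by
      intro i j
      have hcont : Continuous fun s => ‖(γ s).1 i j - (γ t).1 i j‖ :=
        (((continuous_subtype_val.comp γ.continuous).matrix_elem i j).sub continuous_const).norm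
      have := hcont.tendsto t
      rw [sub_self, norm_zero] at this
      exact this.eventually (gt_mem_nhds hδ)
    filter_upwards [eventually_all.2 fun i => eventually_all.2 fun j => hc i j] with s hs u u' hu hu'
    have hent : ∀ i j, ∀ᶠ n in atTop, ‖((u' n).1 - (u n).1) i j‖ < δ := by
      intro i j
      obtain ⟨y, hy1, hy2⟩ := (hu'.sub hu) i j
      have hy3 : ‖(nullSeq E).proj y‖ < δ := by
        rw [hy1, Matrix.sub_apply, Matrix.map_apply, Matrix.map_apply, ← map_sub]
        exact (NonUnitalStarAlgHom.norm_apply_le Θ _).trans_lt (hs i j)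
      filter_upwards [eventually_norm_lt_of_norm_proj_lt hy3] with n hn
      rwa [hy2] at hn
    filter_upwards [eventually_all.2 fun i => eventually_all.2 fun j => hent i j] with n hn
    exact joined_of_norm_lt_two _ _ (hb _ hn)
  have key := PreconnectedSpace.induction₂' P
    (fun t => (hloc t).mono fun s hs => ⟨hs, hsymm _ _ hs⟩) htrans 0 1
  exact key u u' (by rwa [γ.source]) (by rwa [γ.target])

end UnitaryLift

end KTheory
end

noncomputable section

namespace KTheory

open Rokhlin

/-! ### Stable unitaries and `K₁` -/

section UnitaryMap

variable {B C : Type*} [Ring B] [StarRing B] [Algebra ℂ B] [Ring C] [StarRing C] [Algebra ℂ C]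

/-- Entrywise application of a unital `*`-homomorphism to unitary matrices. -/
def unitaryMap (φ : B →⋆ₐ[ℂ] C) {n : ℕ} (u : unitary (Matrix (Fin n) (Fin n) B)) :
    unitary (Matrix (Fin n) (Fin n) C) :=
  (Unitary.map
    { toFun := fun u => u.map φ
      map_one' := Matrix.map_one _ (map_zero φ) (map_one φ)
      map_mul' := fun _ _ => Matrix.map_mul
      map_star' := fun _ => Matrix.conjTranspose_map (f := φ) (fun x => map_star φ x) } :
    unitary (Matrix (Fin n) (Fin n) B) →⋆* unitary (Matrix (Fin n) (Fin n) C)) u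

theorem unitaryPad_unitaryMap (φ : B →⋆ₐ[ℂ] C) {n m : ℕ} (h : n ≤ m)
    (u : unitary (Matrix (Fin n) (Fin n) B)) :
    unitaryPad h (unitaryMap φ u) = unitaryMap φ (unitaryPad h u) := by
  refine Subtype.ext ?_
  show padOne h (u.1.map φ) = (padOne h u.1).map φ
  ext i j
  simp only [padOne_apply, Matrix.map_apply]
  split_ifs <;> simp

end UnitaryMap

section StableUnitaries

variable {B : Type*} [Ring B] [StarRing B] [TopologicalSpace B] [IsTopologicalRing B]
  [ContinuousStar B]

/-- The class of a unitary matrix in the stable unitary group. -/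
def UStable.mk {n : ℕ} (u : unitary (Matrix (Fin n) (Fin n) B)) : UStable B :=
  ⟦⟨n, QuotientGroup.mk u⟩⟧

theorem UPi0.mk_eq_mk_iff {n : ℕ} {u v : unitary (Matrix (Fin n) (Fin n) B)} :
    (QuotientGroup.mk u : UPi0 B n) = QuotientGroup.mk v ↔ Joined u v := by
  rw [QuotientGroup.eq]
  constructor
  · intro h
    have h1 : Joined (1 : unitary (Matrix (Fin n) (Fin n) B)) (u⁻¹ * v) := h
    simpa using h1.map (continuous_const_mul u)
  · intro h
    have h1 := h.map (continuous_const_mul u⁻¹)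
    rw [inv_mul_cancel] at h1
    exact h1

theorem UStable.exists_eq_mk (x : UStable B) :
    ∃ (n : ℕ) (u : unitary (Matrix (Fin n) (Fin n) B)), x = UStable.mk u := by
  obtain ⟨n, u, rfl⟩ := DirectLimit.exists_eq_mk _ x
  obtain ⟨u, rfl⟩ := QuotientGroup.mk_surjective u
  exact ⟨n, u, rfl⟩

theorem UStable.exists_eq_mk₂ (x y : UStable B) :
    ∃ (n : ℕ) (u v : unitary (Matrix (Fin n) (Fin n) B)),
      x = UStable.mk u ∧ y = UStable.mk v := by
  obtain ⟨n, u, v, rfl, rfl⟩ := DirectLimit.exists_eq_mk₂ _ x y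
  obtain ⟨u, rfl⟩ := QuotientGroup.mk_surjective u
  obtain ⟨v, rfl⟩ := QuotientGroup.mk_surjective v
  exact ⟨n, u, v, rfl, rfl⟩

theorem UStable.mk_pad {n m : ℕ} (h : n ≤ m) (u : unitary (Matrix (Fin n) (Fin n) B)) :
    UStable.mk (unitaryPad h u) = UStable.mk u := by
  let x : UPi0 B n := QuotientGroup.mk u
  have key : (⟦⟨n, x⟩⟧ : UStable B) = ⟦⟨m, UPi0.pad B n m h x⟩⟧ :=
    DirectLimit.eq_of_le (f := UPi0.pad B) ⟨n, x⟩ m h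
  exact key.symm

/-- Equality in a direct limit is reached at a finite stage, where it is a homotopy by translation
invariance. -/
theorem UStable.mk_eq_mk_iff {n : ℕ} {u v : unitary (Matrix (Fin n) (Fin n) B)} :
    UStable.mk u = UStable.mk v ↔
      ∃ (m : ℕ) (h : n ≤ m), Joined (unitaryPad h u) (unitaryPad h v) := by
  constructor
  · intro h
    obtain ⟨m, h1, _, h2⟩ := Quotient.exact h
    exact ⟨m, h1, UPi0.mk_eq_mk_iff.1 h2⟩
  · rintro ⟨m, h, hj⟩
    rw [← UStable.mk_pad h u, ← UStable.mk_pad h v]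
    exact congrArg (fun x => (⟦⟨m, x⟩⟧ : UStable B)) (UPi0.mk_eq_mk_iff.2 hj)

variable {C : Type*} [Ring C] [StarRing C] [TopologicalSpace C] [IsTopologicalRing C]
  [ContinuousStar C] [Algebra ℂ B] [Algebra ℂ C]

theorem UStable.map_mk (φ : B →⋆ₐ[ℂ] C) (hφ : Continuous φ) {n : ℕ}
    (u : unitary (Matrix (Fin n) (Fin n) B)) :
    UStable.map φ hφ (UStable.mk u) = UStable.mk (unitaryMap φ u) := rfl

end StableUnitaries

section StableUnitariesSplit

variable {E F H : Type*} [CStarAlgebra E] [CStarAlgebra F] [CStarAlgebra H] {j : E →⋆ₐ[ℂ] F}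
  {c₀ c₁ : F →⋆ₐ[ℂ] H} {Θ : F →⋆ₙₐ[ℂ] SeqAlg E} {Ψ : H →⋆ₙₐ[ℂ] SeqAlg F}

theorem isLift_unitaryMap_const (hj : ∀ x, Θ (j x) = toSeqAlg E x) {n : ℕ}
    (u : unitary (Matrix (Fin n) (Fin n) E)) :
    IsLift ((unitaryMap j u).1.map Θ) fun _ => u.1 := by
  have e : (unitaryMap j u).1.map Θ = u.1.map (toSeqAlg E) := by
    ext i k
    exact hj _
  rw [e]
  exact IsLift.const _

/-- Constant sequences lift unitaries coming from `E`, so a homotopy over `F` forces one over `E`.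
-/
theorem SeqSplitEqualizer.uStable_map_injective (h : SeqSplitEqualizer j c₀ c₁ Θ Ψ)
    (hj : Continuous j) : Function.Injective (UStable.map j hj) := by
  intro x y hxy
  obtain ⟨n, u, v, rfl, rfl⟩ := UStable.exists_eq_mk₂ x y
  rw [UStable.map_mk, UStable.map_mk, UStable.mk_eq_mk_iff] at hxy
  obtain ⟨m, hm, hJ⟩ := hxy
  rw [unitaryPad_unitaryMap, unitaryPad_unitaryMap] at hJ
  have key := eventually_joined_of_isLift h.map_one_left hJ
    (u := fun _ => unitaryPad hm u) (u' := fun _ => unitaryPad hm v)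
    (isLift_unitaryMap_const h.left_split _) (isLift_unitaryMap_const h.left_split _)
  exact UStable.mk_eq_mk_iff.2 ⟨m, hm, key.exists.choose_spec⟩

theorem SeqSplitEqualizer.uStable_map_comp (h : SeqSplitEqualizer j c₀ c₁ Θ Ψ)
    (hj : Continuous j) (hc₀ : Continuous c₀) (hc₁ : Continuous c₁) (x : UStable E) :
    UStable.map c₀ hc₀ (UStable.map j hj x) = UStable.map c₁ hc₁ (UStable.map j hj x) := by
  obtain ⟨n, u, rfl⟩ := UStable.exists_eq_mk x
  simp only [UStable.map_mk]
  refine congrArg UStable.mk (Subtype.ext ?_)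
  ext i k
  exact h.comp_eq _

/-- After padding, `c₀ w` and `c₁ w` are homotopic. Along `Ψ` they lift to `j (v n)` and to the
constant `w`, where `v` lifts `w` along `Θ`; hence `w` is homotopic to `j (v n)` for late `n`. -/
theorem SeqSplitEqualizer.uStable_mem_range (h : SeqSplitEqualizer j c₀ c₁ Θ Ψ)
    (hj : Continuous j) (hc₀ : Continuous c₀) (hc₁ : Continuous c₁) (x : UStable F)
    (hx : UStable.map c₀ hc₀ x = UStable.map c₁ hc₁ x) : ∃ y, UStable.map j hj y = x := by
  obtain ⟨n, u, rfl⟩ := UStable.exists_eq_mk x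
  rw [UStable.map_mk, UStable.map_mk, UStable.mk_eq_mk_iff] at hx
  obtain ⟨m, hm, hJ⟩ := hx
  rw [unitaryPad_unitaryMap, unitaryPad_unitaryMap] at hJ
  rw [← UStable.mk_pad hm]
  set w := unitaryPad hm u
  obtain ⟨v, hv⟩ := unitary_map_isLift h.map_one_left w
  have hv' : IsLift ((unitaryMap c₀ w).1.map Ψ) fun n => (unitaryMap j (v n)).1 := by
    have e : (unitaryMap c₀ w).1.map Ψ = (w.1.map Θ).map (seqAlgMap j.toNonUnitalStarAlgHom) := by
      ext i k
      exact h.compat _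
    rw [e]
    exact hv.map j.toNonUnitalStarAlgHom
  have key := eventually_joined_of_isLift h.map_one_right hJ (u' := fun _ => w) hv'
    (isLift_unitaryMap_const h.right_split _)
  obtain ⟨k, hk⟩ := key.exists
  refine ⟨UStable.mk (v k), ?_⟩
  rw [UStable.map_mk]
  exact congrArg (fun x => (⟦⟨m, x⟩⟧ : UStable F)) (UPi0.mk_eq_mk_iff.2 hk)

end StableUnitariesSplit

/-! ### Passage to unitizations -/

section Unitize

variable {A B C : Type*} [NonUnitalCStarAlgebra A] [NonUnitalCStarAlgebra B]
  [NonUnitalCStarAlgebra C]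

theorem toSeqAlg_inl_mul (c : ℂ) (z : SeqAlg (Unitization ℂ B)) :
    toSeqAlg _ (Unitization.inl c) * z = c • z := by
  obtain ⟨z, rfl⟩ := proj_surjective z
  rw [← map_smul]
  refine (map_mul (nullSeq _).proj _ _).symm.trans (congrArg _ (lp.ext (funext fun n => ?_)))
  show Unitization.inl c * z n = c • z n
  rw [Algebra.smul_def]
  rfl

theorem mul_toSeqAlg_inl (c : ℂ) (z : SeqAlg (Unitization ℂ B)) :
    z * toSeqAlg _ (Unitization.inl c) = c • z := by
  obtain ⟨z, rfl⟩ := proj_surjective z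
  rw [← map_smul]
  refine (map_mul (nullSeq _).proj _ _).symm.trans (congrArg _ (lp.ext (funext fun n => ?_)))
  show z n * Unitization.inl c = c • z n
  rw [Algebra.smul_def, Algebra.commutes]
  rfl

/-- The unital extension `Ã → (B̃)_∞` of a `*`-homomorphism `A → B_∞`. -/
def unitizeSeq (Φ : A →⋆ₙₐ[ℂ] SeqAlg B) : Unitization ℂ A →⋆ₙₐ[ℂ] SeqAlg (Unitization ℂ B) where
  toFun x := toSeqAlg _ (Unitization.inl x.fst)
    + seqAlgMap (Unitization.inrNonUnitalStarAlgHom ℂ B) (Φ x.snd)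
  map_smul' c x := by
    simp only [Unitization.fst_smul, Unitization.snd_smul, map_smul, Unitization.inl_smul,
      smul_add, MonoidHom.id_apply]
  map_zero' := by simp
  map_add' x y := by
    simp only [Unitization.fst_add, Unitization.snd_add, map_add, Unitization.inl_add]
    abel
  map_mul' x y := by
    simp only [Unitization.fst_mul, Unitization.snd_mul, map_add, map_mul, map_smul,
      Unitization.inl_mul, add_mul, mul_add, toSeqAlg_inl_mul, mul_toSeqAlg_inl]
    abel
  map_star' x := by
    simp only [Unitization.fst_star, Unitization.snd_star, map_star, Unitization.inl_star,
      star_add]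

theorem unitizeSeq_apply (Φ : A →⋆ₙₐ[ℂ] SeqAlg B) (x : Unitization ℂ A) :
    unitizeSeq Φ x = toSeqAlg _ (Unitization.inl x.fst)
      + seqAlgMap (Unitization.inrNonUnitalStarAlgHom ℂ B) (Φ x.snd) := rfl

theorem unitizeSeq_one (Φ : A →⋆ₙₐ[ℂ] SeqAlg B) : unitizeSeq Φ 1 = toSeqAlg _ 1 := by
  rw [unitizeSeq_apply]
  simp

theorem fst_starMap (φ : A →⋆ₙₐ[ℂ] B) (x : Unitization ℂ A) :
    (Unitization.starMap φ x).fst = x.fst := by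
  induction x with
  | inl_add_inr r a => simp [Unitization.algebraMap_eq_inl]

theorem snd_starMap (φ : A →⋆ₙₐ[ℂ] B) (x : Unitization ℂ A) :
    (Unitization.starMap φ x).snd = φ x.snd := by
  induction x with
  | inl_add_inr r a => simp [Unitization.algebraMap_eq_inl]

theorem starMap_inl (φ : A →⋆ₙₐ[ℂ] B) (r : ℂ) :
    Unitization.starMap φ (Unitization.inl r) = Unitization.inl r :=
  Unitization.ext (fst_starMap φ _) ((snd_starMap φ _).trans (map_zero φ))

theorem starMap_inr (φ : A →⋆ₙₐ[ℂ] B) (a : A) :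
    Unitization.starMap φ (a : Unitization ℂ A) = (φ a : Unitization ℂ B) :=
  Unitization.ext (fst_starMap φ _) (snd_starMap φ _)

theorem seqAlgMap_inr_seqAlgMap (φ : A →⋆ₙₐ[ℂ] B) (z : SeqAlg A) :
    seqAlgMap (Unitization.inrNonUnitalStarAlgHom ℂ B) (seqAlgMap φ z)
      = seqAlgMap (Unitization.starMap φ).toNonUnitalStarAlgHom
        (seqAlgMap (Unitization.inrNonUnitalStarAlgHom ℂ A) z) := by
  obtain ⟨z, rfl⟩ := proj_surjective z
  refine congrArg (nullSeq _).proj (lp.ext (funext fun n => ?_))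
  exact (starMap_inr φ (z n)).symm

theorem unitizeSeq_of_eq {Φ : A →⋆ₙₐ[ℂ] SeqAlg B} {j : B →⋆ₙₐ[ℂ] A}
    (h : Φ.comp j = toSeqAlg B) (x : Unitization ℂ B) :
    unitizeSeq Φ (Unitization.starMap j x) = toSeqAlg _ x := by
  have h' : Φ (j x.snd) = toSeqAlg B x.snd := DFunLike.congr_fun h x.snd
  rw [unitizeSeq_apply, fst_starMap, snd_starMap, h', seqAlgMap_toSeqAlg, ← map_add]
  exact congrArg _ (Unitization.inl_fst_add_inr_snd_eq x)

/-- Unitization preserves the compatibility of the splittings: both sides fix the scalar part. -/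
theorem unitizeSeq_comp {θ : A →⋆ₙₐ[ℂ] SeqAlg B} {ψ : C →⋆ₙₐ[ℂ] SeqAlg A} {j : B →⋆ₙₐ[ℂ] A}
    {c : A →⋆ₙₐ[ℂ] C} (h : ψ.comp c = (seqAlgMap j).comp θ) (x : Unitization ℂ A) :
    unitizeSeq ψ (Unitization.starMap c x)
      = seqAlgMap (Unitization.starMap j).toNonUnitalStarAlgHom (unitizeSeq θ x) := by
  have h' : ψ (c x.snd) = seqAlgMap j (θ x.snd) := DFunLike.congr_fun h x.snd
  rw [unitizeSeq_apply, unitizeSeq_apply, fst_starMap, snd_starMap, h', map_add,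
    seqAlgMap_toSeqAlg, seqAlgMap_inr_seqAlgMap]
  congr 2
  exact (starMap_inl j x.fst).symm

/-- The K-theory of a sequentially split equalizer. -/
theorem kTheory_equalizer {j : B →⋆ₙₐ[ℂ] A} {c₀ c₁ : A →⋆ₙₐ[ℂ] C} {θ : A →⋆ₙₐ[ℂ] SeqAlg B}
    {ψ : C →⋆ₙₐ[ℂ] SeqAlg A} (hc : c₀.comp j = c₁.comp j) (hθ : θ.comp j = toSeqAlg B)
    (hψ : ψ.comp c₁ = toSeqAlg A) (hψθ : ψ.comp c₀ = (seqAlgMap j).comp θ) :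
    (Function.Injective (K0.map j) ∧
      Set.range (K0.map j) = {x | K0.map c₀ x = K0.map c₁ x}) ∧
    (Function.Injective (K1.map j) ∧
      Set.range (K1.map j) = {x | K1.map c₀ x = K1.map c₁ x}) := by
  have S : SeqSplitEqualizer (Unitization.starMap j) (Unitization.starMap c₀)
      (Unitization.starMap c₁) (unitizeSeq θ) (unitizeSeq ψ) :=
    { comp_eq := fun x => by
        have h' : c₀ (j x.snd) = c₁ (j x.snd) := DFunLike.congr_fun hc x.snd
        exact Unitization.ext (by simp only [fst_starMap]) (by simp only [snd_starMap, h'])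
      map_one_left := unitizeSeq_one θ
      map_one_right := unitizeSeq_one ψ
      left_split := unitizeSeq_of_eq hθ
      right_split := unitizeSeq_of_eq hψ
      compat := unitizeSeq_comp hψθ }
  refine ⟨⟨fun x y hxy => ?_, Set.Subset.antisymm ?_ ?_⟩, S.uStable_map_injective _,
    Set.Subset.antisymm ?_ ?_⟩
  · exact Subtype.ext (S.k00_map_injective (congrArg Subtype.val hxy))
  · rintro _ ⟨x, rfl⟩
    exact Subtype.ext (S.k00_map_comp x.1)
  · intro x hx
    obtain ⟨y, hy⟩ := S.k00_mem_range x.1 (congrArg Subtype.val hx)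
    -- The preimage found over the unitization already lies in `K₀(B)`, because the characters are
    -- compatible with `j`.
    have hy0 : K00.map (unitizationChar B) y = 0 := by
      rw [← K00_char_map j, hy]
      exact x.2
    exact ⟨⟨y, hy0⟩, Subtype.ext hy⟩
  · rintro _ ⟨x, rfl⟩
    exact S.uStable_map_comp _ _ _ x
  · intro x hx
    exact S.uStable_mem_range _ _ _ x hx

end Unitize

end KTheory

end

-- The main theorem

universe u v

theorem theorem4p11 {A : Type u} {G : Type v} [NonUnitalCStarAlgebra A]
    [TopologicalSpace.SeparableSpace A] [Group G] [TopologicalSpace G] [IsTopologicalGroup G]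
    [CompactSpace G] [T2Space G] [SecondCountableTopology G]
    (α : G →* (A ≃⋆ₐ[ℂ] A)) (hα : ∀ a, Continuous fun g => α g a)
    (hR : Rokhlin.HasRokhlinProperty α) :
    (Function.Injective (KTheory.K0.map (Rokhlin.fixedIncl α)) ∧
      Set.range (KTheory.K0.map (Rokhlin.fixedIncl α)) =
        {x | KTheory.K0.map (Rokhlin.coaction α hα) x =
          KTheory.K0.map (Rokhlin.constEmb A G) x}) ∧
    (Function.Injective (KTheory.K1.map (Rokhlin.fixedIncl α)) ∧
      Set.range (KTheory.K1.map (Rokhlin.fixedIncl α)) =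
        {x | KTheory.K1.map (Rokhlin.coaction α hα) x =
          KTheory.K1.map (Rokhlin.constEmb A G) x}) ∧
    ∀ n : ℕ, 2 ≤ n →
      (Function.Injective (KTheory.K0Mod.map.{max u v} n (Rokhlin.fixedIncl α)) ∧
        Set.range (KTheory.K0Mod.map.{max u v} n (Rokhlin.fixedIncl α)) =
          {x | KTheory.K0Mod.map.{max u v} n (Rokhlin.coaction α hα) x =
            KTheory.K0Mod.map.{max u v} n (Rokhlin.constEmb A G) x}) ∧
      (Function.Injective (KTheory.K1Mod.map.{max u v} n (Rokhlin.fixedIncl α)) ∧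
        Set.range (KTheory.K1Mod.map.{max u v} n (Rokhlin.fixedIncl α)) =
          {x | KTheory.K1Mod.map.{max u v} n (Rokhlin.coaction α hα) x =
            KTheory.K1Mod.map.{max u v} n (Rokhlin.constEmb A G) x}) := by
  obtain ⟨ψ, θ, hψ, hψθ, hθ⟩ := hR.exists_splitting hα
  have hc : (Rokhlin.coaction α hα).comp (Rokhlin.fixedIncl α)
      = (Rokhlin.constEmb A G).comp (Rokhlin.fixedIncl α) := by
    ext a g
    exact a.2 g
  obtain ⟨h0, h1⟩ := KTheory.kTheory_equalizer hc hθ hψ hψθ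
  refine ⟨h0, h1, fun n _ => ?_⟩
  -- Coefficients enter only as a fixed tensor factor: all four identities for `θ` and `ψ` persist
  -- for `θ ⊗ id` and `ψ ⊗ id`, the ones involving these maps by a check on elementary tensors.
  obtain ⟨θ', hθ'⟩ := Rokhlin.exists_tensor_seqAlg.{max u v}
    (B := Rokhlin.CuntzAlgebra (n + 1)) θ
  obtain ⟨ψ', hψ'⟩ := Rokhlin.exists_tensor_seqAlg.{max u v}
    (B := Rokhlin.CuntzAlgebra (n + 1)) ψ
  refine KTheory.kTheory_equalizer (j := Rokhlin.MaxTensor.map (Rokhlin.fixedIncl α))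
    (c₀ := Rokhlin.MaxTensor.map (Rokhlin.coaction α hα))
    (c₁ := Rokhlin.MaxTensor.map (Rokhlin.constEmb A G)) (θ := θ') (ψ := ψ') ?_ ?_ ?_ ?_
  · rw [← Rokhlin.MaxTensor.map_comp, hc, Rokhlin.MaxTensor.map_comp]
  · refine Rokhlin.MaxTensor.hom_ext fun a b => ?_
    refine (hθ' _ b).trans ?_
    rw [← Rokhlin.seqTmul_toSeqAlg]
    exact congrArg (Rokhlin.seqTmul · b) (DFunLike.congr_fun hθ a)
  · refine Rokhlin.MaxTensor.hom_ext fun a b => ?_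
    refine (hψ' _ b).trans ?_
    rw [← Rokhlin.seqTmul_toSeqAlg]
    exact congrArg (Rokhlin.seqTmul · b) (DFunLike.congr_fun hψ a)
  · refine Rokhlin.MaxTensor.hom_ext fun a b => ?_
    refine (hψ' _ b).trans ?_
    show _ = Rokhlin.seqAlgMap _ (θ' (Rokhlin.MaxTensor.tmul a b))
    rw [hθ', Rokhlin.seqAlgMap_map_seqTmul]
    exact congrArg (Rokhlin.seqTmul · b) (DFunLike.congr_fun hψθ a)
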